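/- **Setting.** Let $\mathcal A=\{a\in\mathbb R^d:\|a\|_p\le 1\}$ be the $\ell_p$ unit ball, and let $\nu$ be a probability distribution on $\mathbb R^d$ with mean $\theta^\star$ and covariance matrix $\Sigma$ such that $|a^\top\theta|\le 1$ for all $a\in\mathcal A$ almost surely for $\theta\sim\nu$. In rounds $t=1,\dots,T$ a (possibly randomized) bandit algorithm chooses $a_t\in\mathcal A$ on the basis of its internal randomness and its past observations, a parameter $\theta_t\sim\nu$ is drawn independently of the past, and the algorithm observes the reward $X_t=a_t^\top\theta_t$. Its regret is $\mathcal R_T=\sum_{t=1}^T(a^\star-a_t)^\top\theta^\star$ with $a^\star\in\arg\max_{a\in\mathcal A}a^\top\theta^\star$. For $q$ with $1/p+1/q=1$ put $\sigma_q^2=\bigl(\sum_{i=1}^d\Sigma_{ii}^{q/2}\bigr)^{2/q}$. **Theorem.** There is an absolute constant $k\in\mathbb N$, and for every $s<1$ there is a constant $c=c(s)>0$, such that the following holds for all $p\in(2,\infty]$ with dual exponent $q\in[1,2)$, all integers $d\ge 1$ and $T\ge d^{4/(2-q)}$, and all $\sigma^2\in(0,s]$. For every (possibly randomized) bandit algorithm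 on the $\ell_p$ unit ball of $\mathbb R^d$ there is a distribution $\nu$ as above with $\sigma_q^2=\sigma^2$ under which $$\mathbb E[\mathcal R_T]\;\ge\; \frac{c\,d\sqrt{T\sigma^2}}{(1+\log T)^k},$$ that is, $\mathbb E[\mathcal R_T]=\widetilde\Omega\bigl(d\sqrt{T\sigma^2}\bigr)$, where $\widetilde\Omega$ hides factors polylogarithmic in $T$. -/

import Mathlib

open MeasureTheory ProbabilityTheory

open scoped ENNReal

namespace ParameterNoiseBandit

/-- The closed unit ball of the `ℓ_p` norm on `ℝ^d` (with `p = ∞` allowed). -/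
def lpBall (d : ℕ) (p : ℝ≥0∞) : Set (Fin d → ℝ) :=
  {a | ‖WithLp.toLp p a‖ ≤ 1}

/-- A (possibly randomized) bandit algorithm with action set `A`: in round `t` (counted from `0`)
it chooses an action as a measurable function of its internal random seed, an element of `S`, and
of the rewards observed in the rounds before `t`. The past actions are themselves functions of
the seed and of the past rewards, so they need not be listed among the arguments. -/
structure Algorithm {d : ℕ} (A : Set (Fin d → ℝ)) (S : Type*) [MeasurableSpace S] where
  act : (t : ℕ) → S → (Fin t → ℝ) → (Fin d → ℝ)
  measurable_act : ∀ t : ℕ, Measurable (fun z : S × (Fin t → ℝ) => act t z.1 z.2)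
  act_mem : ∀ (t : ℕ) (s : S) (r : Fin t → ℝ), act t s r ∈ A

section Interaction

variable {d : ℕ} {A : Set (Fin d → ℝ)} {S : Type*} [MeasurableSpace S]

/-- The rewards `X_0, …, X_{t-1}` of the first `t` rounds, `X_i = a_i ⬝ᵥ θ_i`, when the seed of the
algorithm is `s` and the environment produces the parameters `θ_0, θ_1, …`. -/
def Algorithm.rewards (alg : Algorithm A S) (s : S) (θ : ℕ → Fin d → ℝ) :
    (t : ℕ) → (Fin t → ℝ)
  | 0 => Fin.elim0
  | t + 1 => Fin.snoc (alg.rewards s θ t) (alg.act t s (alg.rewards s θ t) ⬝ᵥ θ t)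

/-- The action played in round `t`. -/
def Algorithm.action (alg : Algorithm A S) (s : S) (θ : ℕ → Fin d → ℝ) (t : ℕ) : Fin d → ℝ :=
  alg.act t s (alg.rewards s θ t)

/-- The expectation `θ⋆` of the parameter distribution `ν`. -/
noncomputable def meanVec (ν : Measure (Fin d → ℝ)) : Fin d → ℝ :=
  fun i => ∫ θ, θ i ∂ν

/-- The covariance matrix `Σ` of the parameter distribution `ν`. -/
noncomputable def covMatrix (ν : Measure (Fin d → ℝ)) : Matrix (Fin d) (Fin d) ℝ :=
  Matrix.of fun i j => covariance (fun θ : Fin d → ℝ => θ i) (fun θ : Fin d → ℝ => θ j) ν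

/-- `σ_q² = (∑ i, Σ_ii ^ (q / 2)) ^ (2 / q)`. -/
noncomputable def sigmaSq (q : ℝ) (ν : Measure (Fin d → ℝ)) : ℝ :=
  (∑ i, (covMatrix ν i i) ^ (q / 2)) ^ (2 / q)

/-- The pseudo-regret `∑_{t < T} (a⋆ - a_t) ⬝ᵥ θ⋆` against the action `a⋆`. -/
noncomputable def Algorithm.regret (alg : Algorithm A S) (ν : Measure (Fin d → ℝ))
    (aStar : Fin d → ℝ) (T : ℕ) (s : S) (θ : ℕ → Fin d → ℝ) : ℝ :=
  ∑ t ∈ Finset.range T, (aStar - alg.action s θ t) ⬝ᵥ meanVec ν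

/-- The expected pseudo-regret when the seed has law `μ` and, independently of it, the parameters
`θ_0, θ_1, …` are i.i.d. with law `ν`. -/
noncomputable def Algorithm.expectedRegret (alg : Algorithm A S) (μ : Measure S)
    (ν : Measure (Fin d → ℝ)) [IsProbabilityMeasure ν] (aStar : Fin d → ℝ) (T : ℕ) : ℝ :=
  ∫ z, alg.regret ν aStar T z.1 z.2 ∂(μ.prod (Measure.infinitePi fun _ : ℕ => ν))

end Interaction

end ParameterNoiseBandit

namespace ParameterNoiseBandit

/-! ### The interaction of algorithm and environment, and the chain rule for information. -/

section Interaction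

variable {d : ℕ} {A : Set (Fin d → ℝ)} {S : Type*} [MeasurableSpace S]

/-! With `n = d - 1`, the hard instance hides `n` unknown signs behind one noisy but attractive
coordinate. The parameter is `σ (m + ζ, y)`. Here `ζ` is a centred noise of constant size, and `y`
is a point of a sphere in `ℝ^n` whose uniform law is tilted by the density `1 + κ ⟨signs, y⟩`. The
mean is then `σ m (1, ± z^(1/q), …)` with `z = c / √T`.

Coordinate `0` dominates the mean, so an action with `a 0 < 1/2` loses a constant in that round. An
action with `a 0 ≥ 1/2` receives a reward that contains `a 0 * ζ`. The smooth density of `ζ` blurs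
the contribution of `y`, and the information on sign `i` is only of order `κ² v² (a i)²`, instead of
`κ² v (a i)² / ∑ (a j)²` (`sq_integral_coord_mul_le_of_noise`, `sq_integral_coord_mul_le`). For `p >
2` the best weight on a small coordinate is about `z^(1-1/q)`, and a relative deviation `l - 1` from
it costs `z/2 * (l - 1)²` (`dot_hardMean_le_sub`). Playing that weight for `T` rounds yields
information of order `c²` per sign, which is too little to learn it. A wrong sign costs order `σ m
z` per round, hence a regret of order `n T σ m c / √T`.

The trade-off is made precise by a Kullback–Leibler argument in variational form, `E_P G ≤ log E_P'
exp G + info`. It is proved for one reward in `integral_tilt_le_log`, chained over the rounds in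
`Algorithm.integral_rewards_le_log`, and averaged over all sign vectors in
`Algorithm.exists_le_expectedRegret`. The latter needs one inequality per action, bounding errors
plus information by regret, which is `sum_wrongSign_add_hardInfo_le`. The condition `T ≥
d^(4/(2-q))` keeps the tilt a density, and lets the regret of an action with `a 0 < 1/2` pay for all
the information it collects.

The variances must match `σ2` exactly while rewards stay in `[-1, 1]`, for `σ2` up to any `s < 1`.
Hence the noise is nearly two-valued and `y` has constant Euclidean norm, so that the support is
hardly larger than the standard deviations. The gap between `s` and `1` pays for `m`. For `d = 1`
there is no coordinate to hide behind and a biased coin suffices. No logarithm is lost. -/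

lemma Algorithm.rewards_congr (alg : Algorithm A S) (s : S) {θ θ' : ℕ → Fin d → ℝ} {t : ℕ}
    (h : ∀ i < t, θ i = θ' i) : alg.rewards s θ t = alg.rewards s θ' t := by
  induction t with
  | zero => rfl
  | succ t ih =>
    have h1 := ih fun i hi => h i (by omega)
    simp only [Algorithm.rewards, h1, h t (by omega)]

lemma measurable_snoc (t : ℕ) :
    Measurable (fun z : (Fin t → ℝ) × ℝ => (Fin.snoc z.1 z.2 : Fin (t + 1) → ℝ)) := by
  rw [measurable_pi_iff]
  intro i
  refine Fin.lastCases ?_ (fun j => ?_) i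
  · simpa using measurable_snd
  · simp only [Fin.snoc_castSucc]
    fun_prop

lemma measurable_dot {d : ℕ} :
    Measurable (fun z : (Fin d → ℝ) × (Fin d → ℝ) => z.1 ⬝ᵥ z.2) := by
  unfold dotProduct
  fun_prop

lemma Algorithm.measurable_rewards (alg : Algorithm A S) (t : ℕ) :
    Measurable (fun z : S × (ℕ → Fin d → ℝ) => alg.rewards z.1 z.2 t) := by
  induction t with
  | zero => exact measurable_const
  | succ t ih =>
    have h1 : Measurable (fun z : S × (ℕ → Fin d → ℝ) =>
        alg.act t z.1 (alg.rewards z.1 z.2 t)) :=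
      (alg.measurable_act t).comp (measurable_fst.prodMk ih)
    have h2 : Measurable (fun z : S × (ℕ → Fin d → ℝ) => z.2 t) :=
      (measurable_pi_apply t).comp measurable_snd
    exact (measurable_snoc t).comp (ih.prodMk (measurable_dot.comp (h1.prodMk h2)))

lemma Algorithm.measurable_action (alg : Algorithm A S) (t : ℕ) :
    Measurable (fun z : S × (ℕ → Fin d → ℝ) => alg.action z.1 z.2 t) :=
  (alg.measurable_act t).comp (measurable_fst.prodMk (alg.measurable_rewards t))

lemma Algorithm.measurable_act_right (alg : Algorithm A S) (s : S) (t : ℕ) :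
    Measurable (alg.act t s) :=
  (alg.measurable_act t).comp measurable_prodMk_left

lemma Algorithm.measurable_rewards_right (alg : Algorithm A S) (s : S) (t : ℕ) :
    Measurable (fun θ => alg.rewards s θ t) :=
  (alg.measurable_rewards t).comp measurable_prodMk_left

lemma Algorithm.measurable_action_right (alg : Algorithm A S) (s : S) (t : ℕ) :
    Measurable (fun θ => alg.action s θ t) :=
  (alg.measurable_action t).comp measurable_prodMk_left

lemma Algorithm.action_mem (alg : Algorithm A S) (s : S) (θ : ℕ → Fin d → ℝ) (t : ℕ) :
    alg.action s θ t ∈ A := alg.act_mem _ _ _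

/-- The rewards before round `t` are independent of the parameter of round `t`. -/
lemma Algorithm.indepFun_rewards (alg : Algorithm A S) (s : S) (ν : Measure (Fin d → ℝ))
    [IsProbabilityMeasure ν] (t : ℕ) :
    IndepFun (fun θ => alg.rewards s θ t) (fun θ : ℕ → Fin d → ℝ => θ t)
      (Measure.infinitePi fun _ : ℕ => ν) := by
  have h0 : iIndepFun (fun (i : ℕ) (θ : ℕ → Fin d → ℝ) => θ i)
      (Measure.infinitePi fun _ : ℕ => ν) :=
    iIndepFun_infinitePi (P := fun _ : ℕ => ν) (X := fun _ x => x) fun _ => measurable_id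
  have h1 := h0.indepFun_finset (Finset.range t) {t} (by simp) fun i => measurable_pi_apply i
  let e : (Finset.range t → Fin d → ℝ) → ℕ → Fin d → ℝ :=
    fun z i => if h : i ∈ Finset.range t then z ⟨i, h⟩ else 0
  have he : Measurable e := by
    rw [measurable_pi_iff]
    intro i
    by_cases h : i ∈ Finset.range t
    · simp only [e, dif_pos h]
      fun_prop
    · simp only [e, dif_neg h]
      fun_prop
  have h2 := h1.comp (φ := fun z => alg.rewards s (e z) t)
    (ψ := fun z : ({t} : Finset ℕ) → Fin d → ℝ => z ⟨t, by simp⟩)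
    ((alg.measurable_rewards_right s t).comp he)
    (measurable_pi_apply (X := fun _ : ({t} : Finset ℕ) => Fin d → ℝ) _)
  convert! h2 using 2 with θ
  refine alg.rewards_congr s fun i hi => ?_
  simp [e, hi]

/-- Independence of the past from the current parameter turns the joint law into a product, so the
current round can be integrated out with the past frozen. -/
lemma Algorithm.integral_rewards_param (alg : Algorithm A S) (s : S) (ν : Measure (Fin d → ℝ))
    [IsProbabilityMeasure ν] (t : ℕ) {F : (Fin t → ℝ) × (Fin d → ℝ) → ℝ} (hF : Measurable F)
    {K : ℝ} (hK : ∀ z, |F z| ≤ K) :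
    ∫ θ, F (alg.rewards s θ t, θ t) ∂(Measure.infinitePi fun _ : ℕ => ν)
      = ∫ θ, ∫ η, F (alg.rewards s θ t, η) ∂ν ∂(Measure.infinitePi fun _ : ℕ => ν) := by
  set P := Measure.infinitePi fun _ : ℕ => ν
  have hm1 := alg.measurable_rewards_right s t
  have hm2 : Measurable fun θ : ℕ → Fin d → ℝ => θ t := measurable_pi_apply t
  have h1 := (indepFun_iff_map_prod_eq_prod_map_map hm1.aemeasurable hm2.aemeasurable).1
    (alg.indepFun_rewards s ν t)
  have h2 : P.map (fun θ : ℕ → Fin d → ℝ => θ t) = ν := Measure.infinitePi_map_eval _ t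
  rw [h2] at h1
  have : IsProbabilityMeasure (P.map (fun θ => alg.rewards s θ t)) :=
    Measure.isProbabilityMeasure_map hm1.aemeasurable
  have h3 := integral_map (μ := P) (hm1.prodMk hm2).aemeasurable hF.aestronglyMeasurable
  rw [← h3, h1, integral_prod, integral_map hm1.aemeasurable]
  · exact (hF.stronglyMeasurable.integral_prod_right' (ν := ν)).aestronglyMeasurable
  · exact Integrable.of_bound hF.aestronglyMeasurable K (ae_of_all _ hK)

/-- A bound on the expectation of a function of one reward, in the variational form of the
Kullback–Leibler divergence, chains over the rounds. -/
lemma Algorithm.integral_rewards_le_log (alg : Algorithm A S) (s : S)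
    (ν ν' : Measure (Fin d → ℝ)) [IsProbabilityMeasure ν] [IsProbabilityMeasure ν']
    {info : (Fin d → ℝ) → ℝ} (hinfo : Measurable info) {K : ℝ} (hK : ∀ a ∈ A, |info a| ≤ K)
    (hstep : ∀ a ∈ A, ∀ G : ℝ → ℝ, Measurable G → (∀ y, 0 ≤ G y) → (∀ y, G y ≤ 1) →
      ∫ η, G (a ⬝ᵥ η) ∂ν ≤ Real.log (∫ η, Real.exp (G (a ⬝ᵥ η)) ∂ν') + info a)
    (t : ℕ) {F : (Fin t → ℝ) → ℝ} (hF : Measurable F) (hF0 : ∀ r, 0 ≤ F r)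
    (hF1 : ∀ r, F r ≤ 1) :
    ∫ θ, F (alg.rewards s θ t) ∂(Measure.infinitePi fun _ : ℕ => ν)
      ≤ Real.log (∫ θ, Real.exp (F (alg.rewards s θ t)) ∂(Measure.infinitePi fun _ : ℕ => ν'))
        + ∑ j ∈ Finset.range t, ∫ θ, info (alg.action s θ j)
            ∂(Measure.infinitePi fun _ : ℕ => ν) := by
  induction t with
  | zero =>
    simp [Algorithm.rewards]
  | succ t ih =>
    set P := Measure.infinitePi fun _ : ℕ => ν
    set P' := Measure.infinitePi fun _ : ℕ => ν'
    let D : (Fin t → ℝ) × (Fin d → ℝ) → ℝ := fun z => F (Fin.snoc z.1 (alg.act t s z.1 ⬝ᵥ z.2))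
    have hD : Measurable D := by
      have h : Measurable (fun z : (Fin t → ℝ) × (Fin d → ℝ) => (alg.act t s z.1, z.2)) :=
        ((alg.measurable_act_right s t).comp measurable_fst).prodMk measurable_snd
      exact hF.comp ((measurable_snoc t).comp (measurable_fst.prodMk (measurable_dot.comp h)))
    have hDeq : ∀ θ, F (alg.rewards s θ (t + 1)) = D (alg.rewards s θ t, θ t) := fun θ => rfl
    have hexp1 : ∀ y : ℝ, 0 ≤ y → y ≤ 1 → 1 ≤ Real.exp y ∧ Real.exp y ≤ Real.exp 1 :=
      fun y h0 h1 => ⟨Real.one_le_exp h0, Real.exp_le_exp.2 h1⟩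
    let I : (Fin t → ℝ) → ℝ := fun r => ∫ η, Real.exp (D (r, η)) ∂ν'
    have hIm : Measurable I :=
      ((Real.measurable_exp.comp hD).stronglyMeasurable.integral_prod_right' (ν := ν')).measurable
    have hint : ∀ r, Integrable (fun η => Real.exp (D (r, η))) ν' := fun r =>
      Integrable.of_bound (Real.measurable_exp.comp
        (hD.comp measurable_prodMk_left)).aestronglyMeasurable (Real.exp 1)
        (ae_of_all _ fun η => by
          rw [Real.norm_eq_abs, abs_of_pos (Real.exp_pos _)]
          exact (hexp1 _ (hF0 _) (hF1 _)).2)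
    have hI1 : ∀ r, 1 ≤ I r := fun r => by
      have := integral_mono (μ := ν') (integrable_const (1 : ℝ)) (hint r)
        fun η => (hexp1 _ (hF0 _) (hF1 _)).1
      simpa using this
    have hI2 : ∀ r, I r ≤ Real.exp 1 := fun r => by
      have := integral_mono (μ := ν') (hint r) (integrable_const (Real.exp 1))
        fun η => (hexp1 _ (hF0 _) (hF1 _)).2
      simpa using this
    have hL0 : ∀ r, 0 ≤ Real.log (I r) := fun r => Real.log_nonneg (hI1 r)
    have hL1 : ∀ r, Real.log (I r) ≤ 1 := fun r => by
      rw [Real.log_le_iff_le_exp (by linarith [hI1 r])]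
      exact hI2 r
    -- The conditional log-Laplace transform of the last round again takes values in `[0, 1]`,
    -- because `1 ≤ I ≤ e`. It is therefore an admissible statistic of the earlier rounds, and
    -- exponentiating it gives back `I`.
    have hih := ih (F := fun r => Real.log (I r)) (Real.measurable_log.comp hIm) hL0 hL1
    have hexpI : ∀ r, Real.exp (Real.log (I r)) = I r := fun r =>
      Real.exp_log (by linarith [hI1 r])
    simp only [hexpI] at hih
    have hP' : ∫ θ, Real.exp (F (alg.rewards s θ (t + 1))) ∂P'
        = ∫ θ, I (alg.rewards s θ t) ∂P' := by
      simp only [hDeq]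
      exact alg.integral_rewards_param s ν' t (F := fun z => Real.exp (D z))
        (Real.measurable_exp.comp hD) (K := Real.exp 1) fun z => by
          rw [abs_of_pos (Real.exp_pos _)]
          exact (hexp1 _ (hF0 _) (hF1 _)).2
    have hDb : ∀ z, |D z| ≤ 1 := fun z => abs_le.2 ⟨by linarith [hF0 (Fin.snoc z.1
      (alg.act t s z.1 ⬝ᵥ z.2) : Fin (t+1) → ℝ)], hF1 _⟩
    have hP : ∫ θ, F (alg.rewards s θ (t + 1)) ∂P
        = ∫ θ, ∫ η, D (alg.rewards s θ t, η) ∂ν ∂P := by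
      simp only [hDeq]
      exact alg.integral_rewards_param s ν t hD hDb
    have hi1 : Integrable (fun θ => ∫ η, D (alg.rewards s θ t, η) ∂ν) P := by
      refine Integrable.of_bound ((hD.stronglyMeasurable.integral_prod_right'
        (ν := ν)).measurable.comp (alg.measurable_rewards_right s t)).aestronglyMeasurable 1
        (ae_of_all _ fun θ => ?_)
      refine (norm_integral_le_of_norm_le_const (ae_of_all _ fun η => hDb _)).trans ?_
      simp
    have hi2 : Integrable (fun θ => Real.log (I (alg.rewards s θ t))) P :=
      Integrable.of_bound ((Real.measurable_log.comp hIm).comp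
        (alg.measurable_rewards_right s t)).aestronglyMeasurable 1
        (ae_of_all _ fun θ => by
          rw [Real.norm_eq_abs, abs_of_nonneg (hL0 _)]
          exact hL1 _)
    have hi3 : Integrable (fun θ => info (alg.action s θ t)) P :=
      Integrable.of_bound (hinfo.comp (alg.measurable_action_right s t)).aestronglyMeasurable K
        (ae_of_all _ fun θ => hK _ (alg.action_mem _ _ _))
    have hmain : ∫ θ, ∫ η, D (alg.rewards s θ t, η) ∂ν ∂P
        ≤ ∫ θ, (Real.log (I (alg.rewards s θ t)) + info (alg.action s θ t)) ∂P := by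
      refine integral_mono hi1 (hi2.add hi3) fun θ => ?_
      -- With the past frozen, the action is fixed and the statistic depends on the new reward
      -- alone.
      exact hstep (alg.act t s (alg.rewards s θ t)) (alg.act_mem _ _ _)
        (fun y => F (Fin.snoc (alg.rewards s θ t) y))
        (hF.comp ((measurable_snoc t).comp measurable_prodMk_left))
        (fun y => hF0 _) (fun y => hF1 _)
    rw [integral_add hi2 hi3] at hmain
    rw [hP, hP', Finset.sum_range_succ]
    linarith

end Interaction

/-! ### Sign vectors and sign errors. -/

/-- The sign `±1` encoded by a Boolean. -/
def sgn (b : Bool) : ℝ := if b then 1 else -1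

@[simp] lemma sgn_not (b : Bool) : sgn (!b) = -sgn b := by cases b <;> simp [sgn]

@[simp] lemma sgn_mul_self (b : Bool) : sgn b * sgn b = 1 := by cases b <;> simp [sgn]

@[simp] lemma abs_sgn (b : Bool) : |sgn b| = 1 := by cases b <;> simp [sgn]

/-- The sign vector `x` with coordinate `i` flipped. -/
def flip {n : ℕ} (x : Fin n → Bool) (i : Fin n) : Fin n → Bool := Function.update x i (!x i)

@[simp] lemma flip_self {n : ℕ} (x : Fin n → Bool) (i : Fin n) : flip x i i = !x i := by
  simp [flip]

lemma flip_of_ne {n : ℕ} (x : Fin n → Bool) {i j : Fin n} (h : j ≠ i) : flip x i j = x j := by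
  simp [flip, h]

lemma flip_flip {n : ℕ} (x : Fin n → Bool) (i : Fin n) : flip (flip x i) i = x := by
  simp [flip]

lemma sum_flip {n : ℕ} (i : Fin n) (f : (Fin n → Bool) → ℝ) : ∑ x, f (flip x i) = ∑ x, f x :=
  Equiv.sum_comp (Function.Involutive.toPerm (fun x => flip x i) fun x => flip_flip x i) f

/-- The indicator that `y` fails to have the sign `b`. -/
noncomputable def wrongSign (b : Bool) (y : ℝ) : ℝ := if sgn b * y ≤ 0 then 1 else 0

lemma wrongSign_nonneg (b : Bool) (y : ℝ) : 0 ≤ wrongSign b y := by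
  unfold wrongSign; split_ifs <;> norm_num

lemma wrongSign_le_one (b : Bool) (y : ℝ) : wrongSign b y ≤ 1 := by
  unfold wrongSign; split_ifs <;> norm_num

lemma measurable_wrongSign (b : Bool) : Measurable (wrongSign b) :=
  Measurable.ite (measurableSet_le (measurable_const_mul _) measurable_const)
    measurable_const measurable_const

/-- If `y` has sign `b` strictly, then it fails to have the opposite sign, and `e ≤ 3`. At `y = 0`
both signs count as wrong, which only helps. -/
lemma exp_one_sub_wrongSign_le (b : Bool) (y : ℝ) :
    Real.exp (1 - wrongSign b y) ≤ 1 + 2 * wrongSign (!b) y := by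
  unfold wrongSign
  have := Real.exp_one_lt_d9
  by_cases h : sgn b * y ≤ 0
  · simp only [h, if_true]
    split_ifs <;> norm_num
  · have h' : sgn (!b) * y ≤ 0 := by
      rw [sgn_not]; linarith
    simp only [h, h', if_true, if_false, sub_zero]
    linarith

/-! ### From indistinguishable sign flips to a regret bound. -/

section Interaction

variable {d : ℕ} {A : Set (Fin d → ℝ)} {S : Type*} [MeasurableSpace S]

/-- A two-point testing bound: an action rarely wrong under one law is often wrong under the flipped
one, unless information was gathered. It is the chained variational inequality for the statistic `1
- wrongSign b`, followed by `log (1 + x) ≤ x`. -/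
lemma Algorithm.one_le_wrongSign (alg : Algorithm A S) (s : S)
    (ν ν' : Measure (Fin d → ℝ)) [IsProbabilityMeasure ν] [IsProbabilityMeasure ν']
    {info : (Fin d → ℝ) → ℝ} (hinfo : Measurable info) {K : ℝ} (hK : ∀ a ∈ A, |info a| ≤ K)
    (hstep : ∀ a ∈ A, ∀ G : ℝ → ℝ, Measurable G → (∀ y, 0 ≤ G y) → (∀ y, G y ≤ 1) →
      ∫ η, G (a ⬝ᵥ η) ∂ν ≤ Real.log (∫ η, Real.exp (G (a ⬝ᵥ η)) ∂ν') + info a)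
    (t : ℕ) (k : Fin d) (b : Bool) :
    1 ≤ ∫ θ, wrongSign b (alg.action s θ t k) ∂(Measure.infinitePi fun _ : ℕ => ν)
      + 2 * ∫ θ, wrongSign (!b) (alg.action s θ t k) ∂(Measure.infinitePi fun _ : ℕ => ν')
      + ∑ j ∈ Finset.range t, ∫ θ, info (alg.action s θ j)
            ∂(Measure.infinitePi fun _ : ℕ => ν) := by
  set P := Measure.infinitePi fun _ : ℕ => ν
  set P' := Measure.infinitePi fun _ : ℕ => ν'
  have hw (b : Bool) : Measurable fun r => wrongSign b (alg.act t s r k) :=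
    (measurable_wrongSign b).comp ((measurable_pi_apply k).comp (alg.measurable_act_right s t))
  have hwi (b : Bool) (Q : Measure (ℕ → Fin d → ℝ)) [IsProbabilityMeasure Q] :
      Integrable (fun θ => wrongSign b (alg.action s θ t k)) Q :=
    Integrable.of_bound ((hw b).comp (alg.measurable_rewards_right s t)).aestronglyMeasurable 1
      (ae_of_all _ fun θ => by
        rw [Real.norm_eq_abs, abs_of_nonneg (wrongSign_nonneg _ _)]
        exact wrongSign_le_one _ _)
  have h := alg.integral_rewards_le_log s ν ν' hinfo hK hstep t
    (F := fun r => 1 - wrongSign b (alg.act t s r k)) (measurable_const.sub (hw b))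
    (fun r => sub_nonneg.2 (wrongSign_le_one _ _))
    (fun r => by linarith [wrongSign_nonneg b (alg.act t s r k)])
  change ∫ θ, (1 - wrongSign b (alg.action s θ t k)) ∂P ≤
    Real.log (∫ θ, Real.exp (1 - wrongSign b (alg.action s θ t k)) ∂P') + _ at h
  rw [integral_sub (integrable_const _) (hwi b P)] at h
  simp only [integral_const, probReal_univ, smul_eq_mul, mul_one] at h
  have h1 : ∫ θ, Real.exp (1 - wrongSign b (alg.action s θ t k)) ∂P'
      ≤ ∫ θ, (1 + 2 * wrongSign (!b) (alg.action s θ t k)) ∂P' :=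
    integral_mono_of_nonneg (ae_of_all _ fun θ => (Real.exp_pos _).le)
      ((integrable_const _).add ((hwi (!b) P').const_mul 2))
      (ae_of_all _ fun θ => exp_one_sub_wrongSign_le _ _)
  rw [integral_add (integrable_const _) ((hwi (!b) P').const_mul 2), integral_const_mul] at h1
  simp only [integral_const, probReal_univ, smul_eq_mul, mul_one] at h1
  have h2 : 0 ≤ ∫ θ, Real.exp (1 - wrongSign b (alg.action s θ t k)) ∂P' :=
    integral_nonneg fun θ => (Real.exp_pos _).le
  have h3 : Real.log (∫ θ, Real.exp (1 - wrongSign b (alg.action s θ t k)) ∂P')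
      ≤ 2 * ∫ θ, wrongSign (!b) (alg.action s θ t k) ∂P' := by
    rcases h2.eq_or_lt with h0 | h0
    · rw [← h0, Real.log_zero]
      exact mul_nonneg zero_le_two (integral_nonneg fun θ => wrongSign_nonneg _ _)
    · linarith [Real.log_le_sub_one_of_pos h0]
  linarith

/-- A minimax lower bound: if a family of parameter laws indexed by sign vectors is such that
flipping a sign is hard to detect, while acting against the signs or collecting information is
paid for by regret, then one of the laws forces a large regret. -/
theorem Algorithm.exists_le_expectedRegret (alg : Algorithm A S)
    (hA : ∀ a ∈ A, ∀ k, |a k| ≤ 1) (μ : Measure S) [IsProbabilityMeasure μ]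
    {n T : ℕ} (ι : Fin n → Fin d)
    (ν : (Fin n → Bool) → Measure (Fin d → ℝ)) [∀ x, IsProbabilityMeasure (ν x)]
    (aStar : (Fin n → Bool) → Fin d → ℝ)
    {info : Fin n → (Fin d → ℝ) → ℝ} (hinfo : ∀ i, Measurable (info i))
    (hinfo0 : ∀ i a, 0 ≤ info i a) {K : ℝ} (hK : ∀ i, ∀ a ∈ A, info i a ≤ K)
    (hstep : ∀ x i, ∀ a ∈ A, ∀ G : ℝ → ℝ, Measurable G → (∀ y, 0 ≤ G y) → (∀ y, G y ≤ 1) →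
      ∫ η, G (a ⬝ᵥ η) ∂(ν x) ≤ Real.log (∫ η, Real.exp (G (a ⬝ᵥ η)) ∂(ν (flip x i))) + info i a)
    {L : ℝ} (hL : 0 < L)
    (hpt : ∀ x, ∀ a ∈ A, ∑ i, (3 * wrongSign (x i) (a (ι i)) + T * info i a)
      ≤ n / 2 + L * ((aStar x - a) ⬝ᵥ meanVec (ν x))) :
    ∃ x, (n : ℝ) * T / (2 * L) ≤ alg.expectedRegret μ (ν x) (aStar x) T := by
  let P : (Fin n → Bool) → Measure (ℕ → Fin d → ℝ) := fun x => Measure.infinitePi fun _ => ν x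
  have hinfi : ∀ i s x t, Integrable (fun θ => info i (alg.action s θ t)) (P x) := fun i s x t =>
    Integrable.of_bound ((hinfo i).comp (alg.measurable_action_right s t)).aestronglyMeasurable K
      (ae_of_all _ fun θ => by
        rw [Real.norm_eq_abs, abs_of_nonneg (hinfo0 _ _)]
        exact hK _ _ (alg.action_mem _ _ _))
  have hwi : ∀ b s x t k, Integrable (fun θ => wrongSign b (alg.action s θ t k)) (P x) :=
    fun b s x t k => Integrable.of_bound ((measurable_wrongSign b).comp
      ((measurable_pi_apply k).comp (alg.measurable_action_right s t))).aestronglyMeasurable 1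
      (ae_of_all _ fun θ => by
        rw [Real.norm_eq_abs, abs_of_nonneg (wrongSign_nonneg _ _)]
        exact wrongSign_le_one _ _)
  have hregm : ∀ x, Measurable fun z : S × (ℕ → Fin d → ℝ) =>
      alg.regret (ν x) (aStar x) T z.1 z.2 := fun x => by
    unfold Algorithm.regret dotProduct
    refine Finset.measurable_fun_sum _ fun t _ => Finset.measurable_fun_sum _ fun k _ => ?_
    exact (measurable_const.sub
      ((measurable_pi_apply k).comp (alg.measurable_action t))).mul_const _
  have hregb : ∀ x, ∃ C : ℝ, ∀ z : S × (ℕ → Fin d → ℝ),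
      |alg.regret (ν x) (aStar x) T z.1 z.2| ≤ C := fun x => by
    refine ⟨∑ t ∈ Finset.range T, ∑ k, (|aStar x k| + 1) * |meanVec (ν x) k|, fun z => ?_⟩
    refine (Finset.abs_sum_le_sum_abs _ _).trans (Finset.sum_le_sum fun t _ => ?_)
    refine (Finset.abs_sum_le_sum_abs _ _).trans (Finset.sum_le_sum fun k _ => ?_)
    rw [abs_mul]
    refine mul_le_mul_of_nonneg_right ((abs_sub _ _).trans ?_) (abs_nonneg _)
    gcongr
    exact hA _ (alg.action_mem _ _ _) k
  have hregi : ∀ x, Integrable (fun z : S × (ℕ → Fin d → ℝ) =>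
      alg.regret (ν x) (aStar x) T z.1 z.2) (μ.prod (P x)) := fun x => by
    obtain ⟨C, hC⟩ := hregb x
    exact Integrable.of_bound (hregm x).aestronglyMeasurable C (ae_of_all _ hC)
  have hregi' : ∀ x s, Integrable (fun θ => alg.regret (ν x) (aStar x) T s θ) (P x) :=
    fun x s => by
      obtain ⟨C, hC⟩ := hregb x
      exact Integrable.of_bound ((hregm x).comp measurable_prodMk_left).aestronglyMeasurable C
        (ae_of_all _ fun θ => hC (s, θ))
  -- the bound for a fixed seed, averaged over the sign vectors
  have hseed : ∀ s, (Fintype.card (Fin n → Bool) : ℝ) * (n * T / (2 * L))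
      ≤ ∑ x, ∫ θ, alg.regret (ν x) (aStar x) T s θ ∂(P x) := fun s => by
    let p : (Fin n → Bool) → Fin n → ℕ → ℝ := fun x i t =>
      ∫ θ, wrongSign (x i) (alg.action s θ t (ι i)) ∂(P x)
    let I : (Fin n → Bool) → Fin n → ℝ := fun x i =>
      ∑ t ∈ Finset.range T, ∫ θ, info i (alg.action s θ t) ∂(P x)
    have h1 : ∀ x i, ∀ t ∈ Finset.range T, 1 ≤ p x i t + 2 * p (flip x i) i t + I x i :=
      fun x i t ht => by
        have h := alg.one_le_wrongSign s (ν x) (ν (flip x i)) (hinfo i)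
          (fun a ha => by rw [abs_of_nonneg (hinfo0 i a)]; exact hK i a ha)
          (hstep x i) t (ι i) (x i)
        -- Information is nonnegative, so that of the first `t` rounds is at most that of all `T`;
        -- this is why `hpt` carries the factor `T` on `info`.
        have hsub : ∑ j ∈ Finset.range t, ∫ θ, info i (alg.action s θ j) ∂(P x) ≤ I x i :=
          Finset.sum_le_sum_of_subset_of_nonneg
            (Finset.range_subset_range.2 (Finset.mem_range.1 ht).le)
            fun j _ _ => integral_nonneg fun θ => hinfo0 _ _
        have hp : p (flip x i) i t
            = ∫ θ, wrongSign (!x i) (alg.action s θ t (ι i)) ∂(P (flip x i)) := by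
          simp only [p, flip_self]
        rw [hp]
        linarith
    have h2 : ∀ x, ∑ i, (3 * ∑ t ∈ Finset.range T, p x i t + T * I x i)
        ≤ T * (n / 2) + L * ∫ θ, alg.regret (ν x) (aStar x) T s θ ∂(P x) := fun x => by
      have hG : ∀ i t, Integrable (fun θ => 3 * wrongSign (x i) (alg.action s θ t (ι i))
          + T * info i (alg.action s θ t)) (P x) := fun i t =>
        ((hwi (x i) s x t (ι i)).const_mul 3).add ((hinfi i s x t).const_mul (T : ℝ))
      have e1 : ∑ i, (3 * ∑ t ∈ Finset.range T, p x i t + T * I x i)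
          = ∫ θ, ∑ t ∈ Finset.range T, ∑ i, (3 * wrongSign (x i) (alg.action s θ t (ι i))
              + T * info i (alg.action s θ t)) ∂(P x) := by
        rw [integral_finsetSum _ fun t _ => integrable_finsetSum _ fun i _ => hG i t]
        simp_rw [integral_finsetSum Finset.univ fun i _ => hG i _]
        rw [Finset.sum_comm]
        refine Finset.sum_congr rfl fun i _ => ?_
        simp only [p, I, Finset.mul_sum]
        rw [← Finset.sum_add_distrib]
        refine Finset.sum_congr rfl fun t _ => ?_
        rw [integral_add ((hwi _ s x t _).const_mul 3) ((hinfi i s x t).const_mul _),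
          integral_const_mul, integral_const_mul]
      have e2 : T * (n / 2) + L * ∫ θ, alg.regret (ν x) (aStar x) T s θ ∂(P x)
          = ∫ θ, (T * ((n : ℝ) / 2) + L * alg.regret (ν x) (aStar x) T s θ) ∂(P x) := by
        rw [integral_add (integrable_const _) ((hregi' x s).const_mul _), integral_const_mul L]
        simp
      rw [e1, e2]
      refine integral_mono (integrable_finsetSum _ fun t _ => integrable_finsetSum _ fun i _ =>
          hG i t) ((integrable_const _).add ((hregi' x s).const_mul _)) fun θ => ?_
      refine (Finset.sum_le_sum fun t _ => hpt x _ (alg.action_mem s θ t)).trans ?_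
      rw [Finset.sum_add_distrib, ← Finset.mul_sum]
      simp [Algorithm.regret]
    have h3 : (Fintype.card (Fin n → Bool) : ℝ) * (n * T)
        ≤ ∑ x, ∑ i, (3 * ∑ t ∈ Finset.range T, p x i t + T * I x i) := by
      -- Flipping sign `i` permutes the sign vectors, so after summing over `x` the two error terms
      -- merge into `(1 + 2) * p`.
      have e : ∑ x : Fin n → Bool, ∑ i : Fin n, ∑ t ∈ Finset.range T,
          (p x i t + 2 * p (flip x i) i t + I x i)
          = ∑ x, ∑ i, (3 * ∑ t ∈ Finset.range T, p x i t + T * I x i) := by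
        rw [Finset.sum_comm, Finset.sum_comm (γ := Fin n → Bool)]
        refine Finset.sum_congr rfl fun i _ => ?_
        have hf := sum_flip i fun x => ∑ t ∈ Finset.range T, p x i t
        simp only [Finset.sum_add_distrib, ← Finset.mul_sum, Finset.sum_const,
          Finset.card_range, nsmul_eq_mul]
        rw [hf]
        ring
      rw [← e]
      have := Finset.sum_le_sum fun x (_ : x ∈ (Finset.univ : Finset (Fin n → Bool))) =>
        Finset.sum_le_sum fun i (_ : i ∈ (Finset.univ : Finset (Fin n))) =>
          Finset.sum_le_sum (h1 x i)
      refine le_trans (le_of_eq ?_) this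
      simp
    have h4 := h3.trans (Finset.sum_le_sum fun x _ => h2 x)
    rw [Finset.sum_add_distrib, Finset.sum_const, nsmul_eq_mul, Finset.card_univ,
      ← Finset.mul_sum] at h4
    have h5 : (Fintype.card (Fin n → Bool) : ℝ) * (n * T) / 2
        ≤ L * ∑ x, ∫ θ, alg.regret (ν x) (aStar x) T s θ ∂(P x) := by linarith
    have h6 : (Fintype.card (Fin n → Bool) : ℝ) * (n * T / (2 * L))
        = ((Fintype.card (Fin n → Bool) : ℝ) * (n * T) / 2) / L := by
      field_simp
    rw [h6, div_le_iff₀ hL]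
    linarith
  have hsum : (Fintype.card (Fin n → Bool) : ℝ) * (n * T / (2 * L))
      ≤ ∑ x, alg.expectedRegret μ (ν x) (aStar x) T := by
    have hi : ∀ x, Integrable (fun s => ∫ θ, alg.regret (ν x) (aStar x) T s θ ∂(P x)) μ :=
      fun x => (hregi x).integral_prod_left
    have e : ∑ x, alg.expectedRegret μ (ν x) (aStar x) T
        = ∫ s, ∑ x, ∫ θ, alg.regret (ν x) (aStar x) T s θ ∂(P x) ∂μ := by
      rw [integral_finsetSum _ fun x _ => hi x]
      exact Finset.sum_congr rfl fun x _ => integral_prod _ (hregi x)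
    rw [e]
    have := integral_mono (integrable_const _) (integrable_finsetSum Finset.univ fun x _ => hi x)
      hseed
    simpa using this
  -- The average over sign vectors is large, hence so is one of its terms.
  by_contra! hcon
  have := Finset.sum_lt_sum_of_nonempty (s := (Finset.univ : Finset (Fin n → Bool)))
    Finset.univ_nonempty fun x _ => hcon x
  rw [Finset.sum_const, nsmul_eq_mul, Finset.card_univ] at this
  linarith

end Interaction

/-! ### The one-round information inequality. -/

lemma integral_add_add {Ω : Type*} [MeasurableSpace Ω] {P : Measure Ω} {f g h : Ω → ℝ}
    (hf : Integrable f P) (hg : Integrable g P) (hh : Integrable h P) :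
    ∫ ω, (f ω + g ω + h ω) ∂P = ∫ ω, f ω ∂P + ∫ ω, g ω ∂P + ∫ ω, h ω ∂P :=
  (integral_add (hf.add hg) hh).trans (congrArg (· + _) (integral_add hf hg))

lemma integral_mul_sq_le {Ω : Type*} [MeasurableSpace Ω] {P : Measure Ω} {f g : Ω → ℝ}
    (hf : Integrable (fun ω => f ω ^ 2) P) (hg : Integrable (fun ω => g ω ^ 2) P)
    (hfg : Integrable (fun ω => f ω * g ω) P) :
    (∫ ω, f ω * g ω ∂P) ^ 2 ≤ (∫ ω, f ω ^ 2 ∂P) * ∫ ω, g ω ^ 2 ∂P := by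
  have h : ∀ l : ℝ, 0 ≤ (∫ ω, f ω ^ 2 ∂P) * (l * l) + (2 * ∫ ω, f ω * g ω ∂P) * l
      + ∫ ω, g ω ^ 2 ∂P := fun l => by
    have h1 : ∫ ω, (l * f ω + g ω) ^ 2 ∂P
        = (∫ ω, f ω ^ 2 ∂P) * (l * l) + (2 * ∫ ω, f ω * g ω ∂P) * l + ∫ ω, g ω ^ 2 ∂P := by
      have : ∀ ω, (l * f ω + g ω) ^ 2 = (l * l) * f ω ^ 2 + (2 * l) * (f ω * g ω) + g ω ^ 2 :=
        fun ω => by ring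
      simp_rw [this]
      rw [integral_add_add (hf.const_mul _) (hfg.const_mul _) hg, integral_const_mul,
        integral_const_mul]
      ring
    rw [← h1]
    exact integral_nonneg fun ω => sq_nonneg _
  have := discrim_le_zero h
  unfold discrim at this
  nlinarith

/-- The Taylor remainder of order three is at most `2/9 * |y|^3 ≤ 2/9 * y^2`, and `1/2 - 2/9 ≥ 1/4`.
-/
lemma one_add_add_sq_div_four_le_exp {y : ℝ} (h : |y| ≤ 1) : 1 + y + y ^ 2 / 4 ≤ Real.exp y := by
  have h3 := Real.exp_bound (x := y) h (n := 3) (by norm_num)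
  simp only [Finset.sum_range_succ, Finset.sum_range_zero, Nat.factorial] at h3
  norm_num at h3
  have h4 : |y| ^ 3 ≤ y ^ 2 := by
    rw [← sq_abs y]
    nlinarith [abs_nonneg y, sq_nonneg |y|]
  have := (abs_le.1 h3).1
  nlinarith [sq_nonneg y]

/-- Two laws with close densities cannot be told apart from a statistic `X` that carries little
information on the difference `ϑ` of the densities. -/
lemma integral_tilt_le_log {Ω : Type*} [MeasurableSpace Ω] {P : Measure Ω} [IsProbabilityMeasure P]
    {X h h' ϑ : Ω → ℝ} (hX : Measurable X) (hh' : Measurable h')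
    (hϑ : Measurable ϑ) (h'int : ∫ ω, h' ω ∂P = 1) (hint : ∫ ω, h ω ∂P = 1)
    (h'lo : ∀ᵐ ω ∂P, 1 / 2 ≤ h' ω) (h'hi : ∀ᵐ ω ∂P, h' ω ≤ 3 / 2) {c M J : ℝ} (hJ : 0 ≤ J)
    (hϑb : ∀ᵐ ω ∂P, |ϑ ω| ≤ M) (hsub : ∀ ω, h ω = h' ω + c * ϑ ω)
    (hinfo : ∀ φ : ℝ → ℝ, Measurable φ → (∀ y, |φ y| ≤ 1) →
      (∫ ω, ϑ ω * φ (X ω) ∂P) ^ 2 ≤ J * ∫ ω, φ (X ω) ^ 2 ∂P)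
    {G : ℝ → ℝ} (hG : Measurable G) (hG0 : ∀ y, 0 ≤ G y) (hG1 : ∀ y, G y ≤ 1) :
    ∫ ω, h ω * G (X ω) ∂P ≤ Real.log (∫ ω, h' ω * Real.exp (G (X ω)) ∂P) + 2 * c ^ 2 * J := by
  have hGm : Measurable fun ω => G (X ω) := hG.comp hX
  have hexp : ∀ ω, 1 ≤ Real.exp (G (X ω)) ∧ Real.exp (G (X ω)) ≤ Real.exp 1 := fun ω =>
    ⟨Real.one_le_exp (hG0 _), Real.exp_le_exp.2 (hG1 _)⟩
  have h'i : Integrable h' P := Integrable.of_bound hh'.aestronglyMeasurable (3 / 2) (by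
    filter_upwards [h'lo, h'hi] with ω h1 h2
    rw [Real.norm_eq_abs, abs_of_nonneg (by linarith)]; exact h2)
  have h'mul : ∀ {f : Ω → ℝ} {K : ℝ}, Measurable f → (∀ ω, |f ω| ≤ K) →
      Integrable (fun ω => h' ω * f ω) P := fun {f K} hf hK =>
    h'i.mul_bdd (c := K) hf.aestronglyMeasurable (ae_of_all _ hK)
  have hϑi : Integrable ϑ P := Integrable.of_bound hϑ.aestronglyMeasurable M hϑb
  have hI : Integrable (fun ω => h' ω * Real.exp (G (X ω))) P :=
    h'mul (Real.measurable_exp.comp hGm) (K := Real.exp 1) fun ω => by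
      rw [abs_of_pos (Real.exp_pos _)]; exact (hexp ω).2
  set Z := ∫ ω, h' ω * Real.exp (G (X ω)) ∂P with hZ
  have hZ1 : 1 ≤ Z := by
    rw [hZ, ← h'int]
    refine integral_mono_ae h'i hI ?_
    filter_upwards [h'lo] with ω h1
    nlinarith [(hexp ω).1]
  have hZe : Z ≤ Real.exp 1 := by
    have : Z ≤ ∫ ω, h' ω * Real.exp 1 ∂P := by
      refine integral_mono_ae hI (h'i.mul_const _) ?_
      filter_upwards [h'lo] with ω h1
      exact mul_le_mul_of_nonneg_left (hexp ω).2 (by linarith)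
    rwa [integral_mul_const, h'int, one_mul] at this
  have hZpos : 0 < Z := by linarith
  set l := Real.log Z with hl
  have hl0 : 0 ≤ l := Real.log_nonneg hZ1
  have hl1 : l ≤ 1 := (Real.log_le_iff_le_exp hZpos).2 hZe
  -- Subtracting `l = log Z` normalizes the exponential moment under `h'` to `1`, and `0 ≤ l ≤ 1`
  -- keeps `φ` in `[-1, 1]`.
  let φ : ℝ → ℝ := fun y => G y - l
  have hφm : Measurable φ := hG.sub_const _
  have hφb : ∀ y, |φ y| ≤ 1 := fun y => abs_le.2 ⟨by
    simp only [φ]; linarith [hG0 y], by simp only [φ]; linarith [hG1 y]⟩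
  have hφX : Measurable fun ω => φ (X ω) := hφm.comp hX
  set A := ∫ ω, φ (X ω) ^ 2 ∂P with hA
  have hφ2i : Integrable (fun ω => φ (X ω) ^ 2) P :=
    Integrable.of_bound (hφX.pow_const 2).aestronglyMeasurable 1 (ae_of_all _ fun ω => by
      rw [Real.norm_eq_abs, abs_pow]; exact pow_le_one₀ (abs_nonneg _) (hφb _))
  have hexpφ : ∫ ω, h' ω * Real.exp (φ (X ω)) ∂P = 1 := by
    have : ∀ ω, h' ω * Real.exp (φ (X ω)) = h' ω * Real.exp (G (X ω)) * Z⁻¹ := fun ω => by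
      simp only [φ, Real.exp_sub, hl, Real.exp_log hZpos]
      ring
    simp_rw [this]
    rw [integral_mul_const, ← hZ, mul_inv_cancel₀ hZpos.ne']
  have hφi : Integrable (fun ω => h' ω * φ (X ω)) P := h'mul hφX fun ω => hφb _
  have hexpi : Integrable (fun ω => h' ω * Real.exp (φ (X ω))) P :=
    h'mul (Real.measurable_exp.comp hφX) (K := Real.exp 1) fun ω => by
      rw [abs_of_pos (Real.exp_pos _)]
      exact Real.exp_le_exp.2 ((le_abs_self _).trans (hφb _))
  -- The quadratic term of the exponential has coefficient `1/4`, and `h' ≥ 1/2` leaves `1/8`. This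
  -- negative drift absorbs the change of density below.
  have h1 : 1 + (∫ ω, h' ω * φ (X ω) ∂P) + A / 8 ≤ 1 := by
    have : ∫ ω, (h' ω + h' ω * φ (X ω) + (1 / 8) * φ (X ω) ^ 2) ∂P
        ≤ ∫ ω, h' ω * Real.exp (φ (X ω)) ∂P := by
      refine integral_mono_ae ((h'i.add hφi).add (hφ2i.const_mul _)) hexpi ?_
      filter_upwards [h'lo] with ω h1
      have h2 := one_add_add_sq_div_four_le_exp (hφb (X ω))
      have h3 := mul_le_mul_of_nonneg_left h2 (by linarith : 0 ≤ h' ω)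
      nlinarith [sq_nonneg (φ (X ω))]
    rw [integral_add_add h'i hφi (hφ2i.const_mul _), h'int,
      integral_const_mul, hexpφ] at this
    linarith
  have hϑφi : Integrable (fun ω => ϑ ω * φ (X ω)) P :=
    hϑi.mul_bdd (c := 1) hφX.aestronglyMeasurable (ae_of_all _ fun ω => hφb _)
  have h2 : ∫ ω, h ω * φ (X ω) ∂P = (∫ ω, h' ω * φ (X ω) ∂P) + c * ∫ ω, ϑ ω * φ (X ω) ∂P := by
    have : ∀ ω, h ω * φ (X ω) = h' ω * φ (X ω) + c * (ϑ ω * φ (X ω)) := fun ω => by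
      rw [hsub]; ring
    simp_rw [this]
    rw [integral_add hφi (hϑφi.const_mul _), integral_const_mul]
  have hi : Integrable h P := by
    have : h = fun ω => h' ω + c * ϑ ω := funext hsub
    rw [this]
    exact h'i.add (hϑi.const_mul _)
  have h3 : ∫ ω, h ω * φ (X ω) ∂P = (∫ ω, h ω * G (X ω) ∂P) - l := by
    have : ∀ ω, h ω * φ (X ω) = h ω * G (X ω) - h ω * l := fun ω => by simp only [φ]; ring
    simp_rw [this]
    rw [integral_sub _ (hi.mul_const _), integral_mul_const, hint, one_mul]
    exact hi.mul_bdd (c := 1) hGm.aestronglyMeasurable (ae_of_all _ fun ω =>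
      abs_le.2 ⟨by linarith [hG0 (X ω)], hG1 _⟩)
  have h4 := hinfo φ hφm hφb
  have hA0 : 0 ≤ A := integral_nonneg fun ω => sq_nonneg _
  -- The square of the left side is at most `c ^ 2 * J * A`, which is four times the product of the
  -- two terms on the right: the arithmetic-geometric mean inequality.
  have h5 : c * ∫ ω, ϑ ω * φ (X ω) ∂P ≤ 2 * c ^ 2 * J + A / 8 := by
    refine abs_le_of_sq_le_sq' ?_ (by positivity) |>.2
    have h6 := mul_le_mul_of_nonneg_left h4 (sq_nonneg c)
    rw [mul_pow]
    nlinarith [sq_nonneg (2 * c ^ 2 * J - A / 8)]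
  linarith

/-! ### Uniform law on a sphere: symmetry and moments. -/

/-- The uniform law on a centred sphere of a Euclidean space. -/
noncomputable def sphereLaw (n : ℕ) (r : ℝ) : Measure (EuclideanSpace ℝ (Fin n)) :=
  (volume[|Metric.ball (0 : EuclideanSpace ℝ (Fin n)) 1]).map fun x => (r / ‖x‖) • x

section Sphere

variable {n : ℕ} {r : ℝ}

lemma measurable_normalize (n : ℕ) (r : ℝ) :
    Measurable fun x : EuclideanSpace ℝ (Fin n) => (r / ‖x‖) • x :=
  (measurable_const.div measurable_norm).smul measurable_id

instance : IsProbabilityMeasure (volume[|Metric.ball (0 : EuclideanSpace ℝ (Fin n)) 1]) :=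
  cond_isProbabilityMeasure_of_finite
    (Metric.measure_ball_pos volume _ one_pos).ne' measure_ball_lt_top.ne

instance : IsProbabilityMeasure (sphereLaw n r) :=
  Measure.isProbabilityMeasure_map (measurable_normalize n r).aemeasurable

lemma sphereLaw_norm [NeZero n] (hr : 0 ≤ r) : ∀ᵐ x ∂(sphereLaw n r), ‖x‖ = r := by
  unfold sphereLaw
  rw [ae_map_iff (measurable_normalize n r).aemeasurable
    (measurableSet_eq_fun measurable_norm measurable_const)]
  have h : ∀ᵐ x ∂(volume : Measure (EuclideanSpace ℝ (Fin n))), x ≠ 0 := by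
    have : Nontrivial (EuclideanSpace ℝ (Fin n)) :=
      Module.nontrivial_of_finrank_pos (R := ℝ) (by simp [NeZero.pos n])
    simp [ae_iff]
  filter_upwards [cond_absolutelyContinuous.ae_le h] with x hx
  rw [norm_smul, norm_div, norm_norm, Real.norm_of_nonneg hr,
    div_mul_cancel₀ _ (norm_ne_zero_iff.2 hx)]

lemma sphereLaw_map (L : EuclideanSpace ℝ (Fin n) ≃ₗᵢ[ℝ] EuclideanSpace ℝ (Fin n)) :
    MeasurePreserving L (sphereLaw n r) (sphereLaw n r) := by
  refine ⟨L.continuous.measurable, ?_⟩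
  unfold sphereLaw
  rw [Measure.map_map L.continuous.measurable (measurable_normalize n r)]
  have h1 : (L ∘ fun x : EuclideanSpace ℝ (Fin n) => (r / ‖x‖) • x)
      = (fun x => (r / ‖x‖) • x) ∘ L := by
    ext1 x
    simp
  have h2 : L ⁻¹' Metric.ball 0 1 = Metric.ball 0 1 := by
    ext x
    simp
  have h3 := (L.measurePreserving.restrict_preimage
    (measurableSet_ball (x := (0 : EuclideanSpace ℝ (Fin n))) (ε := 1))).map_eq
  rw [h2] at h3
  rw [h1, ← Measure.map_map (measurable_normalize n r) L.continuous.measurable]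
  unfold ProbabilityTheory.cond
  rw [Measure.map_smul, h3]

lemma integral_sphereLaw_comp (L : EuclideanSpace ℝ (Fin n) ≃ₗᵢ[ℝ] EuclideanSpace ℝ (Fin n))
    (f : EuclideanSpace ℝ (Fin n) → ℝ) :
    ∫ x, f (L x) ∂(sphereLaw n r) = ∫ x, f x ∂(sphereLaw n r) :=
  (sphereLaw_map L).integral_comp L.toHomeomorph.measurableEmbedding f

open scoped RealInnerProductSpace

/-- The reflection in the hyperplane bisecting `v` and `w` exchanges them and preserves the law. -/
lemma integral_sphereLaw_inner_congr (f : ℝ → ℝ) {v w : EuclideanSpace ℝ (Fin n)}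
    (h : ‖v‖ = ‖w‖) :
    ∫ x, f ⟪v, x⟫ ∂(sphereLaw n r) = ∫ x, f ⟪w, x⟫ ∂(sphereLaw n r) := by
  set R := (ℝ ∙ (v - w))ᗮ.reflection
  have hR : R v = w := Submodule.reflection_sub h
  rw [← integral_sphereLaw_comp R fun x => f ⟪w, x⟫]
  simp_rw [← hR, R.inner_map_map]

lemma integrable_sphereLaw [NeZero n] (hr : 0 ≤ r) {f : EuclideanSpace ℝ (Fin n) → ℝ}
    (hf : Measurable f) {K : ℝ} (hK : ∀ x, ‖x‖ = r → |f x| ≤ K) :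
    Integrable f (sphereLaw n r) :=
  Integrable.of_bound hf.aestronglyMeasurable K (by
    filter_upwards [sphereLaw_norm hr] with x hx using hK x hx)

lemma integrable_sphereLaw_of_continuous [NeZero n] (hr : 0 ≤ r)
    {f : EuclideanSpace ℝ (Fin n) → ℝ} (hf : Continuous f) :
    Integrable f (sphereLaw n r) := by
  obtain ⟨K, hK⟩ := (isCompact_sphere (0 : EuclideanSpace ℝ (Fin n)) r).exists_bound_of_continuousOn
    hf.continuousOn
  exact integrable_sphereLaw hr hf.measurable (K := K) fun x hx => hK x (by simpa using hx)

/-- Given the value of a linear form, the uniform law on the sphere is centred on the line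
orthogonal to its level sets. -/
lemma integral_sphereLaw_coord_mul [NeZero n] (hr : 0 ≤ r) (a : EuclideanSpace ℝ (Fin n))
    (i : Fin n) {φ : ℝ → ℝ} (hφ : Measurable φ) {M : ℝ} (hφb : ∀ y, |φ y| ≤ M) :
    ‖a‖ ^ 2 * ∫ x, x i * φ ⟪a, x⟫ ∂(sphereLaw n r)
      = a i * ∫ x, ⟪a, x⟫ * φ ⟪a, x⟫ ∂(sphereLaw n r) := by
  rcases eq_or_ne a 0 with rfl | ha
  · simp
  have hn : ‖a‖ ^ 2 ≠ 0 := by simpa using ha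
  -- The reflection through the line of `a` preserves `⟪a, x⟫`, and the midpoint of `x` and its
  -- image is the projection of `x` on that line.
  set R := (ℝ ∙ a).reflection
  have hR : ∀ x, R x = (2 * (⟪a, x⟫ / ‖a‖ ^ 2)) • a - x := fun x => by
    have := Submodule.reflection_singleton_apply (𝕜 := ℝ) a x
    simp only [R]
    rw [this, two_mul, two_smul, ← add_smul]
    simp
  have hRa : ∀ x, ⟪a, R x⟫ = ⟪a, x⟫ := fun x => by
    rw [hR, inner_sub_right, real_inner_smul_right, real_inner_self_eq_norm_sq]
    field_simp
    ring
  have hφm : Measurable fun x : EuclideanSpace ℝ (Fin n) => φ ⟪a, x⟫ :=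
    hφ.comp (by fun_prop : Continuous fun x : EuclideanSpace ℝ (Fin n) => ⟪a, x⟫).measurable
  have hi : Integrable (fun x : EuclideanSpace ℝ (Fin n) => x i * φ ⟪a, x⟫) (sphereLaw n r) :=
    (integrable_sphereLaw_of_continuous hr (by fun_prop)).mul_bdd (c := M)
      hφm.aestronglyMeasurable (ae_of_all _ fun x => hφb _)
  have hi' : Integrable (fun x : EuclideanSpace ℝ (Fin n) => ⟪a, x⟫ * φ ⟪a, x⟫)
      (sphereLaw n r) :=
    (integrable_sphereLaw_of_continuous hr (by fun_prop)).mul_bdd (c := M)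
      hφm.aestronglyMeasurable (ae_of_all _ fun x => hφb _)
  have h1 := integral_sphereLaw_comp (r := r) R fun x => x i * φ ⟪a, x⟫
  have h2 : ∀ x, R x i * φ ⟪a, R x⟫
      = (2 * a i / ‖a‖ ^ 2) * (⟪a, x⟫ * φ ⟪a, x⟫) - x i * φ ⟪a, x⟫ := fun x => by
    rw [hRa, hR]
    simp only [PiLp.sub_apply, PiLp.smul_apply, smul_eq_mul]
    ring
  simp_rw [h2] at h1
  rw [integral_sub (hi'.const_mul _) hi, integral_const_mul] at h1
  field_simp at h1 ⊢
  linarith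

/-- All coordinates have the same second moment and their squares sum to `r ^ 2`. -/
lemma integral_sphereLaw_inner_sq [NeZero n] (hr : 0 ≤ r) (a : EuclideanSpace ℝ (Fin n)) :
    ∫ x, ⟪a, x⟫ ^ 2 ∂(sphereLaw n r) = ‖a‖ ^ 2 * (r ^ 2 / n) := by
  have hn : (n : ℝ) ≠ 0 := by simpa using NeZero.ne n
  let e : Fin n → EuclideanSpace ℝ (Fin n) := fun i => EuclideanSpace.single i 1
  have he : ∀ i x, ⟪e i, x⟫ = x i := fun i x => by simp [e, EuclideanSpace.inner_single_left]
  have hc : ∀ i, ∫ x, ⟪a, x⟫ ^ 2 ∂(sphereLaw n r) = ‖a‖ ^ 2 * ∫ x, x i ^ 2 ∂(sphereLaw n r) :=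
    fun i => by
      rw [integral_sphereLaw_inner_congr (fun y => y ^ 2) (w := ‖a‖ • e i)
        (by simp [e, norm_smul]), ← integral_const_mul]
      simp_rw [real_inner_smul_left, he, mul_pow]
  have hs : ∑ i, ∫ x, x i ^ 2 ∂(sphereLaw n r) = r ^ 2 := by
    rw [← integral_finsetSum _ fun i _ =>
      integrable_sphereLaw_of_continuous hr (by fun_prop)]
    have : ∀ᵐ x ∂(sphereLaw n r), ∑ i, x i ^ 2 = r ^ 2 := by
      filter_upwards [sphereLaw_norm hr] with x hx
      rw [← hx, EuclideanSpace.real_norm_sq_eq]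
    rw [integral_congr_ae this]
    simp
  have := Finset.sum_congr rfl fun i (_ : i ∈ Finset.univ) => hc i
  rw [← Finset.mul_sum, hs] at this
  simp only [Finset.sum_const, Finset.card_univ, Fintype.card_fin, nsmul_eq_mul] at this
  field_simp
  linarith

/-- The Gaussian constant `3` comes from rotating by 45 degrees: comparing the fourth moments of `x
o ± x j` with that of `x o` gives `E x_o^4 = 3 E x_o^2 x_j^2` for `j ≠ o`. Summing over `j` replaces
`∑ x_j^2` by `r ^ 2`. -/
lemma integral_sphereLaw_inner_pow_four [NeZero n] (hr : 0 ≤ r) (a : EuclideanSpace ℝ (Fin n)) :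
    ∫ x, ⟪a, x⟫ ^ 4 ∂(sphereLaw n r) ≤ 3 * (‖a‖ ^ 2 * (r ^ 2 / n)) ^ 2 := by
  have hn : (0 : ℝ) < n := by exact_mod_cast NeZero.pos n
  let e : Fin n → EuclideanSpace ℝ (Fin n) := fun i => EuclideanSpace.single i 1
  have he : ∀ i x, ⟪e i, x⟫ = x i := fun i x => by simp [e, EuclideanSpace.inner_single_left]
  have hc : ∀ i (b : EuclideanSpace ℝ (Fin n)), ∫ x, ⟪b, x⟫ ^ 4 ∂(sphereLaw n r)
      = ‖b‖ ^ 4 * ∫ x, x i ^ 4 ∂(sphereLaw n r) := fun i b => by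
    rw [integral_sphereLaw_inner_congr (fun y => y ^ 4) (w := ‖b‖ • e i)
      (by simp [e, norm_smul]), ← integral_const_mul]
    simp_rw [real_inner_smul_left, he, mul_pow]
  let o : Fin n := 0
  set c := ∫ x, x o ^ 4 ∂(sphereLaw n r) with hcdef
  have hc0 : 0 ≤ c := integral_nonneg fun x => by positivity
  have hci : ∀ i, ∫ x, x i ^ 4 ∂(sphereLaw n r) = c := fun i => by
    have := hc o (e i)
    simp_rw [he] at this
    simpa [e] using this
  have hint : ∀ {f : EuclideanSpace ℝ (Fin n) → ℝ}, Continuous f → Integrable f (sphereLaw n r) :=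
    fun hf => integrable_sphereLaw_of_continuous hr hf
  have hmix : ∀ j, c ≤ 3 * ∫ x, x o ^ 2 * x j ^ 2 ∂(sphereLaw n r) := fun j => by
    rcases eq_or_ne j o with rfl | hj
    · simp_rw [← pow_add]
      norm_num
      linarith
    · have hnorm : ∀ s : ℝ, s ^ 2 = 1 → ‖e o + s • e j‖ ^ 4 = 4 := fun s hs => by
        have : ‖e o + s • e j‖ ^ 2 = 2 := by
          rw [norm_add_sq_real, real_inner_smul_right, he]
          have h0 : e j o = 0 := by simp [e, hj.symm]
          rw [h0, norm_smul, mul_pow, Real.norm_eq_abs, sq_abs, hs]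
          simp [e]
          norm_num
        calc ‖e o + s • e j‖ ^ 4 = (‖e o + s • e j‖ ^ 2) ^ 2 := by ring
          _ = 4 := by rw [this]; norm_num
      have h1 := hc o (e o + (1 : ℝ) • e j)
      have h2 := hc o (e o + (-1 : ℝ) • e j)
      rw [hnorm 1 (by norm_num)] at h1
      rw [hnorm (-1) (by norm_num)] at h2
      have h3 : ∫ x, (⟪e o + (1 : ℝ) • e j, x⟫ ^ 4 + ⟪e o + (-1 : ℝ) • e j, x⟫ ^ 4)
          ∂(sphereLaw n r) = ∫ x, (2 * x o ^ 4 + 2 * x j ^ 4 + 12 * (x o ^ 2 * x j ^ 2))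
          ∂(sphereLaw n r) := by
        refine integral_congr_ae (ae_of_all _ fun x => ?_)
        simp only [inner_add_left, real_inner_smul_left, he]
        ring
      rw [integral_add (hint (by fun_prop)) (hint (by fun_prop)), h1, h2,
        integral_add_add (hint (by fun_prop)) (hint (by fun_prop)) (hint (by fun_prop)),
        integral_const_mul, integral_const_mul, integral_const_mul, hci j, ← hcdef] at h3
      linarith
  have hsum : n * c ≤ 3 * (r ^ 2 * (r ^ 2 / n)) := by
    have h1 := Finset.sum_le_sum fun j (_ : j ∈ Finset.univ) => hmix j
    rw [← Finset.mul_sum, ← integral_finsetSum (μ := sphereLaw n r) Finset.univ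
      (f := fun j x => x o ^ 2 * x j ^ 2) fun j _ => hint (by fun_prop)] at h1
    have h2 : ∀ᵐ x ∂(sphereLaw n r), ∑ j, x o ^ 2 * x j ^ 2 = r ^ 2 * x o ^ 2 := by
      filter_upwards [sphereLaw_norm hr] with x hx
      rw [← Finset.mul_sum, ← EuclideanSpace.real_norm_sq_eq, hx]
      ring
    have h3 := integral_sphereLaw_inner_sq hr (e o)
    simp_rw [he] at h3
    rw [integral_congr_ae h2, integral_const_mul, h3] at h1
    simpa [e] using h1
  rw [hc o a]
  have : c ≤ 3 * (r ^ 2 / n) ^ 2 := by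
    rw [← mul_le_mul_iff_right₀ hn]
    refine hsum.trans (le_of_eq ?_)
    field_simp
  calc ‖a‖ ^ 4 * c ≤ ‖a‖ ^ 4 * (3 * (r ^ 2 / n) ^ 2) := by gcongr
    _ = _ := by ring

/-- `Q` is an isotropic law with variance `v` per coordinate on a centred sphere; only the
consequences of rotation invariance that are needed are recorded. -/
structure IsIsotropic {n : ℕ} (Q : Measure (Fin n → ℝ)) (v : ℝ) : Prop where
  sum_sq : ∀ᵐ x ∂Q, ∑ i, x i ^ 2 = n * v
  integral_neg : ∀ f : (Fin n → ℝ) → ℝ, ∫ x, f (-x) ∂Q = ∫ x, f x ∂Q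
  coord_mul : ∀ (a : Fin n → ℝ) (i : Fin n) (φ : ℝ → ℝ) (M : ℝ), Measurable φ →
    (∀ y, |φ y| ≤ M) →
    (∑ j, a j ^ 2) * ∫ x, x i * φ (a ⬝ᵥ x) ∂Q = a i * ∫ x, (a ⬝ᵥ x) * φ (a ⬝ᵥ x) ∂Q
  dot_sq : ∀ a : Fin n → ℝ, ∫ x, (a ⬝ᵥ x) ^ 2 ∂Q = (∑ j, a j ^ 2) * v
  dot_pow_four : ∀ a : Fin n → ℝ, ∫ x, (a ⬝ᵥ x) ^ 4 ∂Q ≤ 3 * ((∑ j, a j ^ 2) * v) ^ 2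

theorem exists_isIsotropic [NeZero n] {v : ℝ} (hv : 0 ≤ v) :
    ∃ Q : Measure (Fin n → ℝ), IsProbabilityMeasure Q ∧ IsIsotropic Q v := by
  have hn : (n : ℝ) ≠ 0 := by simpa using NeZero.ne n
  have hr : 0 ≤ √(n * v) := Real.sqrt_nonneg _
  have hr2 : √(n * v) ^ 2 / n = v := by
    rw [Real.sq_sqrt (by positivity)]
    field_simp
  let e : EuclideanSpace ℝ (Fin n) ≃ᵐ (Fin n → ℝ) := (MeasurableEquiv.toLp 2 (Fin n → ℝ)).symm
  have he : ∀ x i, e x i = x i := fun x i => rfl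
  have hint : ∀ f : (Fin n → ℝ) → ℝ, ∫ x, f x ∂((sphereLaw n √(n * v)).map e)
      = ∫ x, f (e x) ∂(sphereLaw n √(n * v)) := fun f => integral_map_equiv e f
  have hdot : ∀ (a : Fin n → ℝ) (x : EuclideanSpace ℝ (Fin n)),
      a ⬝ᵥ e x = ⟪WithLp.toLp 2 a, x⟫ := fun a x => by
    simp [PiLp.inner_apply, dotProduct, he, mul_comm]
  have hnorm : ∀ a : Fin n → ℝ, ∑ j, a j ^ 2 = ‖WithLp.toLp 2 a‖ ^ 2 := fun a => by
    rw [EuclideanSpace.real_norm_sq_eq]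
  refine ⟨(sphereLaw n √(n * v)).map e,
    Measure.isProbabilityMeasure_map e.measurable.aemeasurable, ?_, fun f => ?_,
    fun a i φ M hφ hM => ?_, fun a => ?_, fun a => ?_⟩
  · rw [ae_map_iff e.measurable.aemeasurable
      (measurableSet_eq_fun (by fun_prop) measurable_const)]
    filter_upwards [sphereLaw_norm hr] with x hx
    simp only [he]
    rw [← EuclideanSpace.real_norm_sq_eq, hx, Real.sq_sqrt (by positivity)]
  · rw [hint, hint]
    exact integral_sphereLaw_comp (LinearIsometryEquiv.neg ℝ) fun x => f (e x)
  · rw [hint, hint]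
    simp_rw [hdot, he, hnorm]
    exact integral_sphereLaw_coord_mul hr _ i hφ hM
  · rw [hint]
    simp_rw [hdot, hnorm]
    rw [integral_sphereLaw_inner_sq hr, hr2]
  · rw [hint]
    simp_rw [hdot, hnorm]
    have := integral_sphereLaw_inner_pow_four hr (WithLp.toLp 2 a)
    rwa [hr2] at this

end Sphere

/-! ### A bounded noise whose small shifts are hard to detect. -/

/-- The tent function on `[-1, 1]`. -/
noncomputable def tent (u : ℝ) : ℝ := max 0 (1 - |u|)

lemma continuous_tent : Continuous tent := by unfold tent; fun_prop

lemma tent_neg (u : ℝ) : tent (-u) = tent u := by simp [tent]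

lemma tent_eq_zero {u : ℝ} (h : 1 ≤ |u|) : tent u = 0 := max_eq_left (by linarith)

lemma abs_tent_sub_le (u v : ℝ) : |tent u - tent v| ≤ |u - v| := by
  unfold tent
  refine (abs_max_sub_max_le_max _ _ _ _).trans ?_
  rw [sub_self, abs_zero]
  refine max_le (abs_nonneg _) ?_
  rw [show 1 - |u| - (1 - |v|) = -(|u| - |v|) by ring, abs_neg]
  exact abs_abs_sub_abs_le_abs_sub u v

lemma continuous_tent_sq : Continuous fun u => tent u ^ 2 := continuous_tent.pow 2

lemma hasCompactSupport_tent_sq : HasCompactSupport fun u => tent u ^ 2 :=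
  HasCompactSupport.intro (isCompact_Icc (a := -1) (b := 1)) fun u hu => by
    rw [tent_eq_zero, zero_pow two_ne_zero]
    by_contra! h
    exact hu ⟨by linarith [(abs_lt.1 h).1], (abs_lt.1 h).2.le⟩

lemma integrable_tent_sq : Integrable fun u => tent u ^ 2 :=
  continuous_tent_sq.integrable_of_hasCompactSupport hasCompactSupport_tent_sq

lemma integral_tent_sq_pos : 0 < ∫ u, tent u ^ 2 :=
  continuous_tent_sq.integral_pos_of_hasCompactSupport_nonneg_nonzero
    hasCompactSupport_tent_sq (fun u => sq_nonneg (tent u)) (x := 0) (by simp [tent])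

lemma measurable_tent_density :
    Measurable fun u => ENNReal.ofReal (tent u ^ 2 / ∫ u, tent u ^ 2) :=
  (continuous_tent_sq.div_const _).measurable.ennreal_ofReal

/-- For `|y| ≤ 1` the integrand vanishes off `[-2, 2]` and the Lipschitz bound gives `16 * y ^ 2`.
For larger `y` the crude bound `4 * Z` is below `4 * Z * y ^ 2`. -/
lemma exists_integral_tent_sub_sq_le : ∃ C : ℝ, 0 < C ∧ ∀ y : ℝ,
    ∫ u, (tent (u - y) - tent (u + y)) ^ 2 ≤ C * y ^ 2 := by
  set Z := ∫ u, tent u ^ 2 with hZ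
  have hZ0 : 0 < Z := integral_tent_sq_pos
  have hi1 : ∀ y, Integrable fun u => tent (u - y) ^ 2 := fun y =>
    integrable_tent_sq.comp_sub_right y
  have hi2 : ∀ y, Integrable fun u => tent (u + y) ^ 2 := fun y =>
    integrable_tent_sq.comp_add_right y
  refine ⟨16 + 4 * Z, by positivity, fun y => ?_⟩
  by_cases hy : |y| ≤ 1
  · have hy' := abs_le.1 hy
    have h : ∀ u, (tent (u - y) - tent (u + y)) ^ 2
        ≤ (Set.Icc (-2 : ℝ) 2).indicator (fun _ => 4 * y ^ 2) u := fun u => by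
      by_cases hu : u ∈ Set.Icc (-2 : ℝ) 2
      · rw [Set.indicator_of_mem hu, ← sq_abs]
        have h1 := abs_tent_sub_le (u - y) (u + y)
        rw [show u - y - (u + y) = -(2 * y) by ring, abs_neg, abs_mul, abs_two] at h1
        calc |tent (u - y) - tent (u + y)| ^ 2 ≤ (2 * |y|) ^ 2 := by gcongr
          _ = 4 * y ^ 2 := by rw [mul_pow, sq_abs]; norm_num
      · rw [Set.indicator_of_notMem hu]
        have h2 : 2 < |u| := by
          by_contra! h
          exact hu ⟨(abs_le.1 h).1, (abs_le.1 h).2⟩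
        have h3 := abs_sub_abs_le_abs_sub u y
        have h4 := abs_sub_abs_le_abs_sub u (-y)
        rw [sub_neg_eq_add, abs_neg] at h4
        rw [tent_eq_zero (by linarith), tent_eq_zero (by linarith)]
        simp
    have hc : IntegrableOn (fun _ : ℝ => 4 * y ^ 2) (Set.Icc (-2 : ℝ) 2) := integrable_const _
    have h5 := integral_mono_of_nonneg (μ := volume) (ae_of_all _ fun u => sq_nonneg _)
      ((integrable_indicator_iff measurableSet_Icc).2 hc) (ae_of_all _ h)
    rw [integral_indicator measurableSet_Icc] at h5
    simp only [integral_const, MeasurableSet.univ, measureReal_restrict_apply, Set.univ_inter,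
      Real.volume_real_Icc, smul_eq_mul] at h5
    norm_num at h5
    nlinarith [sq_nonneg y]
  · have h : ∀ u, (tent (u - y) - tent (u + y)) ^ 2
        ≤ 2 * tent (u - y) ^ 2 + 2 * tent (u + y) ^ 2 := fun u => by
      nlinarith [sq_nonneg (tent (u - y) + tent (u + y))]
    have h5 := integral_mono_of_nonneg (μ := volume) (ae_of_all _ fun u => sq_nonneg _)
      (((hi1 y).const_mul 2).add ((hi2 y).const_mul 2)) (ae_of_all _ h)
    have e1 : ∫ u, tent (u - y) ^ 2 = Z := integral_sub_right_eq_self (fun u => tent u ^ 2) y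
    have e2 : ∫ u, tent (u + y) ^ 2 = Z := integral_add_right_eq_self (fun u => tent u ^ 2) y
    simp only [Pi.add_apply] at h5
    rw [integral_add ((hi1 y).const_mul 2) ((hi2 y).const_mul 2), integral_const_mul,
      integral_const_mul, e1, e2] at h5
    have h6 : 1 ≤ y ^ 2 := by
      rw [← sq_abs]
      nlinarith [not_le.1 hy]
    nlinarith

/-- The law with density proportional to the square of the tent function. -/
noncomputable def tentLaw : Measure ℝ :=
  volume.withDensity fun u => ENNReal.ofReal (tent u ^ 2 / ∫ u, tent u ^ 2)

lemma integral_tentLaw (f : ℝ → ℝ) :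
    ∫ u, f u ∂tentLaw = (∫ u, tent u ^ 2 * f u) / ∫ u, tent u ^ 2 := by
  unfold tentLaw
  rw [integral_withDensity_eq_integral_toReal_smul measurable_tent_density
    (by simp), ← integral_div]
  refine integral_congr_ae (ae_of_all _ fun u => ?_)
  simp only [smul_eq_mul]
  rw [ENNReal.toReal_ofReal (div_nonneg (sq_nonneg _) integral_tent_sq_pos.le)]
  ring

instance : IsProbabilityMeasure tentLaw := by
  have h0 := integral_tent_sq_pos
  refine ⟨?_⟩
  rw [tentLaw, withDensity_apply _ MeasurableSet.univ, Measure.restrict_univ,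
    ← ofReal_integral_eq_lintegral_ofReal (integrable_tent_sq.div_const _)
      (ae_of_all _ fun u => div_nonneg (sq_nonneg _) h0.le), integral_div, div_self h0.ne']
  simp

lemma tentLaw_abs_le : ∀ᵐ u ∂tentLaw, |u| ≤ 1 := by
  rw [tentLaw, ae_withDensity_iff measurable_tent_density]
  refine ae_of_all _ fun u hu => ?_
  by_contra! h
  exact hu (by simp [tent_eq_zero h.le])

lemma integral_tentLaw_id : ∫ u, u ∂tentLaw = 0 := by
  have h := integral_neg_eq_self (fun u : ℝ => tent u ^ 2 * u) volume
  simp_rw [tent_neg, mul_neg] at h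
  rw [integral_neg] at h
  rw [integral_tentLaw, show ∫ u, tent u ^ 2 * u = 0 by linarith, zero_div]

lemma integrable_tentLaw {f : ℝ → ℝ} (hf : Continuous f) : Integrable f tentLaw := by
  obtain ⟨K, hK⟩ := (isCompact_Icc (a := (-1 : ℝ)) (b := 1)).exists_bound_of_continuousOn
    hf.continuousOn
  refine Integrable.of_bound hf.measurable.aestronglyMeasurable K ?_
  filter_upwards [tentLaw_abs_le] with u hu using hK u (abs_le.1 hu)

lemma integral_tentLaw_sq_le : ∫ u, u ^ 2 ∂tentLaw ≤ 1 := by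
  have h : ∫ u, u ^ 2 ∂tentLaw ≤ ∫ _, (1 : ℝ) ∂tentLaw := by
    refine integral_mono_ae (integrable_tentLaw (by fun_prop)) (integrable_const _) ?_
    filter_upwards [tentLaw_abs_le] with u hu
    rwa [sq_le_one_iff_abs_le_one]
  simpa using h

/-- Small shifts of the tent law are hard to detect. -/
lemma exists_tentLaw_shift : ∃ C : ℝ, 0 < C ∧ ∀ (φ : ℝ → ℝ) (_ : Measurable φ)
    (_ : ∀ u, |φ u| ≤ 1) (y : ℝ), (∫ u, (φ (u + y) - φ (u - y)) ∂tentLaw) ^ 2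
      ≤ C * y ^ 2 * ∫ u, (φ (u + y) ^ 2 + φ (u - y) ^ 2) ∂tentLaw := by
  obtain ⟨C, hC, hCy⟩ := exists_integral_tent_sub_sq_le
  set Z := ∫ u, tent u ^ 2 with hZ
  have hZ0 : 0 < Z := integral_tent_sq_pos
  refine ⟨2 * C / Z, by positivity, fun φ hφ hφ1 y => ?_⟩
  have hi1 : Integrable fun u => tent (u - y) ^ 2 := integrable_tent_sq.comp_sub_right y
  have hi2 : Integrable fun u => tent (u + y) ^ 2 := integrable_tent_sq.comp_add_right y
  have hmul : ∀ {g ψ : ℝ → ℝ}, Integrable g → Measurable ψ → (∀ u, |ψ u| ≤ 1) →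
      Integrable fun u => g u * ψ u := fun hg hψ h1 =>
    hg.mul_bdd (c := 1) hψ.aestronglyMeasurable (ae_of_all _ h1)
  have hφ2 : ∀ u, |φ u ^ 2| ≤ 1 := fun u => by
    rw [abs_pow]; exact pow_le_one₀ (abs_nonneg _) (hφ1 u)
  have hφ2m : Measurable fun u => φ u ^ 2 := hφ.pow_const 2
  -- translate the shifts of the test function to the density
  have hshift : ∀ ψ : ℝ → ℝ, Measurable ψ → (∀ u, |ψ u| ≤ 1) → ∀ s : ℝ,
      (s = 1 ∨ s = -1) → ∫ u, (ψ (u + y) + s * ψ (u - y)) ∂tentLaw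
        = (∫ u, (tent (u - y) ^ 2 + s * tent (u + y) ^ 2) * ψ u) / Z := fun ψ hψ hψ1 s hs => by
    rw [integral_tentLaw]
    congr 1
    have e1 : ∫ u, tent u ^ 2 * ψ (u + y) = ∫ u, tent (u - y) ^ 2 * ψ u := by
      rw [← integral_sub_right_eq_self (fun u => tent u ^ 2 * ψ (u + y)) y]
      simp
    have e2 : ∫ u, tent u ^ 2 * ψ (u - y) = ∫ u, tent (u + y) ^ 2 * ψ u := by
      rw [← integral_add_right_eq_self (fun u => tent u ^ 2 * ψ (u - y)) y]
      simp
    have e3 : ∀ u, tent u ^ 2 * (ψ (u + y) + s * ψ (u - y))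
        = tent u ^ 2 * ψ (u + y) + s * (tent u ^ 2 * ψ (u - y)) := fun u => by ring
    have e4 : ∀ u, (tent (u - y) ^ 2 + s * tent (u + y) ^ 2) * ψ u
        = tent (u - y) ^ 2 * ψ u + s * (tent (u + y) ^ 2 * ψ u) := fun u => by ring
    simp_rw [e3, e4]
    rw [integral_add (hmul integrable_tent_sq (by fun_prop) fun u => hψ1 _)
        ((hmul integrable_tent_sq (by fun_prop) fun u => hψ1 _).const_mul s),
      integral_add (hmul hi1 hψ hψ1) ((hmul hi2 hψ hψ1).const_mul s), integral_const_mul,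
      integral_const_mul, e1, e2]
  have h1 := hshift φ hφ hφ1 (-1) (Or.inr rfl)
  have h2 := hshift (fun u => φ u ^ 2) hφ2m hφ2 1 (Or.inl rfl)
  simp only [neg_mul, one_mul, ← sub_eq_add_neg] at h1 h2
  rw [h1, h2]
  -- The density is a square, so the difference of its shifts factors. Cauchy–Schwarz puts the
  -- Lipschitz factor `f` on one side and leaves the sum of the shifted densities, up to a factor
  -- `2`, on the other.
  let f : ℝ → ℝ := fun u => tent (u - y) - tent (u + y)
  let g : ℝ → ℝ := fun u => (tent (u - y) + tent (u + y)) * φ u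
  have htm : Measurable tent := continuous_tent.measurable
  have hfi : Integrable fun u => f u ^ 2 := by
    refine ((hi1.const_mul 2).add (hi2.const_mul 2)).mono' (by fun_prop) (ae_of_all _ fun u => ?_)
    rw [Real.norm_eq_abs, abs_of_nonneg (sq_nonneg _)]
    simp only [f, Pi.add_apply]
    nlinarith [sq_nonneg (tent (u - y) + tent (u + y))]
  have hgle : ∀ u, g u ^ 2 ≤ 2 * ((tent (u - y) ^ 2 + tent (u + y) ^ 2) * φ u ^ 2) := fun u => by
    simp only [g, mul_pow]
    rw [← mul_assoc]
    refine mul_le_mul_of_nonneg_right ?_ (sq_nonneg _)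
    nlinarith [sq_nonneg (tent (u - y) - tent (u + y))]
  have hi12 : Integrable fun u => 2 * ((tent (u - y) ^ 2 + tent (u + y) ^ 2) * φ u ^ 2) :=
    (hmul (hi1.add hi2) hφ2m hφ2).const_mul 2
  have hgi : Integrable fun u => g u ^ 2 := by
    refine hi12.mono' (by fun_prop) (ae_of_all _ fun u => ?_)
    rw [Real.norm_eq_abs, abs_of_nonneg (sq_nonneg _)]
    exact hgle u
  have hfg : ∀ u, (tent (u - y) ^ 2 - tent (u + y) ^ 2) * φ u = f u * g u := fun u => by
    simp only [f, g]; ring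
  have hfgi : Integrable fun u => f u * g u := by
    simp_rw [← hfg]
    exact hmul (hi1.sub hi2) hφ hφ1
  simp_rw [hfg]
  have h3 := integral_mul_sq_le hfi hgi hfgi
  have h4 : ∫ u, g u ^ 2 ≤ 2 * ∫ u, (tent (u - y) ^ 2 + tent (u + y) ^ 2) * φ u ^ 2 := by
    rw [← integral_const_mul]
    exact integral_mono hgi hi12 hgle
  have h5 : 0 ≤ ∫ u, g u ^ 2 := integral_nonneg fun u => sq_nonneg _
  have h6 := h3.trans (mul_le_mul (hCy y) h4 h5 (by positivity))
  rw [div_pow, div_le_iff₀ (by positivity)]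
  refine h6.trans (le_of_eq ?_)
  field_simp

/-- `η` is a centred law with standard deviation `w`, supported close to `[-w, w]`, whose small
shifts are hard to detect. -/
structure IsNoise (η : Measure ℝ) (w ρ C : ℝ) : Prop where
  ae_abs_le : ∀ᵐ t ∂η, |t| ≤ w + ρ
  mean : ∫ t, t ∂η = 0
  sq : ∫ t, t ^ 2 ∂η = w ^ 2
  shift : ∀ (φ : ℝ → ℝ) (_ : Measurable φ) (_ : ∀ u, |φ u| ≤ 1) (y : ℝ),
    (∫ t, (φ (t + y) - φ (t - y)) ∂η) ^ 2
      ≤ C * y ^ 2 * ∫ t, (φ (t + y) ^ 2 + φ (t - y) ^ 2) ∂η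

/-- Two narrow tents of width `ρ`, centred at `± b`, are mixed equally. The variance is `b ^ 2 + ρ ^
2 * V`, so `b` can be adjusted to make it exactly `w ^ 2`, with the support exceeding `w` by at most
`ρ`. Smoothing at scale `ρ` costs the factor `1 / ρ ^ 2` in the shift constant. -/
theorem exists_isNoise : ∃ C : ℝ, 0 < C ∧ ∀ w ρ : ℝ, 0 < ρ → ρ ≤ w →
    ∃ η : Measure ℝ, IsProbabilityMeasure η ∧ IsNoise η w ρ (C / ρ ^ 2) := by
  obtain ⟨C, hC, hshift⟩ := exists_tentLaw_shift
  refine ⟨C, hC, fun w ρ hρ hρw => ?_⟩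
  set V := ∫ u, u ^ 2 ∂tentLaw with hV
  have hV0 : 0 ≤ V := integral_nonneg fun u => sq_nonneg _
  have hV1 : V ≤ 1 := integral_tentLaw_sq_le
  have hw : 0 < w := hρ.trans_le hρw
  have hb2 : 0 ≤ w ^ 2 - ρ ^ 2 * V := by nlinarith [sq_nonneg ρ]
  set b := √(w ^ 2 - ρ ^ 2 * V) with hb
  have hbsq : b ^ 2 = w ^ 2 - ρ ^ 2 * V := Real.sq_sqrt hb2
  have hb0 : 0 ≤ b := Real.sqrt_nonneg _
  have hbw : b ≤ w := abs_le_of_sq_le_sq' (by nlinarith [sq_nonneg ρ]) hw.le |>.2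
  have hm : ∀ s : ℝ, Measurable fun u : ℝ => s + ρ * u := fun s => by fun_prop
  have hpm : ∀ s : ℝ, IsProbabilityMeasure (tentLaw.map fun u => s + ρ * u) := fun s =>
    Measure.isProbabilityMeasure_map (hm s).aemeasurable
  have hp1 := hpm b
  have hp2 := hpm (-b)
  let η : Measure ℝ := (2⁻¹ : ℝ≥0∞) • (tentLaw.map fun u => b + ρ * u)
    + (2⁻¹ : ℝ≥0∞) • (tentLaw.map fun u => -b + ρ * u)
  have hint : ∀ f : ℝ → ℝ, Measurable f → Integrable (fun u => f (b + ρ * u)) tentLaw →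
      Integrable (fun u => f (-b + ρ * u)) tentLaw →
      ∫ t, f t ∂η = (∫ u, f (b + ρ * u) ∂tentLaw + ∫ u, f (-b + ρ * u) ∂tentLaw) / 2 :=
    fun f hf h1 h2 => by
      have h1' := (integrable_map_measure hf.aestronglyMeasurable (hm b).aemeasurable).2 h1
      have h2' := (integrable_map_measure hf.aestronglyMeasurable (hm (-b)).aemeasurable).2 h2
      rw [integral_add_measure (h1'.smul_measure (by simp)) (h2'.smul_measure (by simp)),
        integral_smul_measure, integral_smul_measure,
        integral_map (hm b).aemeasurable hf.aestronglyMeasurable,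
        integral_map (hm (-b)).aemeasurable hf.aestronglyMeasurable]
      simp only [ENNReal.toReal_inv, ENNReal.toReal_ofNat, smul_eq_mul]
      ring
  have hintc : ∀ f : ℝ → ℝ, Continuous f →
      ∫ t, f t ∂η = (∫ u, f (b + ρ * u) ∂tentLaw + ∫ u, f (-b + ρ * u) ∂tentLaw) / 2 :=
    fun f hf => hint f hf.measurable (integrable_tentLaw (by fun_prop))
      (integrable_tentLaw (by fun_prop))
  have hintb : ∀ f : ℝ → ℝ, Measurable f → ∀ M, (∀ t, |f t| ≤ M) →
      ∫ t, f t ∂η = (∫ u, f (b + ρ * u) ∂tentLaw + ∫ u, f (-b + ρ * u) ∂tentLaw) / 2 :=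
    fun f hf M hM => hint f hf
      (Integrable.of_bound (hf.comp (hm b)).aestronglyMeasurable M (ae_of_all _ fun _ => hM _))
      (Integrable.of_bound (hf.comp (hm (-b))).aestronglyMeasurable M
        (ae_of_all _ fun _ => hM _))
  have hsq : ∀ s : ℝ, ∫ u, (s + ρ * u) ^ 2 ∂tentLaw = s ^ 2 + ρ ^ 2 * V := fun s => by
    have : ∀ u : ℝ, (s + ρ * u) ^ 2 = s ^ 2 + (2 * s * ρ) * u + ρ ^ 2 * u ^ 2 := fun u => by ring
    simp_rw [this]
    rw [integral_add_add (integrable_const _) (integrable_tentLaw (by fun_prop))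
      (integrable_tentLaw (by fun_prop)), integral_const_mul, integral_const_mul,
      integral_tentLaw_id, ← hV]
    simp
  have hlin : ∀ s : ℝ, ∫ u, (s + ρ * u) ∂tentLaw = s := fun s => by
    rw [integral_add (integrable_const _) (integrable_tentLaw (by fun_prop)),
      integral_const_mul, integral_tentLaw_id]
    simp
  refine ⟨η, ⟨?_⟩, ?_, ?_, ?_, fun φ hφ hφ1 y => ?_⟩
  · simp [η, ENNReal.inv_two_add_inv_two]
  · have hms : MeasurableSet {t : ℝ | |t| ≤ w + ρ} :=
      measurableSet_le (by fun_prop) measurable_const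
    have hs : ∀ s : ℝ, |s| ≤ w → ∀ᵐ t ∂(tentLaw.map fun u => s + ρ * u), |t| ≤ w + ρ :=
      fun s hs => by
        rw [ae_map_iff (hm s).aemeasurable hms]
        filter_upwards [tentLaw_abs_le] with u hu
        refine (abs_add_le _ _).trans ?_
        rw [abs_mul, abs_of_pos hρ]
        nlinarith
    rw [ae_add_measure_iff]
    exact ⟨Measure.ae_smul_measure (hs b (by rwa [abs_of_nonneg hb0])) _,
      Measure.ae_smul_measure (hs (-b) (by rwa [abs_neg, abs_of_nonneg hb0])) _⟩
  · rw [hintc _ continuous_id']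
    simp_rw [hlin]
    ring
  · rw [hintc _ (continuous_pow 2)]
    simp_rw [hsq]
    rw [neg_sq, hbsq]
    ring
  · have hφy : ∀ s : ℝ, (∫ u, (φ (s + ρ * u + y) - φ (s + ρ * u - y)) ∂tentLaw) ^ 2
        ≤ C / ρ ^ 2 * y ^ 2 * ∫ u, (φ (s + ρ * u + y) ^ 2 + φ (s + ρ * u - y) ^ 2) ∂tentLaw :=
      fun s => by
        have h := hshift (fun u => φ (s + ρ * u)) (hφ.comp (hm s)) (fun u => hφ1 _) (y / ρ)
        have e1 : ∀ u, s + ρ * (u + y / ρ) = s + ρ * u + y := fun u => by field_simp; ring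
        have e2 : ∀ u, s + ρ * (u - y / ρ) = s + ρ * u - y := fun u => by field_simp; ring
        simp only [e1, e2] at h
        convert h using 2
        field_simp
    have hφ2 : ∀ u, φ u ^ 2 ≤ 1 := fun u => by
      rw [sq_le_one_iff_abs_le_one]; exact hφ1 u
    rw [hintb (fun t => φ (t + y) - φ (t - y)) (by fun_prop) 2 fun t => by
        refine (abs_sub _ _).trans ?_
        linarith [hφ1 (t + y), hφ1 (t - y)],
      hintb (fun t => φ (t + y) ^ 2 + φ (t - y) ^ 2) (by fun_prop) 2 fun t => by
        rw [abs_of_nonneg (by positivity)]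
        linarith [hφ2 (t + y), hφ2 (t - y)]]
    have h1 := hφy b
    have h2 := hφy (-b)
    -- The shift bound passes to the mixture because the square of a mean is at most the mean of the
    -- squares.
    rw [mul_div_assoc', mul_add]
    nlinarith [sq_nonneg (∫ u, (φ (b + ρ * u + y) - φ (b + ρ * u - y)) ∂tentLaw
      - ∫ u, (φ (-b + ρ * u + y) - φ (-b + ρ * u - y)) ∂tentLaw)]

/-! ### Information on one coordinate carried by a reward. -/

section Information

variable {n : ℕ} {Q : Measure (Fin n → ℝ)} {v : ℝ}

lemma sq_sum_mul_le (a x : Fin n → ℝ) : (a ⬝ᵥ x) ^ 2 ≤ (∑ i, a i ^ 2) * ∑ i, x i ^ 2 :=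
  Finset.sum_mul_sq_le_sq_mul_sq _ _ _

lemma IsIsotropic.abs_dot_le (hQ : IsIsotropic Q v) (a : Fin n → ℝ) :
    ∀ᵐ x ∂Q, |a ⬝ᵥ x| ≤ √((∑ i, a i ^ 2) * (n * v)) := by
  filter_upwards [hQ.sum_sq] with x hx
  refine Real.abs_le_sqrt ?_
  rw [← hx]
  exact sq_sum_mul_le a x

lemma IsIsotropic.abs_coord_le (hQ : IsIsotropic Q v) (i : Fin n) :
    ∀ᵐ x ∂Q, |x i| ≤ √(n * v) := by
  filter_upwards [hQ.sum_sq] with x hx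
  refine Real.abs_le_sqrt ?_
  rw [← hx]
  exact Finset.single_le_sum (f := fun i => x i ^ 2) (fun j _ => sq_nonneg _) (Finset.mem_univ i)

lemma measurable_dot_right (a : Fin n → ℝ) : Measurable fun x : Fin n → ℝ => a ⬝ᵥ x := by
  unfold dotProduct; fun_prop

lemma continuous_dot_right (a : Fin n → ℝ) : Continuous fun x : Fin n → ℝ => a ⬝ᵥ x := by
  unfold dotProduct; fun_prop

lemma IsIsotropic.integral_coord (hQ : IsIsotropic Q v) (i : Fin n) : ∫ x, x i ∂Q = 0 := by
  have := hQ.integral_neg fun x => x i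
  simp only [Pi.neg_apply] at this
  rw [MeasureTheory.integral_neg] at this
  linarith

lemma IsIsotropic.integral_dot (hQ : IsIsotropic Q v) (a : Fin n → ℝ) : ∫ x, a ⬝ᵥ x ∂Q = 0 := by
  have := hQ.integral_neg fun x => a ⬝ᵥ x
  simp only [dotProduct_neg] at this
  rw [MeasureTheory.integral_neg] at this
  linarith

lemma IsIsotropic.integral_dot_mul_coord_sq (hQ : IsIsotropic Q v) (a : Fin n → ℝ) (i : Fin n) :
    ∫ x, (a ⬝ᵥ x) * x i ^ 2 ∂Q = 0 := by
  have := hQ.integral_neg fun x => (a ⬝ᵥ x) * x i ^ 2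
  simp only [dotProduct_neg, Pi.neg_apply, neg_sq, neg_mul] at this
  rw [MeasureTheory.integral_neg] at this
  linarith

variable [IsProbabilityMeasure Q]

lemma IsIsotropic.integrable (hQ : IsIsotropic Q v) {f : (Fin n → ℝ) → ℝ} (hf : Continuous f) :
    Integrable f Q := by
  obtain ⟨K, hK⟩ := (isCompact_univ_pi fun _ : Fin n =>
    isCompact_Icc (a := -√(n * v)) (b := √(n * v))).exists_bound_of_continuousOn hf.continuousOn
  refine Integrable.of_bound hf.measurable.aestronglyMeasurable K ?_
  filter_upwards [ae_all_iff.2 hQ.abs_coord_le] with x hx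
  exact hK x fun i _ => abs_le.1 (hx i)

lemma IsIsotropic.integral_dot_mul_coord (hQ : IsIsotropic Q v) (a : Fin n → ℝ) (i : Fin n) :
    ∫ x, (a ⬝ᵥ x) * x i ∂Q = a i * v := by
  have e : ∀ x : Fin n → ℝ, x i = Pi.single i 1 ⬝ᵥ x := fun x => by simp
  have h1 := hQ.dot_sq (a + Pi.single i 1)
  have h2 := hQ.dot_sq (a - Pi.single i 1)
  have h3 : ∀ x : Fin n → ℝ, (a ⬝ᵥ x) * x i
      = (1 / 4) * ((a + Pi.single i 1) ⬝ᵥ x) ^ 2 - (1 / 4) * ((a - Pi.single i 1) ⬝ᵥ x) ^ 2 :=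
    fun x => by
      rw [add_dotProduct, sub_dotProduct, ← e]; ring
  have hi : ∀ b : Fin n → ℝ, Integrable (fun x => (b ⬝ᵥ x) ^ 2) Q := fun b =>
    hQ.integrable ((continuous_dot_right b).pow 2)
  simp_rw [h3]
  rw [integral_sub ((hi _).const_mul _) ((hi _).const_mul _), integral_const_mul,
    integral_const_mul, h1, h2]
  have h4 : ∑ j, (a + Pi.single i 1 : Fin n → ℝ) j ^ 2 - ∑ j, (a - Pi.single i 1 : Fin n → ℝ) j ^ 2
      = 4 * a i := by
    rw [← Finset.sum_sub_distrib, Finset.sum_eq_single i]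
    · simp; ring
    · intro j _ hj
      simp [hj]
    · simp
  linear_combination (v / 4) * h4

lemma IsIsotropic.integral_coord_sq (hQ : IsIsotropic Q v) (i : Fin n) :
    ∫ x, x i ^ 2 ∂Q = v := by
  have := hQ.integral_dot_mul_coord (Pi.single i 1) i
  simpa [sq] using this

variable {η : Measure ℝ} [IsProbabilityMeasure η] {m : ℝ}

/-- The reward of action `a` when the parameter is `(m + z.1, z.2)`. -/
def pairReward (m : ℝ) (a : Fin (n + 1) → ℝ) (z : ℝ × (Fin n → ℝ)) : ℝ :=
  a 0 * (m + z.1) + Fin.tail a ⬝ᵥ z.2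

lemma measurable_pairReward (m : ℝ) (a : Fin (n + 1) → ℝ) : Measurable (pairReward m a) := by
  unfold pairReward dotProduct; fun_prop

lemma dot_smul_cons (σ m : ℝ) (a : Fin (n + 1) → ℝ) (z : ℝ × (Fin n → ℝ)) :
    a ⬝ᵥ (σ • (Fin.cons (m + z.1) z.2 : Fin (n + 1) → ℝ)) = σ * pairReward m a z := by
  rw [dotProduct_smul, smul_eq_mul]
  congr 1
  simp [dotProduct, Fin.sum_univ_succ, pairReward, Fin.tail]

lemma integrable_snd_mul (hQ : IsIsotropic Q v) {g : (Fin n → ℝ) → ℝ} (hg : Continuous g)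
    {f : ℝ × (Fin n → ℝ) → ℝ} (hf : Measurable f) {M : ℝ} (hM : ∀ z, |f z| ≤ M) :
    Integrable (fun z => g z.2 * f z) (η.prod Q) :=
  (hQ.integrable hg).comp_snd η |>.mul_bdd (c := M) hf.aestronglyMeasurable (ae_of_all _ hM)

lemma integral_coord_mul_pairReward (hQ : IsIsotropic Q v) (a : Fin (n + 1) → ℝ) (i : Fin n)
    {φ : ℝ → ℝ} (hφ : Measurable φ) {M : ℝ} (hM : ∀ y, |φ y| ≤ M) :
    (∑ j, Fin.tail a j ^ 2) * ∫ z, z.2 i * φ (pairReward m a z) ∂(η.prod Q)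
      = Fin.tail a i * ∫ z, (Fin.tail a ⬝ᵥ z.2) * φ (pairReward m a z) ∂(η.prod Q) := by
  have hφm : Measurable fun z => φ (pairReward m a z) := hφ.comp (measurable_pairReward m a)
  rw [integral_prod _ (integrable_snd_mul (g := fun x => x i) hQ (by fun_prop) hφm fun _ => hM _),
    integral_prod _ (integrable_snd_mul (g := fun x => Fin.tail a ⬝ᵥ x) hQ
      (continuous_dot_right _) hφm fun _ => hM _), ← integral_const_mul, ← integral_const_mul]
  refine integral_congr_ae (ae_of_all _ fun t => ?_)
  exact hQ.coord_mul (Fin.tail a) i (fun y => φ (a 0 * (m + t) + y)) M (by fun_prop)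
    fun y => hM _

lemma integral_coord_mul_pairReward_eq_zero (hQ : IsIsotropic Q v) {a : Fin (n + 1) → ℝ}
    (i : Fin n) (ha : ∑ j, Fin.tail a j ^ 2 = 0)
    {φ : ℝ → ℝ} (hφ : Measurable φ) {M : ℝ} (hM : ∀ y, |φ y| ≤ M) :
    ∫ z, z.2 i * φ (pairReward m a z) ∂(η.prod Q) = 0 := by
  have h0 : Fin.tail a = 0 := by
    ext j
    have := (Finset.sum_eq_zero_iff_of_nonneg fun j _ => sq_nonneg (Fin.tail a j)).1 ha j
      (Finset.mem_univ j)
    simpa using this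
  have hφm : Measurable fun z => φ (pairReward m a z) := hφ.comp (measurable_pairReward m a)
  rw [integral_prod _ (integrable_snd_mul (g := fun x => x i) hQ (by fun_prop) hφm fun _ => hM _)]
  simp only [pairReward, h0, zero_dotProduct, add_zero]
  simp_rw [integral_mul_const, hQ.integral_coord i, zero_mul]
  simp

/-- The information on coordinate `i` in a reward, when nothing else hides it. -/
lemma sq_integral_coord_mul_le (hQ : IsIsotropic Q v) (a : Fin (n + 1) → ℝ) (i : Fin n)
    {φ : ℝ → ℝ} (hφ : Measurable φ) (h1 : ∀ y, |φ y| ≤ 1) :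
    (∫ z, z.2 i * φ (pairReward m a z) ∂(η.prod Q)) ^ 2
      ≤ v * (Fin.tail a i ^ 2 / ∑ j, Fin.tail a j ^ 2)
        * ∫ z, φ (pairReward m a z) ^ 2 ∂(η.prod Q) := by
  set s := ∑ j, Fin.tail a j ^ 2 with hs
  have hφm : Measurable fun z => φ (pairReward m a z) := hφ.comp (measurable_pairReward m a)
  have hs0 : 0 ≤ s := Finset.sum_nonneg fun j _ => sq_nonneg _
  -- If the tail of `a` vanishes, the reward does not involve the isotropic part. The quotient in
  -- the bound is then `0 / 0 = 0`, so the correlation has to be exactly zero.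
  rcases hs0.eq_or_lt with h0 | h0
  · rw [integral_coord_mul_pairReward_eq_zero hQ i h0.symm hφ h1, ← h0]
    simp
  have h2 := integral_coord_mul_pairReward (η := η) (m := m) hQ a i hφ h1
  rw [← hs] at h2
  have hY : ∫ z, (Fin.tail a ⬝ᵥ z.2) ^ 2 ∂(η.prod Q) = s * v := by
    have := integral_prod_mul (μ := η) (ν := Q) (fun _ => (1 : ℝ)) fun x => (Fin.tail a ⬝ᵥ x) ^ 2
    simp only [one_mul] at this
    rw [this, hQ.dot_sq]
    simp [hs]
  have h3 := integral_mul_sq_le (P := η.prod Q) (f := fun z => Fin.tail a ⬝ᵥ z.2)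
    (g := fun z => φ (pairReward m a z))
    ((hQ.integrable ((continuous_dot_right (Fin.tail a)).pow 2)).comp_snd η)
    (Integrable.of_bound (hφm.pow_const 2).aestronglyMeasurable 1 (ae_of_all _ fun z => by
      rw [Real.norm_eq_abs, abs_pow]; exact pow_le_one₀ (abs_nonneg _) (h1 _)))
    (integrable_snd_mul (g := fun x => Fin.tail a ⬝ᵥ x) hQ (continuous_dot_right _) hφm
      fun _ => h1 _)
  rw [hY] at h3
  have h4 : ∫ z, z.2 i * φ (pairReward m a z) ∂(η.prod Q)
      = Fin.tail a i * (∫ z, (Fin.tail a ⬝ᵥ z.2) * φ (pairReward m a z) ∂(η.prod Q)) / s := by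
    rw [← h2]; field_simp
  rw [h4, div_pow, mul_pow, div_le_iff₀ (by positivity)]
  refine (mul_le_mul_of_nonneg_left h3 (sq_nonneg _)).trans (le_of_eq ?_)
  field_simp

/-- The information on coordinate `i` in a reward, when the noise hides it. -/
lemma sq_integral_coord_mul_le_of_noise {w ρ C : ℝ} (hC : 0 ≤ C) (hη : IsNoise η w ρ C)
    (hQ : IsIsotropic Q v)
    (a : Fin (n + 1) → ℝ) (ha : 1 / 2 ≤ a 0) (i : Fin n)
    {φ : ℝ → ℝ} (hφ : Measurable φ) (h1 : ∀ y, |φ y| ≤ 1) :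
    (∫ z, z.2 i * φ (pairReward m a z) ∂(η.prod Q)) ^ 2
      ≤ 6 * C * v ^ 2 * Fin.tail a i ^ 2 * ∫ z, φ (pairReward m a z) ^ 2 ∂(η.prod Q) := by
  set s := ∑ j, Fin.tail a j ^ 2 with hs
  have hφm : Measurable fun z => φ (pairReward m a z) := hφ.comp (measurable_pairReward m a)
  have hs0 : 0 ≤ s := Finset.sum_nonneg fun j _ => sq_nonneg _
  have hE0 : 0 ≤ ∫ z, φ (pairReward m a z) ^ 2 ∂(η.prod Q) := integral_nonneg fun z => sq_nonneg _
  rcases hs0.eq_or_lt with h0 | h0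
  · rw [integral_coord_mul_pairReward_eq_zero hQ i h0.symm hφ h1]
    rw [zero_pow two_ne_zero]
    positivity
  have ha0 : 0 < a 0 := by linarith
  have h2 := integral_coord_mul_pairReward (η := η) (m := m) hQ a i hφ h1
  rw [← hs] at h2
  let Y : (Fin n → ℝ) → ℝ := fun x => Fin.tail a ⬝ᵥ x
  have hYc : Continuous Y := continuous_dot_right _
  have hYneg : ∀ x, Y (-x) = -Y x := fun x => dotProduct_neg _ _
  -- The symmetry of `Q` replaces `φ` by the difference of its two shifts by `± Y x`, averaged over
  -- the noise. The shift property makes this difference itself of order `Y x`, which is the gain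
  -- over plain Cauchy–Schwarz.
  let D : (Fin n → ℝ) → ℝ := fun x =>
    ∫ t, (φ (a 0 * (m + t) + Y x) - φ (a 0 * (m + t) - Y x)) ∂η
  let B : (Fin n → ℝ) → ℝ := fun x =>
    ∫ t, (φ (a 0 * (m + t) + Y x) ^ 2 + φ (a 0 * (m + t) - Y x) ^ 2) ∂η
  have hYm : Measurable Y := hYc.measurable
  have hDm : Measurable fun z : (Fin n → ℝ) × ℝ =>
      φ (a 0 * (m + z.2) + Y z.1) - φ (a 0 * (m + z.2) - Y z.1) := by fun_prop
  have hBm : Measurable fun z : (Fin n → ℝ) × ℝ =>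
      φ (a 0 * (m + z.2) + Y z.1) ^ 2 + φ (a 0 * (m + z.2) - Y z.1) ^ 2 := by fun_prop
  have hDM : Measurable D := (hDm.stronglyMeasurable.integral_prod_right' (ν := η)).measurable
  have hBM : Measurable B := (hBm.stronglyMeasurable.integral_prod_right' (ν := η)).measurable
  have hφ2 : ∀ y, φ y ^ 2 ≤ 1 := fun y => by rw [sq_le_one_iff_abs_le_one]; exact h1 y
  have hB0 : ∀ x, 0 ≤ B x := fun x => integral_nonneg fun t => by positivity
  have hB2 : ∀ x, B x ≤ 2 := fun x => by
    have := norm_integral_le_of_norm_le_const (μ := η) (C := 2)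
      (f := fun t => φ (a 0 * (m + t) + Y x) ^ 2 + φ (a 0 * (m + t) - Y x) ^ 2)
      (ae_of_all _ fun t => by
        rw [Real.norm_eq_abs, abs_of_nonneg (by positivity)]
        linarith [hφ2 (a 0 * (m + t) + Y x), hφ2 (a 0 * (m + t) - Y x)])
    simp only [probReal_univ, mul_one] at this
    exact (le_abs_self _).trans this
  -- rewrite the correlation through differences of shifts
  have hφint : ∀ t, Integrable (fun x => Y x * φ (a 0 * (m + t) + Y x)) Q := fun t =>
    (hQ.integrable hYc).mul_bdd (c := 1) (Measurable.aestronglyMeasurable (by fun_prop))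
      (ae_of_all _ fun x => h1 _)
  have hφint' : ∀ t, Integrable (fun x => Y x * φ (a 0 * (m + t) - Y x)) Q := fun t =>
    (hQ.integrable hYc).mul_bdd (c := 1) (Measurable.aestronglyMeasurable (by fun_prop))
      (ae_of_all _ fun x => h1 _)
  have hint2 : Integrable (fun z : ℝ × (Fin n → ℝ) => Y z.2 *
      (φ (a 0 * (m + z.1) + Y z.2) - φ (a 0 * (m + z.1) - Y z.2))) (η.prod Q) :=
    integrable_snd_mul hQ hYc (M := 2) (by fun_prop) fun z => by
      refine (abs_sub _ _).trans ?_
      linarith [h1 (a 0 * (m + z.1) + Y z.2), h1 (a 0 * (m + z.1) - Y z.2)]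
  have h5 : 2 * ∫ z, Y z.2 * φ (pairReward m a z) ∂(η.prod Q) = ∫ x, Y x * D x ∂Q := by
    have e1 : 2 * ∫ z, Y z.2 * φ (pairReward m a z) ∂(η.prod Q)
        = ∫ t, ∫ x, Y x * (φ (a 0 * (m + t) + Y x) - φ (a 0 * (m + t) - Y x)) ∂Q ∂η := by
      rw [integral_prod _ (integrable_snd_mul hQ hYc hφm fun _ => h1 _), ← integral_const_mul]
      refine integral_congr_ae (ae_of_all _ fun t => ?_)
      have hneg := hQ.integral_neg fun x => Y x * φ (a 0 * (m + t) + Y x)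
      simp only [hYneg, neg_mul, ← sub_eq_add_neg] at hneg
      rw [MeasureTheory.integral_neg] at hneg
      simp only [mul_sub]
      rw [integral_sub (hφint t) (hφint' t)]
      change 2 * ∫ x, Y x * φ (a 0 * (m + t) + Y x) ∂Q = _
      linarith
    rw [e1, integral_integral_swap hint2]
    simp_rw [integral_const_mul]
    rfl
  have h6 : ∫ x, B x ∂Q = 2 * ∫ z, φ (pairReward m a z) ^ 2 ∂(η.prod Q) := by
    have hb : Integrable (fun z : (Fin n → ℝ) × ℝ =>
        φ (a 0 * (m + z.2) + Y z.1) ^ 2 + φ (a 0 * (m + z.2) - Y z.1) ^ 2) (Q.prod η) :=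
      Integrable.of_bound hBm.aestronglyMeasurable 2 (ae_of_all _ fun z => by
        rw [Real.norm_eq_abs, abs_of_nonneg (by positivity)]
        linarith [hφ2 (a 0 * (m + z.2) + Y z.1), hφ2 (a 0 * (m + z.2) - Y z.1)])
    have hφ2i : ∀ {f : (Fin n → ℝ) → ℝ}, Measurable f → Integrable (fun x => φ (f x) ^ 2) Q :=
      fun hf => Integrable.of_bound ((hφ.comp hf).pow_const 2).aestronglyMeasurable 1
        (ae_of_all _ fun x => by
          rw [Real.norm_eq_abs, abs_of_nonneg (by positivity)]; exact hφ2 _)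
    have e1 : ∫ x, B x ∂Q
        = ∫ t, ∫ x, (φ (a 0 * (m + t) + Y x) ^ 2 + φ (a 0 * (m + t) - Y x) ^ 2) ∂Q ∂η :=
      integral_integral_swap hb
    rw [e1, integral_prod _ (Integrable.of_bound (hφm.pow_const 2).aestronglyMeasurable 1
      (ae_of_all _ fun z => by
        rw [Real.norm_eq_abs, abs_of_nonneg (by positivity)]; exact hφ2 _)), ← integral_const_mul]
    refine integral_congr_ae (ae_of_all _ fun t => ?_)
    have hneg := hQ.integral_neg fun x => φ (a 0 * (m + t) + Y x) ^ 2
    simp only [hYneg, ← sub_eq_add_neg] at hneg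
    simp only
    rw [integral_add (hφ2i (by fun_prop)) (hφ2i (by fun_prop)), hneg, ← two_mul]
    rfl
  -- A shift of the reward by `Y x` is a shift of the noise by `Y x / a 0`; since `a 0 ≥ 1/2`, this
  -- at most quadruples the square.
  have hD : ∀ x, D x ^ 2 ≤ (2 * √C * √(B x) * Y x) ^ 2 := fun x => by
    have h7 := hη.shift (fun t => φ (a 0 * (m + t))) (by fun_prop) (fun u => h1 _) (Y x / a 0)
    have e1 : ∀ t, a 0 * (m + (t + Y x / a 0)) = a 0 * (m + t) + Y x := fun t => by
      field_simp; ring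
    have e2 : ∀ t, a 0 * (m + (t - Y x / a 0)) = a 0 * (m + t) - Y x := fun t => by
      field_simp; ring
    simp only [e1, e2] at h7
    refine h7.trans ?_
    rw [mul_pow, mul_pow, mul_pow, Real.sq_sqrt hC, Real.sq_sqrt (hB0 x)]
    have h8 : (Y x / a 0) ^ 2 ≤ 4 * Y x ^ 2 := by
      rw [div_pow, div_le_iff₀ (by positivity)]
      have : 1 ≤ 4 * a 0 ^ 2 := by nlinarith
      nlinarith [sq_nonneg (Y x)]
    calc C * (Y x / a 0) ^ 2 * B x ≤ C * (4 * Y x ^ 2) * B x :=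
          mul_le_mul_of_nonneg_right (mul_le_mul_of_nonneg_left h8 hC) (hB0 x)
      _ = 2 ^ 2 * C * B x * Y x ^ 2 := by ring
  have hYD : ∀ x, |Y x * D x| ≤ 2 * √C * (Y x ^ 2 * √(B x)) := fun x => by
    have h9 := sq_le_sq.1 (hD x)
    rw [abs_mul]
    calc |Y x| * |D x| ≤ |Y x| * |2 * √C * √(B x) * Y x| := by gcongr
      _ = 2 * √C * (Y x ^ 2 * √(B x)) := by
        rw [abs_mul, abs_of_nonneg (by positivity : 0 ≤ 2 * √C * √(B x)), ← sq_abs (Y x)]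
        ring
  have hYBi : Integrable (fun x => Y x ^ 2 * √(B x)) Q :=
    (hQ.integrable (hYc.pow 2)).mul_bdd (c := √2) hBM.sqrt.aestronglyMeasurable
      (ae_of_all _ fun x => by
        rw [Real.norm_eq_abs, abs_of_nonneg (Real.sqrt_nonneg _)]
        exact Real.sqrt_le_sqrt (hB2 x))
  have h10 : |∫ x, Y x * D x ∂Q| ≤ 2 * √C * ∫ x, Y x ^ 2 * √(B x) ∂Q := by
    rw [← integral_const_mul]
    exact (abs_integral_le_integral_abs).trans
      (integral_mono_of_nonneg (ae_of_all _ fun x => abs_nonneg _) (hYBi.const_mul _)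
        (ae_of_all _ hYD))
  have hsqrtB : ∀ x, √(B x) ^ 2 = B x := fun x => Real.sq_sqrt (hB0 x)
  have hY4 : ∀ x, (Y x ^ 2) ^ 2 = Y x ^ 4 := fun x => by ring
  have hBi : Integrable B Q := Integrable.of_bound hBM.aestronglyMeasurable 2
    (ae_of_all _ fun x => by rw [Real.norm_eq_abs, abs_of_nonneg (hB0 x)]; exact hB2 x)
  -- Here the fourth moment of `Y` enters, and with it the factor `v ^ 2` instead of `v`.
  have h11 := integral_mul_sq_le (P := Q) (f := fun x => Y x ^ 2) (g := fun x => √(B x))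
    (by simp_rw [hY4]; exact hQ.integrable (hYc.pow 4)) (by simp_rw [hsqrtB]; exact hBi) hYBi
  simp_rw [hsqrtB, hY4] at h11
  have h12 : (∫ x, Y x * D x ∂Q) ^ 2
      ≤ 4 * C * (3 * (s * v) ^ 2 * (2 * ∫ z, φ (pairReward m a z) ^ 2 ∂(η.prod Q))) := by
    rw [← sq_abs]
    calc |∫ x, Y x * D x ∂Q| ^ 2 ≤ (2 * √C * ∫ x, Y x ^ 2 * √(B x) ∂Q) ^ 2 := by gcongr
      _ = 4 * C * (∫ x, Y x ^ 2 * √(B x) ∂Q) ^ 2 := by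
        rw [mul_pow, mul_pow, Real.sq_sqrt hC]; ring
      _ ≤ 4 * C * ((∫ x, Y x ^ 4 ∂Q) * ∫ x, B x ∂Q) := by gcongr
      _ ≤ _ := by
        rw [h6]
        gcongr
        exact hQ.dot_pow_four (Fin.tail a)
  rw [← h5] at h12
  have h4 : ∫ z, z.2 i * φ (pairReward m a z) ∂(η.prod Q)
      = Fin.tail a i * (∫ z, Y z.2 * φ (pairReward m a z) ∂(η.prod Q)) / s := by
    rw [eq_div_iff h0.ne', mul_comm, h2]
  rw [h4, div_pow, mul_pow, div_le_iff₀ (by positivity)]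
  have h13 := mul_le_mul_of_nonneg_left h12 (sq_nonneg (Fin.tail a i))
  nlinarith

end Information

/-! ### The hard parameter laws: support, mean, covariance and information. -/

section HardLaw

variable {n : ℕ} {Q : Measure (Fin n → ℝ)} {v : ℝ}

/-- The vector of signs encoded by `x`. -/
def signVec (x : Fin n → Bool) : Fin n → ℝ := fun i => sgn (x i)

lemma sum_signVec_sq (x : Fin n → Bool) : ∑ i, signVec x i ^ 2 = n := by
  simp [signVec, sq]

lemma signVec_dot_sub_flip (x : Fin n → Bool) (i : Fin n) (y : Fin n → ℝ) :
    signVec x ⬝ᵥ y = signVec (flip x i) ⬝ᵥ y + 2 * sgn (x i) * y i := by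
  rw [← sub_eq_iff_eq_add', ← sub_dotProduct, dotProduct, Finset.sum_eq_single i]
  · simp only [Pi.sub_apply, signVec, flip_self, sgn_not]; ring
  · intro j _ hj
    simp [signVec, flip_of_ne x hj]
  · simp

/-- The density tilting the isotropic part of the parameter towards the signs `x`. -/
def tilt (κ : ℝ) (x : Fin n → Bool) (z : ℝ × (Fin n → ℝ)) : ℝ := 1 + κ * (signVec x ⬝ᵥ z.2)

lemma continuous_tilt (κ : ℝ) (x : Fin n → Bool) : Continuous (tilt κ x) := by
  unfold tilt dotProduct; fun_prop

/-- The affine map that places the parameter in `ℝ^(n+1)`. -/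
def place (σ m : ℝ) (z : ℝ × (Fin n → ℝ)) : Fin (n + 1) → ℝ :=
  σ • (Fin.cons (m + z.1) z.2 : Fin (n + 1) → ℝ)

@[simp] lemma place_zero (σ m : ℝ) (z : ℝ × (Fin n → ℝ)) : place σ m z 0 = σ * (m + z.1) := by
  simp [place]

@[simp] lemma place_succ (σ m : ℝ) (z : ℝ × (Fin n → ℝ)) (i : Fin n) :
    place σ m z i.succ = σ * z.2 i := by
  simp [place]

lemma measurable_place (σ m : ℝ) : Measurable (place σ m : ℝ × (Fin n → ℝ) → Fin (n + 1) → ℝ) := by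
  rw [measurable_pi_iff]
  intro k
  refine Fin.cases ?_ (fun i => ?_) k
  · simp only [place_zero]; fun_prop
  · simp only [place_succ]; fun_prop

/-- The law of the parameter in the hard instance with signs `x`. -/
noncomputable def hardLaw (η : Measure ℝ) (Q : Measure (Fin n → ℝ)) (σ m κ : ℝ)
    (x : Fin n → Bool) : Measure (Fin (n + 1) → ℝ) :=
  ((η.prod Q).withDensity fun z => ENNReal.ofReal (tilt κ x z)).map (place σ m)

variable {η : Measure ℝ} {σ m κ : ℝ}

/-- On the sphere of radius `√(n * v)`, Cauchy–Schwarz against a sign vector of norm `√n` gives at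
most `n * √v`. -/
lemma tilt_mem_Icc [SFinite Q] (hQ : IsIsotropic Q v) (hκ : |κ| * (n * √v) ≤ 1 / 2)
    (x : Fin n → Bool) :
    ∀ᵐ z ∂(η.prod Q), 1 / 2 ≤ tilt κ x z ∧ tilt κ x z ≤ 3 / 2 := by
  have h := hQ.abs_dot_le (signVec x)
  rw [sum_signVec_sq, ← mul_assoc, Real.sqrt_mul (by positivity),
    Real.sqrt_mul_self (by positivity)] at h
  have h' : ∀ᵐ z ∂(η.prod Q), |signVec x ⬝ᵥ z.2| ≤ n * √v := Measure.quasiMeasurePreserving_snd.ae h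
  filter_upwards [h'] with z hz
  have : |κ * (signVec x ⬝ᵥ z.2)| ≤ 1 / 2 := by
    rw [abs_mul]
    exact (mul_le_mul_of_nonneg_left hz (abs_nonneg _)).trans hκ
  have := abs_le.1 this
  unfold tilt
  constructor <;> linarith

lemma ae_hardLaw {w ρ C : ℝ} (hη : IsNoise η w ρ C) (hQ : IsIsotropic Q v) (x : Fin n → Bool)
    (hm : 0 ≤ m) (hσ : 0 ≤ σ) :
    ∀ᵐ y ∂(hardLaw η Q σ m κ x), |y 0| ≤ σ * (m + w + ρ) ∧
      ∑ i : Fin n, y i.succ ^ 2 = σ ^ 2 * (n * v) := by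
  unfold hardLaw
  have hms : MeasurableSet {y : Fin (n + 1) → ℝ | |y 0| ≤ σ * (m + w + ρ) ∧
      ∑ i : Fin n, y i.succ ^ 2 = σ ^ 2 * (n * v)} := by
    have h1 : Measurable fun y : Fin (n + 1) → ℝ => |y 0| := by fun_prop
    have h2 : Measurable fun y : Fin (n + 1) → ℝ => ∑ i : Fin n, y i.succ ^ 2 := by fun_prop
    exact (measurableSet_le h1 measurable_const).inter (measurableSet_eq_fun h2 measurable_const)
  rw [ae_map_iff (measurable_place σ m).aemeasurable hms]
  refine (withDensity_absolutelyContinuous _ _).ae_le ?_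
  have h1 : ∀ᵐ z ∂(η.prod Q), |z.1| ≤ w + ρ := Measure.quasiMeasurePreserving_fst.ae hη.ae_abs_le
  have h2 : ∀ᵐ z ∂(η.prod Q), ∑ i, z.2 i ^ 2 = n * v :=
    Measure.quasiMeasurePreserving_snd.ae hQ.sum_sq
  filter_upwards [h1, h2] with z hz1 hz2
  refine ⟨?_, ?_⟩
  · rw [place_zero, abs_mul, abs_of_nonneg hσ]
    refine mul_le_mul_of_nonneg_left ((abs_add_le _ _).trans ?_) hσ
    rw [abs_of_nonneg hm]
    linarith
  · simp only [place_succ, mul_pow]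
    rw [← Finset.mul_sum, hz2]

variable [IsProbabilityMeasure Q]

lemma integral_hardLaw (hQ : IsIsotropic Q v) (hκ : |κ| * (n * √v) ≤ 1 / 2) (x : Fin n → Bool)
    {f : (Fin (n + 1) → ℝ) → ℝ} (hf : Measurable f) :
    ∫ y, f y ∂(hardLaw η Q σ m κ x) = ∫ z, tilt κ x z * f (place σ m z) ∂(η.prod Q) := by
  unfold hardLaw
  rw [integral_map (measurable_place σ m).aemeasurable hf.aestronglyMeasurable,
    integral_withDensity_eq_integral_toReal_smul
      (continuous_tilt κ x).measurable.ennreal_ofReal (by simp)]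
  refine integral_congr_ae ?_
  filter_upwards [tilt_mem_Icc hQ hκ x] with z hz
  rw [ENNReal.toReal_ofReal (by linarith [hz.1]), smul_eq_mul]

variable [IsProbabilityMeasure η]

lemma integral_fst_mul_snd (f : ℝ → ℝ) (g : (Fin n → ℝ) → ℝ) :
    ∫ z, f z.1 * g z.2 ∂(η.prod Q) = (∫ t, f t ∂η) * ∫ y, g y ∂Q :=
  integral_prod_mul f g

lemma integral_tilt (hQ : IsIsotropic Q v) (x : Fin n → Bool) :
    ∫ z, tilt κ x z ∂(η.prod Q) = 1 := by
  unfold tilt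
  have hi : Integrable (fun z : ℝ × (Fin n → ℝ) => κ * (signVec x ⬝ᵥ z.2)) (η.prod Q) :=
    (hQ.integrable (f := fun y => κ * (signVec x ⬝ᵥ y))
      (continuous_const.mul (continuous_dot_right _))).comp_snd η
  have := integral_fst_mul_snd (η := η) (Q := Q) (fun _ => κ) fun y => signVec x ⬝ᵥ y
  rw [integral_add (integrable_const _) hi, this, hQ.integral_dot]
  simp

lemma isProbabilityMeasure_hardLaw (hQ : IsIsotropic Q v) (hκ : |κ| * (n * √v) ≤ 1 / 2)
    (x : Fin n → Bool) : IsProbabilityMeasure (hardLaw η Q σ m κ x) := by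
  have h : IsProbabilityMeasure
      ((η.prod Q).withDensity fun z => ENNReal.ofReal (tilt κ x z)) := by
    refine ⟨?_⟩
    have hi : Integrable (tilt κ x) (η.prod Q) :=
      Integrable.of_bound (continuous_tilt κ x).measurable.aestronglyMeasurable (3 / 2) (by
        filter_upwards [tilt_mem_Icc hQ hκ x] with z hz
        rw [Real.norm_eq_abs, abs_of_nonneg (by linarith [hz.1])]
        exact hz.2)
    rw [withDensity_apply _ MeasurableSet.univ, Measure.restrict_univ,
      ← ofReal_integral_eq_lintegral_ofReal hi (by
        filter_upwards [tilt_mem_Icc hQ hκ x] with z hz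
        simp only [Pi.zero_apply]; linarith [hz.1]), integral_tilt hQ]
    simp
  exact Measure.isProbabilityMeasure_map (measurable_place σ m).aemeasurable

lemma IsNoise.integrable {w ρ C : ℝ} (hη : IsNoise η w ρ C) {f : ℝ → ℝ} (hf : Continuous f) :
    Integrable f η := by
  obtain ⟨K, hK⟩ := (isCompact_Icc (a := -(w + ρ)) (b := w + ρ)).exists_bound_of_continuousOn
    hf.continuousOn
  refine Integrable.of_bound hf.measurable.aestronglyMeasurable K ?_
  filter_upwards [hη.ae_abs_le] with t ht using hK t (abs_le.1 ht)

/-- Under the hard law, functions of the noise coordinate are not tilted. -/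
lemma integral_hardLaw_zero (hQ : IsIsotropic Q v)
    (hκ : |κ| * (n * √v) ≤ 1 / 2) (x : Fin n → Bool) {f : ℝ → ℝ} (hf : Continuous f) :
    ∫ y, f (y 0) ∂(hardLaw η Q σ m κ x) = ∫ t, f (σ * (m + t)) ∂η := by
  rw [integral_hardLaw hQ hκ x (f := fun y => f (y 0)) (by fun_prop)]
  have e : ∀ z : ℝ × (Fin n → ℝ), tilt κ x z * f (place σ m z 0)
      = f (σ * (m + z.1)) * (1 + κ * (signVec x ⬝ᵥ z.2)) := fun z => by
    simp only [tilt, place_zero]; ring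
  simp_rw [e]
  rw [integral_fst_mul_snd (fun t => f (σ * (m + t))) fun y => 1 + κ * (signVec x ⬝ᵥ y),
    integral_add (integrable_const _) ((hQ.integrable (continuous_dot_right _)).const_mul κ),
    integral_const_mul, hQ.integral_dot]
  simp

/-- Under the hard law, functions of the other coordinates do not see the noise. -/
lemma integral_hardLaw_succ (hQ : IsIsotropic Q v) (hκ : |κ| * (n * √v) ≤ 1 / 2)
    (x : Fin n → Bool) (i : Fin n) {f : ℝ → ℝ} (hf : Continuous f) :
    ∫ y, f (y i.succ) ∂(hardLaw η Q σ m κ x)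
      = ∫ y, f (σ * y i) ∂Q + κ * ∫ y, (signVec x ⬝ᵥ y) * f (σ * y i) ∂Q := by
  rw [integral_hardLaw hQ hκ x (f := fun y => f (y i.succ)) (by fun_prop)]
  have e : ∀ z : ℝ × (Fin n → ℝ), tilt κ x z * f (place σ m z i.succ)
      = 1 * (f (σ * z.2 i) + κ * ((signVec x ⬝ᵥ z.2) * f (σ * z.2 i))) := fun z => by
    simp only [tilt, place_succ]; ring
  have hi : Integrable (fun y => (signVec x ⬝ᵥ y) * f (σ * y i)) Q :=
    hQ.integrable ((continuous_dot_right _).mul (by fun_prop))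
  simp_rw [e]
  rw [integral_fst_mul_snd (fun _ => 1) fun y =>
      f (σ * y i) + κ * ((signVec x ⬝ᵥ y) * f (σ * y i)),
    integral_add (hQ.integrable (by fun_prop)) (hi.const_mul κ),
    integral_const_mul]
  simp

lemma meanVec_hardLaw_zero {w ρ C : ℝ} (hη : IsNoise η w ρ C) (hQ : IsIsotropic Q v)
    (hκ : |κ| * (n * √v) ≤ 1 / 2) (x : Fin n → Bool) :
    meanVec (hardLaw η Q σ m κ x) 0 = σ * m := by
  have := integral_hardLaw_zero (η := η) (σ := σ) (m := m) hQ hκ x continuous_id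
  unfold meanVec
  simp only [id] at this
  rw [this, integral_const_mul, integral_add (integrable_const _) (hη.integrable continuous_id'),
    hη.mean]
  simp

lemma meanVec_hardLaw_succ (hQ : IsIsotropic Q v)
    (hκ : |κ| * (n * √v) ≤ 1 / 2) (x : Fin n → Bool) (i : Fin n) :
    meanVec (hardLaw η Q σ m κ x) i.succ = σ * (κ * v * sgn (x i)) := by
  have := integral_hardLaw_succ (η := η) (σ := σ) (m := m) hQ hκ x i continuous_id
  unfold meanVec
  simp only [id] at this
  have e : ∀ y : Fin n → ℝ, (signVec x ⬝ᵥ y) * (σ * y i) = σ * ((signVec x ⬝ᵥ y) * y i) :=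
    fun y => by ring
  simp_rw [this, e]
  rw [integral_const_mul, hQ.integral_coord, integral_const_mul, hQ.integral_dot_mul_coord]
  simp only [signVec]
  ring

lemma covMatrix_hardLaw {w ρ C : ℝ} (hη : IsNoise η w ρ C) (hQ : IsIsotropic Q v)
    (hκ : |κ| * (n * √v) ≤ 1 / 2) (x : Fin n → Bool) (hm : 0 ≤ m) (hσ : 0 ≤ σ)
    (k : Fin (n + 1)) :
    covMatrix (hardLaw η Q σ m κ x) k k
      = ∫ y, y k ^ 2 ∂(hardLaw η Q σ m κ x) - meanVec (hardLaw η Q σ m κ x) k ^ 2 := by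
  have hp := isProbabilityMeasure_hardLaw (η := η) (σ := σ) (m := m) hQ hκ x
  unfold covMatrix meanVec
  simp only [Matrix.of_apply]
  have hb : ∃ K : ℝ, ∀ᵐ y ∂(hardLaw η Q σ m κ x), |y k| ≤ K := by
    refine Fin.cases ?_ (fun i => ?_) k
    · refine ⟨σ * (m + w + ρ), ?_⟩
      filter_upwards [ae_hardLaw hη hQ x hm hσ] with y hy using hy.1
    · refine ⟨√(σ ^ 2 * (n * v)), ?_⟩
      filter_upwards [ae_hardLaw hη hQ x hm hσ] with y hy
      refine Real.abs_le_sqrt ?_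
      rw [← hy.2]
      exact Finset.single_le_sum (f := fun i : Fin n => y i.succ ^ 2) (fun j _ => sq_nonneg _)
        (Finset.mem_univ i)
  obtain ⟨K, hK⟩ := hb
  have hL : MemLp (fun y : Fin (n + 1) → ℝ => y k) 2 (hardLaw η Q σ m κ x) :=
    MemLp.of_bound (measurable_pi_apply k).aestronglyMeasurable K hK
  rw [covariance_self (measurable_pi_apply k).aemeasurable, variance_eq_sub hL]
  simp

lemma covMatrix_hardLaw_zero {w ρ C : ℝ} (hη : IsNoise η w ρ C) (hQ : IsIsotropic Q v)
    (hκ : |κ| * (n * √v) ≤ 1 / 2) (x : Fin n → Bool) (hm : 0 ≤ m) (hσ : 0 ≤ σ) :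
    covMatrix (hardLaw η Q σ m κ x) 0 0 = σ ^ 2 * w ^ 2 := by
  rw [covMatrix_hardLaw hη hQ hκ x hm hσ, meanVec_hardLaw_zero hη hQ hκ,
    integral_hardLaw_zero hQ hκ x (continuous_pow 2)]
  have e : ∀ t : ℝ, (σ * (m + t)) ^ 2
      = (σ * m) ^ 2 + (2 * σ ^ 2 * m) * t + σ ^ 2 * t ^ 2 := fun t => by ring
  simp_rw [e]
  rw [integral_add_add (integrable_const _) ((hη.integrable continuous_id').const_mul _)
    ((hη.integrable (continuous_pow 2)).const_mul _), integral_const_mul (2 * σ ^ 2 * m),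
    integral_const_mul (σ ^ 2), hη.mean, hη.sq]
  simp only [integral_const, probReal_univ, smul_eq_mul]
  ring

/-- The tilt is odd and the square is even, so second moments are those of `Q` and the tilt lowers
the variance only through the mean. -/
lemma covMatrix_hardLaw_succ {w ρ C : ℝ} (hη : IsNoise η w ρ C) (hQ : IsIsotropic Q v)
    (hκ : |κ| * (n * √v) ≤ 1 / 2) (x : Fin n → Bool) (hm : 0 ≤ m) (hσ : 0 ≤ σ) (i : Fin n) :
    covMatrix (hardLaw η Q σ m κ x) i.succ i.succ = σ ^ 2 * (v - (κ * v) ^ 2) := by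
  rw [covMatrix_hardLaw hη hQ hκ x hm hσ, meanVec_hardLaw_succ hQ hκ,
    integral_hardLaw_succ hQ hκ x i (continuous_pow 2)]
  have e : ∀ y : Fin n → ℝ, (signVec x ⬝ᵥ y) * (σ * y i) ^ 2
      = σ ^ 2 * ((signVec x ⬝ᵥ y) * y i ^ 2) := fun y => by ring
  simp_rw [e, mul_pow]
  rw [integral_const_mul, integral_const_mul, hQ.integral_coord_sq,
    hQ.integral_dot_mul_coord_sq]
  have h1 : sgn (x i) ^ 2 = 1 := by rw [sq, sgn_mul_self]
  rw [h1]
  ring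

/-- A bound for the information on sign `i` that the reward of action `a` carries under the hard
law. -/
noncomputable def hardInfo (C v κ : ℝ) (i : Fin n) (a : Fin (n + 1) → ℝ) : ℝ :=
  8 * κ ^ 2 * if 1 / 2 ≤ a 0 then 6 * C * v ^ 2 * a i.succ ^ 2
    else v * (a i.succ ^ 2 / ∑ j : Fin n, a j.succ ^ 2)

lemma measurable_hardInfo (C v κ : ℝ) (i : Fin n) : Measurable (hardInfo C v κ i) := by
  refine Measurable.const_mul (Measurable.ite ?_ ?_ ?_) _
  · exact measurableSet_le measurable_const (measurable_pi_apply 0)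
  · fun_prop
  · fun_prop

lemma integral_hardLaw_le_log {w ρ C : ℝ} (hC : 0 ≤ C) (hv : 0 ≤ v) (hη : IsNoise η w ρ C)
    (hQ : IsIsotropic Q v) (hκ : |κ| * (n * √v) ≤ 1 / 2) (x : Fin n → Bool) (i : Fin n)
    (a : Fin (n + 1) → ℝ) {G : ℝ → ℝ} (hG : Measurable G) (hG0 : ∀ y, 0 ≤ G y)
    (hG1 : ∀ y, G y ≤ 1) :
    ∫ y, G (a ⬝ᵥ y) ∂(hardLaw η Q σ m κ x)
      ≤ Real.log (∫ y, Real.exp (G (a ⬝ᵥ y)) ∂(hardLaw η Q σ m κ (flip x i)))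
        + hardInfo C v κ i a := by
  have hGa : Measurable fun y : Fin (n + 1) → ℝ => G (a ⬝ᵥ y) := hG.comp (measurable_dot_right a)
  rw [integral_hardLaw hQ hκ x hGa,
    integral_hardLaw hQ hκ (flip x i) (f := fun y => Real.exp (G (a ⬝ᵥ y)))
      (Real.measurable_exp.comp hGa)]
  have e : ∀ z : ℝ × (Fin n → ℝ), a ⬝ᵥ place σ m z = σ * pairReward m a z := fun z =>
    dot_smul_cons σ m a z
  simp only [e]
  let J : ℝ := if 1 / 2 ≤ a 0 then 6 * C * v ^ 2 * a i.succ ^ 2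
    else v * (a i.succ ^ 2 / ∑ j : Fin n, a j.succ ^ 2)
  have hJ : 0 ≤ J := by
    simp only [J]
    have : 0 ≤ ∑ j : Fin n, a j.succ ^ 2 := Finset.sum_nonneg fun j _ => sq_nonneg _
    split_ifs <;> positivity
  have hinfo : ∀ φ : ℝ → ℝ, Measurable φ → (∀ y, |φ y| ≤ 1) →
      (∫ z, z.2 i * φ (σ * pairReward m a z) ∂(η.prod Q)) ^ 2
        ≤ J * ∫ z, φ (σ * pairReward m a z) ^ 2 ∂(η.prod Q) := fun φ hφ h1 => by
    have hφσ : Measurable fun y => φ (σ * y) := by fun_prop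
    simp only [J]
    split_ifs with ha
    · exact sq_integral_coord_mul_le_of_noise hC hη hQ a ha i hφσ fun y => h1 _
    · exact sq_integral_coord_mul_le hQ a i hφσ fun y => h1 _
  -- Flipping sign `i` changes the density by `2 * κ * sgn (x i)` times coordinate `i`. The cost `2
  -- * c ^ 2 * J` is therefore `8 * κ ^ 2 * J`, which is `hardInfo`.
  have h := integral_tilt_le_log (P := η.prod Q) (X := fun z => σ * pairReward m a z)
    (h := tilt κ x) (h' := tilt κ (flip x i)) (ϑ := fun z => z.2 i)
    (c := 2 * κ * sgn (x i)) (M := √(n * v)) ((measurable_pairReward m a).const_mul σ)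
    (continuous_tilt κ _).measurable (by fun_prop) (integral_tilt hQ _) (integral_tilt hQ _)
    ((tilt_mem_Icc hQ hκ (flip x i)).mono fun z hz => hz.1)
    ((tilt_mem_Icc hQ hκ (flip x i)).mono fun z hz => hz.2) hJ
    (Measure.quasiMeasurePreserving_snd.ae (hQ.abs_coord_le i))
    (fun z => by
      unfold tilt
      rw [signVec_dot_sub_flip x i]; ring)
    hinfo hG hG0 hG1
  refine h.trans (le_of_eq ?_)
  congr 1
  unfold hardInfo
  rw [mul_pow, mul_pow, sq (sgn (x i)), sgn_mul_self]
  ring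

end HardLaw

/-! ### Geometry of the unit ball: optimal actions and the cost of deviating from them. -/

section Geometry

variable {d n : ℕ} {p : ℝ≥0∞} {q : ℝ}

lemma rpow_le_one_iff_of_pos_right {x r : ℝ} (hx : 0 ≤ x) (hr : 0 < r) : x ^ r ≤ 1 ↔ x ≤ 1 := by
  simpa using Real.rpow_le_rpow_iff hx zero_le_one hr

lemma mem_lpBall_top {a : Fin d → ℝ} : a ∈ lpBall d ⊤ ↔ ∀ i, |a i| ≤ 1 := by
  simp only [lpBall, Set.mem_ofPred_eq, PiLp.norm_toLp]
  rw [pi_norm_le_iff_of_nonneg zero_le_one]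
  rfl

lemma mem_lpBall_ofReal {P : ℝ} (hP : 0 < P) {a : Fin d → ℝ} :
    a ∈ lpBall d (ENNReal.ofReal P) ↔ ∑ i, |a i| ^ P ≤ 1 := by
  have hP' : (ENNReal.ofReal P).toReal = P := ENNReal.toReal_ofReal hP.le
  have h0 : 0 ≤ ∑ i, |a i| ^ P := Finset.sum_nonneg fun i _ => Real.rpow_nonneg (abs_nonneg _) _
  simp only [lpBall, Set.mem_ofPred_eq]
  rw [PiLp.norm_eq_sum (by rwa [hP']), hP']
  simp only [Real.norm_eq_abs]
  rw [rpow_le_one_iff_of_pos_right h0 (by positivity)]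

/-- A pair of conjugate exponents `p ∈ (2, ∞]` and `q ∈ [1, 2)`. -/
structure DualExponents (p : ℝ≥0∞) (q : ℝ) : Prop where
  two_lt : 2 < p
  conj : ENNReal.HolderConjugate p (ENNReal.ofReal q)

lemma DualExponents.cases (h : DualExponents p q) :
    (p = ⊤ ∧ q = 1) ∨ ∃ P : ℝ, p = ENNReal.ofReal P ∧ 2 < P ∧ P.HolderConjugate q := by
  have hc := h.conj
  have hq1 : 1 ≤ ENNReal.ofReal q := ENNReal.HolderConjugate.one_le (ENNReal.ofReal q) p
  have hq0 : 1 ≤ q := by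
    rw [← ENNReal.ofReal_one, ENNReal.ofReal_le_ofReal_iff'] at hq1
    rcases hq1 with h | h
    · exact h
    · norm_num at h
  by_cases hp : p = ⊤
  · left
    refine ⟨hp, ?_⟩
    have := (ENNReal.HolderConjugate.eq_top_iff_eq_one p (ENNReal.ofReal q)).1 hp
    rwa [ENNReal.ofReal_eq_one] at this
  · right
    refine ⟨p.toReal, (ENNReal.ofReal_toReal hp).symm, ?_, ?_⟩
    · have := (ENNReal.toReal_lt_toReal (by norm_num) hp).2 h.two_lt
      simpa using this
    · have := ENNReal.HolderConjugate.toReal_of_ne_top (p := p) (q := ENNReal.ofReal q) hp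
        ENNReal.ofReal_ne_top
      rwa [ENNReal.toReal_ofReal (by linarith)] at this

lemma DualExponents.one_le (h : DualExponents p q) : 1 ≤ q := by
  rcases h.cases with ⟨_, rfl⟩ | ⟨P, _, _, hc⟩
  · exact le_rfl
  · exact hc.symm.lt.le

lemma DualExponents.lt_two (h : DualExponents p q) : q < 2 := by
  rcases h.cases with ⟨_, rfl⟩ | ⟨P, _, hP, hc⟩
  · norm_num
  · have h1 := hc.inv_add_inv_eq_one
    have h2 : P⁻¹ < 2⁻¹ := inv_strictAnti₀ two_pos hP
    have h3 : 2⁻¹ < q⁻¹ := by linarith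
    exact (inv_lt_inv₀ two_pos (by linarith [hc.symm.lt])).1 h3

lemma DualExponents.abs_le_one (h : DualExponents p q) {a : Fin d → ℝ} (ha : a ∈ lpBall d p)
    (i : Fin d) : |a i| ≤ 1 := by
  rcases h.cases with ⟨rfl, _⟩ | ⟨P, rfl, hP, hc⟩
  · exact mem_lpBall_top.1 ha i
  · rw [mem_lpBall_ofReal (by linarith)] at ha
    have h1 := Finset.single_le_sum (f := fun i => |a i| ^ P)
      (fun j _ => Real.rpow_nonneg (abs_nonneg _) _) (Finset.mem_univ i)
    exact (rpow_le_one_iff_of_pos_right (abs_nonneg _) (by linarith)).1 (h1.trans ha)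

/-- Hölder's inequality on the unit ball. -/
lemma DualExponents.dot_le (h : DualExponents p q) {a : Fin d → ℝ} (ha : a ∈ lpBall d p)
    (y : Fin d → ℝ) : a ⬝ᵥ y ≤ (∑ i, |y i| ^ q) ^ (1 / q) := by
  rcases h.cases with ⟨rfl, rfl⟩ | ⟨P, rfl, hP, hc⟩
  · rw [mem_lpBall_top] at ha
    simp only [Real.rpow_one, div_one]
    refine Finset.sum_le_sum fun i _ => (le_abs_self _).trans ?_
    rw [abs_mul]
    exact mul_le_of_le_one_left (abs_nonneg _) (ha i)
  · rw [mem_lpBall_ofReal (by linarith)] at ha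
    refine (Real.inner_le_Lp_mul_Lq Finset.univ a y hc).trans ?_
    refine mul_le_of_le_one_left (Real.rpow_nonneg (Finset.sum_nonneg fun i _ =>
      Real.rpow_nonneg (abs_nonneg _) _) _) ?_
    exact Real.rpow_le_one (Finset.sum_nonneg fun i _ => Real.rpow_nonneg (abs_nonneg _) _) ha
      (by positivity)

lemma neg_mem_lpBall {a : Fin d → ℝ} (h : DualExponents p q) (ha : a ∈ lpBall d p) :
    -a ∈ lpBall d p := by
  rcases h.cases with ⟨rfl, _⟩ | ⟨P, rfl, hP, hc⟩
  · simpa [mem_lpBall_top] using ha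
  · rw [mem_lpBall_ofReal (by linarith)] at ha ⊢
    simpa using ha

lemma DualExponents.abs_dot_le (h : DualExponents p q) {a : Fin d → ℝ} (ha : a ∈ lpBall d p)
    (y : Fin d → ℝ) : |a ⬝ᵥ y| ≤ (∑ i, |y i| ^ q) ^ (1 / q) := by
  refine abs_le'.2 ⟨h.dot_le ha y, ?_⟩
  rw [← neg_dotProduct]
  exact h.dot_le (neg_mem_lpBall h ha) y

lemma one_add_mul_sub_one_le_rpow {y r : ℝ} (hy : 0 ≤ y) (hr : 1 ≤ r) :
    1 + r * (y - 1) ≤ y ^ r := by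
  have := one_add_mul_self_le_rpow_one_add (s := y - 1) (by linarith) hr
  simpa using this

/-- The mean vector of the hard instance, up to scaling. -/
noncomputable def hardMean (q z₀ : ℝ) (x : Fin n → Bool) : Fin (n + 1) → ℝ :=
  Fin.cons 1 fun i => z₀ ^ (1 / q) * sgn (x i)

/-- The best action against `hardMean`. -/
noncomputable def bestAction (q z₀ : ℝ) (x : Fin n → Bool) : Fin (n + 1) → ℝ :=
  (1 + n * z₀) ^ (1 / q - 1) • Fin.cons 1 fun i => z₀ ^ (1 - 1 / q) * sgn (x i)

lemma dot_hardMean (q z₀ : ℝ) (x : Fin n → Bool) (a : Fin (n + 1) → ℝ) :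
    a ⬝ᵥ hardMean q z₀ x = a 0 + z₀ ^ (1 / q) * ∑ i, sgn (x i) * a i.succ := by
  simp only [hardMean, dotProduct, Fin.sum_univ_succ, Fin.cons_zero, Fin.cons_succ, mul_one,
    Finset.mul_sum]
  congr 1
  exact Finset.sum_congr rfl fun i _ => by ring

variable {z₀ : ℝ}

/-- The action is the equality case of Hölder's inequality, so for finite `p` its norm is exactly
`1`. -/
lemma bestAction_mem (h : DualExponents p q) (hz : 0 < z₀) (x : Fin n → Bool) :
    bestAction q z₀ x ∈ lpBall (n + 1) p := by
  have hZ : 0 < 1 + n * z₀ := by positivity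
  rcases h.cases with ⟨rfl, rfl⟩ | ⟨P, rfl, hP, hc⟩
  · rw [mem_lpBall_top]
    intro i
    refine Fin.cases ?_ (fun i => ?_) i <;> simp [bestAction]
  · rw [mem_lpBall_ofReal (by linarith), Fin.sum_univ_succ]
    have h1 := hc.inv_add_inv_eq_one
    have hP0 : P ≠ 0 := by linarith
    have e1 : (1 / q - 1) * P = -1 := by
      have : 1 / q - 1 = -P⁻¹ := by rw [one_div]; linarith
      rw [this]; field_simp
    have e2 : (1 - 1 / q) * P = 1 := by linarith
    have e3 : ∀ i : Fin n, |bestAction q z₀ x i.succ| ^ P = (1 + n * z₀)⁻¹ * z₀ := fun i => by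
      simp only [bestAction, Pi.smul_apply, Fin.cons_succ, smul_eq_mul, abs_mul, abs_sgn, mul_one]
      rw [abs_of_nonneg (by positivity), abs_of_nonneg (by positivity),
        Real.mul_rpow (by positivity) (by positivity), ← Real.rpow_mul hZ.le,
        ← Real.rpow_mul hz.le, e1, e2, Real.rpow_neg_one, Real.rpow_one]
    have e4 : |bestAction q z₀ x 0| ^ P = (1 + n * z₀)⁻¹ := by
      simp only [bestAction, Pi.smul_apply, Fin.cons_zero, smul_eq_mul, mul_one]
      rw [abs_of_nonneg (by positivity), ← Real.rpow_mul hZ.le, e1, Real.rpow_neg_one]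
    simp only [e3, e4, Finset.sum_const, Finset.card_univ, Fintype.card_fin, nsmul_eq_mul]
    refine le_of_eq ?_
    field_simp

lemma bestAction_dot (hz : 0 < z₀) (x : Fin n → Bool) :
    bestAction q z₀ x ⬝ᵥ hardMean q z₀ x = (1 + n * z₀) ^ (1 / q) := by
  have hZ : 0 < 1 + n * z₀ := by positivity
  rw [dot_hardMean]
  have e : ∀ i, sgn (x i) * bestAction q z₀ x i.succ
      = (1 + n * z₀) ^ (1 / q - 1) * z₀ ^ (1 - 1 / q) := fun i => by
    simp only [bestAction, Pi.smul_apply, Fin.cons_succ, smul_eq_mul]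
    linear_combination (1 + n * z₀) ^ (1 / q - 1) * z₀ ^ (1 - 1 / q) * sgn_mul_self (x i)
  simp only [e, Finset.sum_const, Finset.card_univ, Fintype.card_fin, nsmul_eq_mul]
  have e0 : bestAction q z₀ x 0 = (1 + n * z₀) ^ (1 / q - 1) := by simp [bestAction]
  have e1 : z₀ ^ (1 / q) * z₀ ^ (1 - 1 / q) = z₀ := by
    rw [← Real.rpow_add hz, add_sub_cancel, Real.rpow_one]
  have e2 : (1 + n * z₀) ^ (1 / q - 1) * (1 + n * z₀) = (1 + n * z₀) ^ (1 / q) := by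
    rw [← Real.rpow_add_one hZ.ne', sub_add_cancel]
  rw [e0, ← e2]
  linear_combination (n * (1 + n * z₀) ^ (1 / q - 1)) * e1

lemma dot_hardMean_le (h : DualExponents p q) (hz : 0 < z₀) (x : Fin n → Bool)
    {a : Fin (n + 1) → ℝ} (ha : a ∈ lpBall (n + 1) p) :
    a ⬝ᵥ hardMean q z₀ x ≤ (1 + n * z₀) ^ (1 / q) := by
  refine (h.dot_le ha _).trans (le_of_eq ?_)
  have hq : q ≠ 0 := by linarith [h.one_le]
  rw [Fin.sum_univ_succ]
  simp only [hardMean, Fin.cons_zero, Fin.cons_succ, abs_mul, abs_sgn, abs_one, Real.one_rpow,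
    mul_one, abs_of_nonneg (Real.rpow_nonneg hz.le _)]
  simp only [← Real.rpow_mul hz.le, one_div_mul_cancel hq, Real.rpow_one]
  simp

/-- A lower bound for the optimal value with the same first-order term as in `dot_hardMean_le_sub`,
so that only a second-order error survives in the regret. -/
lemma one_add_div_sub_le_rpow {z : ℝ} (hq : 1 ≤ q) (hz : 0 ≤ z) :
    1 + z / q - z ^ 2 ≤ (1 + z) ^ (1 / q) := by
  have h1 : 0 < 1 + z := by linarith
  have h2 := Real.one_sub_inv_le_log_of_pos h1
  have h3 : z - z ^ 2 ≤ 1 - (1 + z)⁻¹ := by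
    have : 1 - (1 + z)⁻¹ = z / (1 + z) := by field_simp; ring
    rw [this, le_div_iff₀ h1]
    nlinarith [pow_nonneg hz 3]
  rw [Real.rpow_def_of_pos h1]
  have h4 := Real.add_one_le_exp (Real.log (1 + z) * (1 / q))
  have h5 : 1 / q ≤ 1 := by rw [div_le_one (by linarith)]; exact hq
  have h6 : 0 < 1 / q := by positivity
  have h7 : (z - z ^ 2) * (1 / q) ≤ Real.log (1 + z) * (1 / q) :=
    mul_le_mul_of_nonneg_right (h3.trans h2) h6.le
  have h8 : z / q = z * (1 / q) := by ring
  nlinarith [sq_nonneg z]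

/-- The loss of an action is at least quadratic in its distance from the optimal proportions. -/
lemma dot_hardMean_le_sub (h : DualExponents p q) (hz : 0 < z₀) (x : Fin n → Bool)
    {a : Fin (n + 1) → ℝ} (ha : a ∈ lpBall (n + 1) p) :
    a ⬝ᵥ hardMean q z₀ x ≤ 1 + n * z₀ / q
      - z₀ / 2 * ∑ i : Fin n, (sgn (x i) * a i.succ / z₀ ^ (1 - 1 / q) - 1) ^ 2 := by
  rw [dot_hardMean]
  set y₀ := z₀ ^ (1 - 1 / q) with hy
  have hy0 : 0 < y₀ := Real.rpow_pos_of_pos hz _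
  have e1 : z₀ ^ (1 / q) * y₀ = z₀ := by
    rw [hy, ← Real.rpow_add hz, add_sub_cancel, Real.rpow_one]
  let l : Fin n → ℝ := fun i => sgn (x i) * a i.succ / y₀
  have hl : ∀ i, sgn (x i) * a i.succ = y₀ * l i := fun i => by
    simp only [l]; field_simp
  suffices hs : a 0 + ∑ i, z₀ * l i ≤ 1 + ∑ i, (z₀ / q - z₀ / 2 * (l i - 1) ^ 2) by
    simp only [Finset.sum_sub_distrib, ← Finset.mul_sum, Finset.sum_const, Finset.card_univ,
      Fintype.card_fin, nsmul_eq_mul] at hs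
    simp only [hl, ← Finset.mul_sum]
    rw [← mul_assoc, e1]
    simp only [l] at hs ⊢
    have e2 : (n : ℝ) * (z₀ / q) = n * z₀ / q := by ring
    have e3 : ∀ i, y₀ * (sgn (x i) * a i.succ / y₀) / y₀ = sgn (x i) * a i.succ / y₀ :=
      fun i => by field_simp
    simp only [e3]
    linarith
  rcases h.cases with ⟨rfl, rfl⟩ | ⟨P, rfl, hP, hc⟩
  · rw [mem_lpBall_top] at ha
    have hy1 : y₀ = 1 := by simp [hy]
    refine add_le_add ((le_abs_self _).trans (ha 0)) (Finset.sum_le_sum fun i _ => ?_)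
    have h1 : |l i| ≤ 1 := by
      simp only [l, hy1, div_one, abs_mul, abs_sgn, one_mul]
      exact ha _
    have h2 := abs_le.1 h1
    have h3 : (l i - 1) ^ 2 / 2 ≤ 1 - l i := by nlinarith
    rw [div_one]
    nlinarith [mul_le_mul_of_nonneg_left h3 hz.le]
  · rw [mem_lpBall_ofReal (by linarith), Fin.sum_univ_succ] at ha
    have hP0 : 0 < P := by linarith
    have h1 := hc.inv_add_inv_eq_one
    have e2 : (1 - 1 / q) * P = 1 := by
      have : 1 - 1 / q = P⁻¹ := by rw [one_div]; linarith
      rw [this]; field_simp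
    have hy0P : y₀ ^ P = z₀ := by rw [hy, ← Real.rpow_mul hz.le, e2, Real.rpow_one]
    -- The norm constraint is linearized: Bernoulli's inequality is used at `|a 0|` with exponent
    -- `P`, and below at `|l i| ^ 2` with exponent `P / 2`. The latter needs `P ≥ 2` and yields the
    -- quadratic loss.
    have h0 := one_add_mul_sub_one_le_rpow (abs_nonneg (a 0)) (by linarith : (1 : ℝ) ≤ P)
    have hi : ∀ i : Fin n, P * (z₀ * l i) ≤ P * (z₀ / q - z₀ / 2 * (l i - 1) ^ 2)
        + |a i.succ| ^ P := fun i => by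
      have h2 : |a i.succ| = y₀ * |l i| := by
        have : |sgn (x i) * a i.succ| = |y₀ * l i| := by rw [hl]
        rwa [abs_mul, abs_mul, abs_sgn, one_mul, abs_of_pos hy0] at this
      rw [h2, Real.mul_rpow hy0.le (abs_nonneg _), hy0P]
      have h3 := one_add_mul_sub_one_le_rpow (sq_nonneg (|l i|)) (by linarith : 1 ≤ P / 2)
      have h4 : (|l i| ^ 2) ^ (P / 2) = |l i| ^ P := by
        rw [← Real.rpow_natCast, ← Real.rpow_mul (abs_nonneg _)]
        congr 1
        push_cast
        ring
      rw [h4, sq_abs] at h3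
      have h5 : P / q = P - 1 := by
        have : P * (P⁻¹ + q⁻¹) = P := by rw [h1, mul_one]
        rw [mul_add, mul_inv_cancel₀ hP0.ne'] at this
        rw [div_eq_mul_inv]; linarith
      have h6 := mul_le_mul_of_nonneg_left h3 hz.le
      have h7 : P * (z₀ / q) = z₀ * (P - 1) := by rw [← h5]; ring
      rw [mul_sub, h7]
      nlinarith
    have hsum := Finset.sum_le_sum fun i (_ : i ∈ Finset.univ) => hi i
    rw [Finset.sum_add_distrib, ← Finset.mul_sum, ← Finset.mul_sum Finset.univ (fun i =>
      z₀ / q - z₀ / 2 * (l i - 1) ^ 2)] at hsum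
    have h8 : P * (a 0 + ∑ i, z₀ * l i) ≤ P * (1 + ∑ i, (z₀ / q - z₀ / 2 * (l i - 1) ^ 2)) := by
      have := mul_le_mul_of_nonneg_left (le_abs_self (a 0)) hP0.le
      rw [mul_add, mul_add]
      linarith
    exact le_of_mul_le_mul_left h8 hP0

/-- By Hölder the small coordinates add at most `(n * z₀) ^ (1 / q)`, which is below `(1/64) ^ (1/2)
= 1/8` since `q < 2`. The optimum is at least `1`, so the loss is at least `3/8`. -/
lemma dot_hardMean_le_of_lt_half (h : DualExponents p q) (hz : 0 < z₀) (hz1 : n * z₀ ≤ 1 / 64)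
    (x : Fin n → Bool) {a : Fin (n + 1) → ℝ} (ha : a ∈ lpBall (n + 1) p) (ha0 : a 0 < 1 / 2) :
    a ⬝ᵥ hardMean q z₀ x ≤ 5 / 8 := by
  have hq := h.one_le
  have hq2 := h.lt_two
  have h1 := h.dot_le ha (Fin.cons 0 fun i => z₀ ^ (1 / q) * sgn (x i))
  have h2 : a ⬝ᵥ (Fin.cons 0 fun i => z₀ ^ (1 / q) * sgn (x i) : Fin (n + 1) → ℝ)
      = a ⬝ᵥ hardMean q z₀ x - a 0 := by
    simp only [hardMean, dotProduct, Fin.sum_univ_succ, Fin.cons_zero, Fin.cons_succ]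
    ring
  rw [h2, Fin.sum_univ_succ] at h1
  simp only [Fin.cons_zero, Fin.cons_succ, abs_mul, abs_sgn, abs_zero, mul_one,
    Real.zero_rpow (by linarith : q ≠ 0), abs_of_nonneg (Real.rpow_nonneg hz.le _), zero_add] at h1
  simp only [← Real.rpow_mul hz.le, one_div_mul_cancel (by linarith : q ≠ 0), Real.rpow_one,
    Finset.sum_const, Finset.card_univ, Fintype.card_fin, nsmul_eq_mul] at h1
  have h0 : 0 ≤ n * z₀ := by positivity
  have h3 : (n * z₀) ^ (1 / q) ≤ (1 / 64 : ℝ) ^ (1 / q) :=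
    Real.rpow_le_rpow h0 hz1 (by positivity)
  have h4 : (1 / 64 : ℝ) ^ (1 / q) ≤ (1 / 64 : ℝ) ^ (1 / 2 : ℝ) := by
    refine Real.rpow_le_rpow_of_exponent_ge (by norm_num) (by norm_num) ?_
    exact one_div_le_one_div_of_le (by linarith) hq2.le
  have h5 : (1 / 64 : ℝ) ^ (1 / 2 : ℝ) = 1 / 8 := by
    rw [← Real.sqrt_eq_rpow, show (1 / 64 : ℝ) = (1 / 8) ^ 2 by norm_num,
      Real.sqrt_sq (by norm_num)]
  linarith

/-- Comparison of the `ℓ_q` and the `ℓ_2` norm. -/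
lemma sum_abs_rpow_le (hq : 1 ≤ q) (hq2 : q < 2) (hn : 0 < n) {v : ℝ} (hv : 0 ≤ v)
    {y : Fin n → ℝ} (hy : ∑ i, y i ^ 2 = n * v) : ∑ i, |y i| ^ q ≤ n * √v ^ q := by
  have hn' : (0 : ℝ) < n := by exact_mod_cast hn
  -- Power mean inequality with uniform weights and exponent `2 / q ≥ 1`.
  have h := Real.arith_mean_le_rpow_mean Finset.univ (fun _ : Fin n => (n : ℝ)⁻¹)
    (fun i => |y i| ^ q) (fun _ _ => by positivity) (by simp [hn'.ne'])
    (fun i _ => Real.rpow_nonneg (abs_nonneg _) _) (p := 2 / q)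
    ((one_le_div (by linarith)).2 hq2.le)
  have e : ∀ i, (|y i| ^ q) ^ (2 / q) = y i ^ 2 := fun i => by
    rw [← Real.rpow_mul (abs_nonneg _), mul_div_cancel₀ _ (by linarith), ← sq_abs,
      ← Real.rpow_natCast]
    norm_num
  simp only [e, ← Finset.mul_sum, hy] at h
  have e2 : (1 : ℝ) / (2 / q) = 1 / 2 * q := by field_simp
  rw [inv_mul_cancel_left₀ hn'.ne', e2, Real.rpow_mul hv, ← Real.sqrt_eq_rpow] at h
  rwa [inv_mul_le_iff₀ hn'] at h

end Geometry

/-! ### Dimension one: a biased coin. -/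

section Coin

/-- The law on `ℝ` that charges `r` and `-r` and has mean `r * δ`. -/
noncomputable def coinLaw (r δ : ℝ) : Measure (Fin 1 → ℝ) :=
  ENNReal.ofReal ((1 + δ) / 2) • Measure.dirac (fun _ => r)
    + ENNReal.ofReal ((1 - δ) / 2) • Measure.dirac (fun _ => -r)

variable {r δ : ℝ}

lemma isProbabilityMeasure_coinLaw (hδ : |δ| ≤ 1) : IsProbabilityMeasure (coinLaw r δ) := by
  have h := abs_le.1 hδ
  refine ⟨?_⟩
  simp only [coinLaw, Measure.coe_add, Measure.coe_smul, Pi.add_apply, Pi.smul_apply,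
    measure_univ, smul_eq_mul, mul_one]
  rw [← ENNReal.ofReal_add (by linarith) (by linarith), ← ENNReal.ofReal_one]
  congr 1
  ring

lemma integral_coinLaw (hδ : |δ| ≤ 1) (f : (Fin 1 → ℝ) → ℝ) :
    ∫ y, f y ∂(coinLaw r δ)
      = (1 + δ) / 2 * f (fun _ => r) + (1 - δ) / 2 * f (fun _ => -r) := by
  have h := abs_le.1 hδ
  have hi : ∀ y, Integrable f (Measure.dirac y) := fun y => integrable_dirac (by simp)
  unfold coinLaw
  rw [integral_add_measure ((hi _).smul_measure ENNReal.ofReal_ne_top)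
      ((hi _).smul_measure ENNReal.ofReal_ne_top), integral_smul_measure, integral_smul_measure,
    integral_dirac, integral_dirac, ENNReal.toReal_ofReal (by linarith),
    ENNReal.toReal_ofReal (by linarith), smul_eq_mul, smul_eq_mul]

lemma ae_coinLaw (hr : 0 ≤ r) : ∀ᵐ y ∂(coinLaw r δ), |y 0| = r := by
  unfold coinLaw
  rw [ae_add_measure_iff]
  constructor <;> refine Measure.ae_smul_measure ?_ _ <;> rw [ae_dirac_eq] <;>
    simp [abs_of_nonneg hr]

lemma meanVec_coinLaw (hδ : |δ| ≤ 1) : meanVec (coinLaw r δ) = fun _ => r * δ := by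
  funext i
  unfold meanVec
  rw [integral_coinLaw hδ fun y => y i]
  ring

lemma covMatrix_coinLaw (hδ : |δ| ≤ 1) (i : Fin 1) :
    covMatrix (coinLaw r δ) i i = r ^ 2 * (1 - δ ^ 2) := by
  unfold covMatrix
  simp only [Matrix.of_apply]
  rw [covariance, integral_coinLaw hδ fun y => y i, integral_coinLaw hδ]
  ring

/-- Both coins are tilts of a fair coin on `± 1` by `1 ± δ y`. The densities differ by `2 * δ * y`,
and `2 * (2 * δ) ^ 2 = 8 * δ ^ 2`. -/
lemma integral_coinLaw_le_log (hδ : |δ| ≤ 1 / 2) (a : Fin 1 → ℝ)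
    {G : ℝ → ℝ} (hG : Measurable G) (hG0 : ∀ y, 0 ≤ G y) (hG1 : ∀ y, G y ≤ 1) :
    ∫ y, G (a ⬝ᵥ y) ∂(coinLaw r δ)
      ≤ Real.log (∫ y, Real.exp (G (a ⬝ᵥ y)) ∂(coinLaw r (-δ))) + 8 * δ ^ 2 := by
  have h0 : |(0 : ℝ)| ≤ 1 := by simp
  have hp : IsProbabilityMeasure (coinLaw 1 0) := isProbabilityMeasure_coinLaw h0
  have hae : ∀ᵐ y ∂(coinLaw 1 0), |y 0| = 1 := ae_coinLaw zero_le_one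
  have hb : ∀ᵐ y ∂(coinLaw 1 0), 1 / 2 ≤ 1 - δ * y 0 ∧ 1 - δ * y 0 ≤ 3 / 2 := by
    filter_upwards [hae] with y hy
    have : |δ * y 0| ≤ 1 / 2 := by rwa [abs_mul, hy, mul_one]
    have := abs_le.1 this
    constructor <;> linarith
  have hinfo : ∀ φ : ℝ → ℝ, Measurable φ → (∀ y, |φ y| ≤ 1) →
      (∫ y, y 0 * φ (r * (a ⬝ᵥ y)) ∂(coinLaw 1 0)) ^ 2
        ≤ 1 * ∫ y, φ (r * (a ⬝ᵥ y)) ^ 2 ∂(coinLaw 1 0) := fun φ _ _ => by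
    rw [integral_coinLaw h0 fun y => y 0 * φ (r * (a ⬝ᵥ y)),
      integral_coinLaw h0 fun y => φ (r * (a ⬝ᵥ y)) ^ 2]
    nlinarith [sq_nonneg (φ (r * (a ⬝ᵥ fun _ => 1)) + φ (r * (a ⬝ᵥ fun _ => -1)))]
  have h := integral_tilt_le_log (P := coinLaw 1 0) (X := fun y => r * (a ⬝ᵥ y))
    (h := fun y => 1 + δ * y 0) (h' := fun y => 1 - δ * y 0) (ϑ := fun y => y 0)
    (c := 2 * δ) (M := 1) (by unfold dotProduct; fun_prop) (by fun_prop) (by fun_prop)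
    (by rw [integral_coinLaw h0]; ring) (by rw [integral_coinLaw h0]; ring)
    (hb.mono fun y hy => hy.1) (hb.mono fun y hy => hy.2) zero_le_one
    (hae.mono fun y hy => hy.le) (fun y => by ring) hinfo hG hG0 hG1
  have e : ∀ t : ℝ, r * (a ⬝ᵥ fun _ => t) = a ⬝ᵥ fun _ => r * t := fun t => by
    simp [dotProduct]; ring
  rw [integral_coinLaw h0, integral_coinLaw h0 fun y => (1 - δ * y 0) * _] at h
  rw [integral_coinLaw (by linarith), integral_coinLaw (by rw [abs_neg]; linarith)]
  simp only [e, mul_one, mul_neg] at h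
  convert h using 1
  · ring
  · congr 1
    · congr 1; ring
    · ring

/-- A bias of order `1 / √T` cannot be detected in `T` rounds, and playing the wrong sign costs
order `σ / √T` in each. -/
lemma exists_le_expectedRegret_one {m σ : ℝ} (hm : 0 < m) (hm1 : m ≤ 1 / 4) (hσ : 0 < σ)
    (hσm : σ * (1 + 4 * m) ≤ 1) {p : ℝ≥0∞} {q : ℝ} (h : DualExponents p q) {T : ℕ} (hT : 1 ≤ T)
    {S : Type*} [MeasurableSpace S] (μ : Measure S) [IsProbabilityMeasure μ]
    (alg : Algorithm (lpBall 1 p) S) :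
    ∃ (ν : Measure (Fin 1 → ℝ)) (_ : IsProbabilityMeasure ν) (aStar : Fin 1 → ℝ),
      (∀ᵐ θ ∂ν, ∀ a ∈ lpBall 1 p, |a ⬝ᵥ θ| ≤ 1) ∧ sigmaSq q ν = σ ^ 2 ∧ aStar ∈ lpBall 1 p ∧
      IsMaxOn (fun a => a ⬝ᵥ meanVec ν) (lpBall 1 p) aStar ∧
      m / 6 * (√T * σ) ≤ alg.expectedRegret μ ν aStar T := by
  have hq := h.one_le
  have hT' : (1 : ℝ) ≤ T := by exact_mod_cast hT
  have hτ : 1 ≤ √(T : ℝ) := Real.one_le_sqrt.2 hT'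
  have hτT : √(T : ℝ) ^ 2 = T := Real.sq_sqrt (by linarith)
  set τ := √(T : ℝ)
  set δ := m / τ with hδ
  have hδ0 : 0 < δ := by positivity
  have hδm : δ ≤ m := div_le_self hm.le hτ
  have hδ1 : 0 < 1 - δ ^ 2 := by nlinarith
  -- The bias lowers the variance by the factor `1 - δ ^ 2`; the radius `σ * b` compensates for it
  -- exactly.
  obtain ⟨b, hb0, hb⟩ : ∃ b : ℝ, 0 < b ∧ b ^ 2 * (1 - δ ^ 2) = 1 := by
    refine ⟨√(1 - δ ^ 2)⁻¹, by positivity, ?_⟩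
    rw [Real.sq_sqrt (by positivity), inv_mul_cancel₀ hδ1.ne']
  have hb1 : 1 ≤ b := by
    by_contra! hlt
    nlinarith [sq_nonneg δ, mul_pos hb0 hδ1]
  have hbm : b ≤ 1 + 4 * m := by
    by_contra! hlt
    have h1 : (1 + 4 * m) ^ 2 < b ^ 2 := by gcongr
    have h2 : 1 - m ^ 2 ≤ 1 - δ ^ 2 := by gcongr
    have h3 : 0 < 1 - m ^ 2 := by nlinarith
    have h4 : (1 + 4 * m) ^ 2 * (1 - m ^ 2) < 1 := by nlinarith [sq_nonneg b]
    nlinarith [pow_pos hm 2, pow_pos hm 3]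
  have hsδ : ∀ y : Bool, |δ * sgn y| ≤ 1 / 2 := fun y => by
    rw [abs_mul, abs_sgn, mul_one, abs_of_pos hδ0]; linarith
  have hsδ1 : ∀ y : Bool, |δ * sgn y| ≤ 1 := fun y => (hsδ y).trans (by norm_num)
  have hprob : ∀ x : Fin 1 → Bool, IsProbabilityMeasure (coinLaw (σ * b) (δ * sgn (x 0))) :=
    fun x => isProbabilityMeasure_coinLaw (hsδ1 _)
  have hdot : ∀ (x : Fin 1 → Bool) (a : Fin 1 → ℝ),
      a ⬝ᵥ meanVec (coinLaw (σ * b) (δ * sgn (x 0))) = σ * b * δ * (sgn (x 0) * a 0) :=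
        fun x a => by
    rw [meanVec_coinLaw (hsδ1 _)]; simp [dotProduct]; ring
  have hsa : ∀ (y : Bool), ∀ a ∈ lpBall 1 p, sgn y * a 0 ≤ 1 := fun y a ha => by
    refine (le_abs_self _).trans ?_
    rw [abs_mul, abs_sgn, one_mul]
    exact h.abs_le_one ha 0
  have hK : 0 < σ * b * δ := by positivity
  obtain ⟨x, hx⟩ := alg.exists_le_expectedRegret (fun a ha => h.abs_le_one ha) μ (n := 1) (T := T)
    id
    (fun x => coinLaw (σ * b) (δ * sgn (x 0))) (fun x _ => sgn (x 0))
    (info := fun _ _ => 8 * δ ^ 2) (fun _ => measurable_const) (fun _ _ => by positivity)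
    (K := 8 * δ ^ 2) (fun _ _ _ => le_rfl)
    (fun x i a ha G hG hG0 hG1 => by
      obtain rfl : i = 0 := Subsingleton.elim _ _
      have := integral_coinLaw_le_log (r := σ * b) (hsδ (x 0)) a hG hG0 hG1
      rw [mul_pow, sq (sgn (x 0)), sgn_mul_self, mul_one] at this
      simpa only [flip_self, sgn_not, mul_neg] using this)
    (L := 3 / (σ * b * δ)) (by positivity)
    (fun x a ha => by
      -- Since `m ≤ 1/4`, this is at most the allowance `n / 2 = 1/2`.
      have e1 : (T : ℝ) * (8 * δ ^ 2) = 8 * m ^ 2 := by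
        rw [← hτT, hδ]; field_simp
      rw [sub_dotProduct, hdot, hdot, ← mul_sub, ← mul_assoc (3 / (σ * b * δ)),
        div_mul_cancel₀ _ hK.ne', sgn_mul_self]
      simp only [Finset.univ_unique, Finset.sum_singleton, id, e1, Fin.default_eq_zero]
      have h2 : wrongSign (x 0) (a 0) ≤ 1 - sgn (x 0) * a 0 := by
        unfold wrongSign
        split_ifs with h3
        · linarith
        · linarith [hsa (x 0) a ha]
      push_cast
      nlinarith)
  have hmem : (fun _ => sgn (x 0) : Fin 1 → ℝ) ∈ lpBall 1 p := by
    rcases h.cases with ⟨rfl, _⟩ | ⟨P, rfl, hP, hc⟩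
    · simp [mem_lpBall_top]
    · rw [mem_lpBall_ofReal (by linarith)]; simp
  refine ⟨_, hprob x, _, ?_, ?_, hmem, ?_, ?_⟩
  · filter_upwards [ae_coinLaw (r := σ * b) (by positivity)] with y hy a ha
    have e : a ⬝ᵥ y = a 0 * y 0 := by simp [dotProduct]
    rw [e, abs_mul, hy]
    have h1 := h.abs_le_one ha 0
    have h2 : σ * b ≤ 1 := (mul_le_mul_of_nonneg_left hbm hσ.le).trans hσm
    exact mul_le_one₀ h1 (by positivity) h2
  · have e : (σ * b) ^ 2 * (1 - (δ * sgn (x 0)) ^ 2) = σ ^ 2 := by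
      rw [mul_pow δ, sq (sgn (x 0)), sgn_mul_self]
      linear_combination σ ^ 2 * hb
    unfold sigmaSq
    simp only [Finset.univ_unique, Finset.sum_singleton, covMatrix_coinLaw (hsδ1 _), e]
    rw [← Real.rpow_mul (by positivity)]
    have : q / 2 * (2 / q) = 1 := by field_simp
    rw [this, Real.rpow_one]
  · intro a ha
    simp only [Set.mem_ofPred_eq, hdot, sgn_mul_self]
    exact mul_le_mul_of_nonneg_left (hsa _ a ha) hK.le
  · refine le_trans ?_ hx
    have e : ((1 : ℕ) : ℝ) * T / (2 * (3 / (σ * b * δ))) = m / 6 * (τ * (σ * b)) := by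
      rw [← hτT, hδ]; push_cast; field_simp
      norm_num
    rw [e]
    gcongr
    exact le_mul_of_one_le_right hσ.le hb1

end Coin

/-! ### Balancing errors, information and regret; choice of scales. -/

section LowerBound

variable {n : ℕ} {p : ℝ≥0∞} {q m τ : ℝ}

/-- Every action either errs in many signs, or gains much information, or has a large regret. -/
lemma sum_wrongSign_add_hardInfo_le {C c κ v : ℝ} (h : DualExponents p q)
    (hm : 0 < m) (hτ : 1 ≤ τ) (hnτ : n ≤ τ) (hc0 : 0 < c)
    (hc : c ≤ 1 / 64) (hcC : 768 * C * c ≤ 1) (hκv : κ * v = m * (c / τ) ^ (1 / q)) (hv : 0 < v)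
    (hvτ : τ * (κ * v) ^ 2 ≤ v) (x : Fin n → Bool) {a : Fin (n + 1) → ℝ}
    (ha : a ∈ lpBall (n + 1) p) :
    ∑ i, (3 * wrongSign (x i) (a i.succ) + τ ^ 2 * hardInfo (C / m ^ 2) v κ i a)
      ≤ n / 2 + 7 * τ / c * ((1 + n * (c / τ)) ^ (1 / q) - a ⬝ᵥ hardMean q (c / τ) x) := by
  have hτ0 : 0 < τ := by linarith
  have hq := h.one_le
  set z := c / τ with hz
  have hz0 : 0 < z := by positivity
  have hnz : n * z ≤ c := by
    rw [hz, mul_div_assoc', div_le_iff₀ hτ0, mul_comm c]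
    gcongr
  have hnz0 : 0 ≤ n * z := by positivity
  have hroot : 1 ≤ (1 + n * z) ^ (1 / q) := Real.one_le_rpow (by linarith) (by positivity)
  rw [Finset.sum_add_distrib, ← Finset.mul_sum, ← Finset.mul_sum]
  by_cases ha0 : 1 / 2 ≤ a 0
  · let l : Fin n → ℝ := fun i => sgn (x i) * a i.succ / z ^ (1 - 1 / q)
    have hy0 : 0 < z ^ (1 - 1 / q) := by positivity
    -- The factor `1 / m ^ 2` of the shift constant cancels against `m ^ 2` in the squared mean.
    -- What remains is `48 * C * c ^ 2 * l i ^ 2`, at most `l i ^ 2 / 16`, and `l ^ 2 ≤ 2 + 2 * (l -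
    -- 1) ^ 2`.
    have hI : ∀ i : Fin n, τ ^ 2 * hardInfo (C / m ^ 2) v κ i a ≤ 1 / 8 + (l i - 1) ^ 2 / 8 :=
        fun i => by
      have e1 : z ^ (1 / q) * z ^ (1 - 1 / q) = z := by
        rw [← Real.rpow_add hz0, add_sub_cancel, Real.rpow_one]
      have e2 : z ^ (1 / q) * (sgn (x i) * a i.succ) = z * l i := by
        have : sgn (x i) * a i.succ = z ^ (1 - 1 / q) * l i := by
          simp only [l]; field_simp
        rw [this, ← mul_assoc, e1]
      have e3 : τ * z = c := by rw [hz]; field_simp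
      have e4 : τ ^ 2 * hardInfo (C / m ^ 2) v κ i a = 48 * C * c ^ 2 * l i ^ 2 := by
        unfold hardInfo
        rw [if_pos ha0]
        calc τ ^ 2 * (8 * κ ^ 2 * (6 * (C / m ^ 2) * v ^ 2 * a i.succ ^ 2))
            = 48 * C * (τ ^ 2 * ((κ * v) ^ 2 / m ^ 2) * a i.succ ^ 2) := by ring
          _ = 48 * C * (τ ^ 2 * (z ^ (1 / q) * (sgn (x i) * a i.succ)) ^ 2) := by
              have : (sgn (x i) * a i.succ) ^ 2 = a i.succ ^ 2 := by
                rw [mul_pow, sq (sgn (x i)), sgn_mul_self, one_mul]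
              rw [hκv, mul_pow m, mul_div_cancel_left₀ _ (by positivity), mul_pow (z ^ (1 / q)),
                this]
              ring
          _ = 48 * C * c ^ 2 * l i ^ 2 := by rw [e2, ← e3]; ring
      have e5 : 48 * C * c ^ 2 ≤ 1 / 16 := by nlinarith
      rw [e4]
      have := mul_le_mul_of_nonneg_right e5 (sq_nonneg (l i))
      nlinarith [sq_nonneg (l i - 2)]
    -- A wrong sign means `l i ≤ 0`, at distance at least `1` from the optimal proportion `1`.
    have hW : ∀ i : Fin n, wrongSign (x i) (a i.succ) ≤ (l i - 1) ^ 2 := fun i => by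
      unfold wrongSign
      split_ifs with h1
      · have : l i ≤ 0 := div_nonpos_of_nonpos_of_nonneg h1 hy0.le
        nlinarith
      · positivity
    have h1 := Finset.sum_le_sum fun i (_ : i ∈ Finset.univ) => hI i
    have h2 := Finset.sum_le_sum fun i (_ : i ∈ Finset.univ) => hW i
    have h3 := dot_hardMean_le_sub h hz0 x ha
    have h4 := one_add_div_sub_le_rpow hq hnz0
    rw [Finset.sum_add_distrib, ← Finset.mul_sum] at h1
    simp only [Finset.sum_const, Finset.card_univ, Fintype.card_fin, nsmul_eq_mul] at h1
    rw [← Finset.sum_div] at h1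
    set s := ∑ i, (l i - 1) ^ 2
    set R := (1 + n * z) ^ (1 / q) - a ⬝ᵥ hardMean q z x with hR
    have h5 : z / 2 * s ≤ R + (n * z) ^ 2 := by rw [hR]; linarith
    have h6 : s ≤ 2 * (τ / c) * R + n / 32 := by
      have e : 2 * (τ / c) * (z / 2) = 1 := by rw [hz]; field_simp
      have := mul_le_mul_of_nonneg_left h5 (by positivity : 0 ≤ 2 * (τ / c))
      rw [← mul_assoc, e, one_mul] at this
      have e2 : 2 * (τ / c) * (n * z) ^ 2 = 2 * n * (n * z) := by rw [hz]; field_simp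
      have e3 : (n : ℝ) * (n * z) ≤ n * (1 / 64) := by gcongr; linarith
      linarith
    have hR0 : 0 ≤ R := sub_nonneg.2 (dot_hardMean_le h hz0 x ha)
    have h7 : 0 ≤ τ / c * R := by positivity
    have e : 7 * τ / c * R = 7 * (τ / c * R) := by ring
    rw [e]
    have hn0 : (0 : ℝ) ≤ n := Nat.cast_nonneg n
    linarith
  · have h1 := dot_hardMean_le_of_lt_half h hz0 (hnz.trans hc) x ha (not_le.1 ha0)
    -- Without the cover of the noise the information is shared among the signs: the fractions `a i
    -- ^ 2 / ∑ a j ^ 2` sum to at most `1`, also when the denominator is zero.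
    have hI : τ ^ 2 * ∑ i : Fin n, hardInfo (C / m ^ 2) v κ i a ≤ 8 * τ := by
      simp only [hardInfo, if_neg ha0]
      rw [← Finset.mul_sum, ← Finset.mul_sum, ← Finset.sum_div]
      have h2 := div_self_le_one (∑ j : Fin n, a j.succ ^ 2)
      have h3 : τ ^ 2 * κ ^ 2 * v ≤ τ := by
        have h4 : v * (τ * (τ * κ ^ 2 * v)) ≤ v * (τ * 1) := by
          nlinarith
        linarith [le_of_mul_le_mul_left h4 hv]
      calc _ = 8 * (τ ^ 2 * κ ^ 2 * v)
            * ((∑ j : Fin n, a j.succ ^ 2) / ∑ j : Fin n, a j.succ ^ 2) := by ring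
        _ ≤ 8 * τ * 1 := by gcongr
        _ = 8 * τ := mul_one _
    have hW : ∑ i : Fin n, wrongSign (x i) (a i.succ) ≤ n := by
      have := Finset.sum_le_sum fun i (_ : i ∈ Finset.univ) => wrongSign_le_one (x i) (a i.succ)
      simpa using this
    have h5 : 448 * τ ≤ 7 * τ / c := by
      rw [le_div_iff₀ hc0]; nlinarith
    -- The constant loss `3/8` is weighted by `7 * τ / c ≥ 448 * τ`, far more than the at most `3 *
    -- n + 8 * τ` to be paid.
    have h6 : 448 * τ * (3 / 8) ≤ 7 * τ / c * ((1 + n * z) ^ (1 / q) - a ⬝ᵥ hardMean q z x) :=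
      mul_le_mul h5 (by linarith) (by norm_num) (by positivity)
    have hn0 : (0 : ℝ) ≤ n := Nat.cast_nonneg n
    linarith

lemma hardInfo_nonneg {C v : ℝ} (hC : 0 ≤ C) (hv : 0 ≤ v) (κ : ℝ) (i : Fin n)
    (a : Fin (n + 1) → ℝ) : 0 ≤ hardInfo C v κ i a := by
  have : 0 ≤ ∑ j : Fin n, a j.succ ^ 2 := Finset.sum_nonneg fun j _ => sq_nonneg _
  unfold hardInfo
  split_ifs <;> positivity

lemma hardInfo_le {C v : ℝ} (hC : 0 ≤ C) (hv : 0 ≤ v) (κ : ℝ) (i : Fin n)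
    {a : Fin (n + 1) → ℝ} (ha : |a i.succ| ≤ 1) :
    hardInfo C v κ i a ≤ 8 * κ ^ 2 * (6 * C * v ^ 2 + v) := by
  unfold hardInfo
  refine mul_le_mul_of_nonneg_left ?_ (by positivity)
  split_ifs
  · have h1 : a i.succ ^ 2 ≤ 1 := by rwa [sq_le_one_iff_abs_le_one]
    have : 6 * C * v ^ 2 * a i.succ ^ 2 ≤ 6 * C * v ^ 2 := mul_le_of_le_one_right (by positivity) h1
    linarith
  · have h1 : a i.succ ^ 2 / ∑ j : Fin n, a j.succ ^ 2 ≤ 1 :=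
      div_le_one_of_le₀ (Finset.single_le_sum (f := fun j : Fin n => a j.succ ^ 2)
        (fun j _ => sq_nonneg _) (Finset.mem_univ i)) (Finset.sum_nonneg fun j _ => sq_nonneg _)
    have := mul_le_of_le_one_right hv h1
    have : 0 ≤ 6 * C * v ^ 2 := by positivity
    linarith

/-- The consequences of the horizon being long. -/
lemma long_horizon (hq : 1 ≤ q) (hq2 : q < 2) (hn : 0 < n) (hτ : 0 < τ)
    (hT : ((n + 1 : ℕ) : ℝ) ^ (4 / (2 - q)) ≤ τ ^ 2) :
    (n : ℝ) ^ 2 ≤ τ ∧ τ * ((n / τ) ^ (1 / q)) ^ 2 ≤ 1 := by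
  have hn1 : (1 : ℝ) ≤ n := by exact_mod_cast hn
  have hn0 : (0 : ℝ) < n := by linarith
  have h2q : 0 < 2 - q := by linarith
  have h1 : (n : ℝ) ^ (2 / (2 - q)) ≤ τ := by
    have h2 : ((n : ℝ) ^ (2 / (2 - q))) ^ 2 ≤ τ ^ 2 := by
      rw [← Real.rpow_mul_natCast hn0.le]
      have : 2 / (2 - q) * ((2 : ℕ) : ℝ) = 4 / (2 - q) := by push_cast; ring
      rw [this]
      refine le_trans (Real.rpow_le_rpow hn0.le ?_ (by positivity)) hT
      push_cast; linarith
    exact le_of_sq_le_sq h2 hτ.le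
  constructor
  · refine le_trans ?_ h1
    rw [← Real.rpow_natCast]
    refine Real.rpow_le_rpow_of_exponent_le hn1 ?_
    rw [le_div_iff₀ h2q]
    push_cast; linarith
  · have h3 : (n : ℝ) ^ (2 / q) ≤ τ ^ ((2 - q) / q) := by
      have := Real.rpow_le_rpow (by positivity) h1 (by positivity : 0 ≤ (2 - q) / q)
      rw [← Real.rpow_mul hn0.le] at this
      have e : 2 / (2 - q) * ((2 - q) / q) = 2 / q := by field_simp
      rwa [e] at this
    have e1 : 1 / q * ((2 : ℕ) : ℝ) = 2 / q := by push_cast; ring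
    rw [← Real.rpow_mul_natCast (by positivity), e1, Real.div_rpow hn0.le hτ.le,
      mul_div_assoc', div_le_one (by positivity)]
    have e2 : τ * τ ^ ((2 - q) / q) = τ ^ (2 / q) := by
      have : 2 / q = 1 + (2 - q) / q := by field_simp; ring
      rw [this, Real.rpow_add hτ, Real.rpow_one]
    rw [← e2]
    gcongr

/-- The scales of the hard instance. -/
lemma exists_scales {c : ℝ} (hq : 1 ≤ q) (hn : 0 < n) (hτ0 : 0 < τ) (hnτ2 : (n : ℝ) ^ 2 ≤ τ)
    (huτ : τ * ((n / τ) ^ (1 / q)) ^ 2 ≤ 1) (hm : 0 < m) (hm1 : m ≤ 1 / 4) (hc0 : 0 < c)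
    (hc : c ≤ 1 / 64) {Δ : ℝ} (hΔ : Δ = m * (c / τ) ^ (1 / q)) :
    ∃ b w v : ℝ, 0 < b ∧ 1 / 2 ≤ w ∧ w ^ q = 1 / 2 ∧ n * b ^ q = 1 / 2 ∧ v = b ^ 2 + Δ ^ 2 ∧
      √v ≤ b * (1 + m) ∧ |Δ / v| * (n * √v) ≤ 1 / 2 ∧ τ * Δ ^ 2 ≤ v := by
  have hq0 : q ≠ 0 := by linarith
  have hn1 : (1 : ℝ) ≤ n := by exact_mod_cast hn
  have hn0 : (0 : ℝ) < n := by linarith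
  set u := ((n : ℝ) / τ) ^ (1 / q)
  have hu0 : 0 ≤ u := by positivity
  have hnu : n * u ≤ 1 := by
    have : (n * u) ^ 2 ≤ 1 := by
      rw [mul_pow]
      exact (mul_le_mul_of_nonneg_right hnτ2 (sq_nonneg u)).trans huτ
    exact (sq_le_one_iff₀ (by positivity)).1 this
  have hu1 : u ≤ 1 := le_trans (by nlinarith) hnu
  set z := c / τ with hz
  have hz0 : 0 < z := by positivity
  -- The budget `σ_q^q = σ^q` is split evenly: half goes to coordinate `0` through `w ^ q = 1/2`,
  -- half to the other coordinates through `n * b ^ q = 1/2`.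
  set b := (2 * (n : ℝ)) ^ (-(1 / q)) with hb
  have hb0 : 0 < b := by positivity
  have hΔ0 : 0 < Δ := by rw [hΔ]; positivity
  -- This is `2 * n * c / τ ≤ n / τ` raised to the power `1 / q`. The mean `Δ` is thus small against
  -- the standard deviation `b`, which gives the bounds on the tilt and on `τ * Δ ^ 2`.
  have hΔb : Δ ≤ m * (u * b) := by
    rw [hΔ]
    refine mul_le_mul_of_nonneg_left ?_ hm.le
    rw [hb, Real.rpow_neg (by positivity), ← div_eq_mul_inv, le_div_iff₀ (by positivity),
      ← Real.mul_rpow hz0.le (by positivity)]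
    refine Real.rpow_le_rpow (by positivity) ?_ (by positivity)
    rw [hz, div_mul_eq_mul_div]
    gcongr
    nlinarith
  -- The tilt reduces the variance by `Δ ^ 2`, so this makes the final variance exactly `b ^ 2`.
  set v := b ^ 2 + Δ ^ 2 with hv
  have hv0 : 0 < v := by positivity
  have hbv : b ≤ √v := Real.le_sqrt_of_sq_le (by rw [hv]; nlinarith [sq_nonneg Δ])
  have hvb : √v ≤ b * (1 + m) := by
    have h1 : √v ≤ b + Δ := by
      rw [Real.sqrt_le_left (by positivity)]
      nlinarith [mul_pos hb0 hΔ0]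
    have h2 : u * b ≤ b := mul_le_of_le_one_left hb0.le hu1
    nlinarith
  have hκ : |Δ / v| * (n * √v) ≤ 1 / 2 := by
    rw [abs_of_pos (by positivity)]
    have e : Δ / v * (n * √v) = n * Δ / √v := by
      have : v = √v * √v := (Real.mul_self_sqrt hv0.le).symm
      have hs : √v ≠ 0 := (Real.sqrt_pos.2 hv0).ne'
      rw [div_mul_eq_mul_div, div_eq_div_iff hv0.ne' hs]
      linear_combination -(n * Δ) * this
    rw [e, div_le_iff₀ (Real.sqrt_pos.2 hv0)]
    calc n * Δ ≤ n * (m * (u * b)) := by gcongr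
      _ = m * (n * u) * b := by ring
      _ ≤ 1 / 2 * 1 * √v := by gcongr; linarith
      _ = 1 / 2 * √v := by ring
  have hvτ : τ * Δ ^ 2 ≤ v := by
    have h1 : Δ ^ 2 ≤ (m * (u * b)) ^ 2 := by gcongr
    calc τ * Δ ^ 2 ≤ τ * (m * (u * b)) ^ 2 := by gcongr
      _ = m ^ 2 * (τ * u ^ 2) * b ^ 2 := by ring
      _ ≤ 1 * 1 * b ^ 2 := by gcongr; nlinarith
      _ ≤ v := by rw [hv]; nlinarith [sq_nonneg Δ]
  set w := (2 : ℝ) ^ (-(1 / q)) with hw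
  have hw0 : 0 < w := by positivity
  have hw1 : 1 / 2 ≤ w := by
    have : (2 : ℝ) ^ (-1 : ℝ) ≤ w :=
      Real.rpow_le_rpow_of_exponent_le (by norm_num)
        (neg_le_neg ((div_le_one (by linarith)).2 hq))
    rwa [Real.rpow_neg_one, ← one_div] at this
  have hwq : w ^ q = 1 / 2 := by
    rw [hw, ← Real.rpow_mul (by norm_num), neg_mul, one_div_mul_cancel hq0, Real.rpow_neg_one,
      one_div]
  have hbq : n * b ^ q = 1 / 2 := by
    rw [hb, ← Real.rpow_mul (by positivity), neg_mul, one_div_mul_cancel hq0, Real.rpow_neg_one]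
    field_simp
  exact ⟨b, w, v, hb0, hw1, hwq, hbq, hv, hvb, hκ, hvτ⟩

lemma exists_le_expectedRegret_succ {C c σ : ℝ}
    (hC : ∀ w ρ, 0 < ρ → ρ ≤ w → ∃ η, IsProbabilityMeasure η ∧ IsNoise η w ρ (C / ρ ^ 2))
    (hC0 : 0 < C) (hm : 0 < m) (hm1 : m ≤ 1 / 4) (hc0 : 0 < c)
    (hc : c ≤ 1 / 64) (hcC : 768 * C * c ≤ 1) (hσ : 0 < σ) (hσm : σ * (1 + 4 * m) ≤ 1)
    (h : DualExponents p q) (hn : 0 < n) {T : ℕ}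
    (hT : ((n + 1 : ℕ) : ℝ) ^ (4 / (2 - q)) ≤ T)
    {S : Type*} [MeasurableSpace S] (μ : Measure S) [IsProbabilityMeasure μ]
    (alg : Algorithm (lpBall (n + 1) p) S) :
    ∃ (ν : Measure (Fin (n + 1) → ℝ)) (_ : IsProbabilityMeasure ν) (aStar : Fin (n + 1) → ℝ),
      (∀ᵐ θ ∂ν, ∀ a ∈ lpBall (n + 1) p, |a ⬝ᵥ θ| ≤ 1) ∧ sigmaSq q ν = σ ^ 2 ∧
      aStar ∈ lpBall (n + 1) p ∧ IsMaxOn (fun a => a ⬝ᵥ meanVec ν) (lpBall (n + 1) p) aStar ∧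
      c * m / 14 * (n * (√T * σ)) ≤ alg.expectedRegret μ ν aStar T := by
  have hq := h.one_le
  have hq2 := h.lt_two
  have hq0 : q ≠ 0 := by linarith
  have hn1 : (1 : ℝ) ≤ n := by exact_mod_cast hn
  have hn0 : (0 : ℝ) < n := by linarith
  have hT0 : (0 : ℝ) < T := lt_of_lt_of_le (by positivity) hT
  have hτ0 : 0 < √(T : ℝ) := Real.sqrt_pos.2 hT0
  have hτT : √(T : ℝ) ^ 2 = T := Real.sq_sqrt hT0.le
  rw [← hτT] at hT
  obtain ⟨hnτ2, huτ⟩ := long_horizon hq hq2 hn hτ0 hT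
  set τ := √(T : ℝ)
  have hτ1 : 1 ≤ τ := le_trans (by nlinarith) hnτ2
  have hnτ : n ≤ τ := le_trans (by nlinarith) hnτ2
  set z := c / τ with hz
  have hz0 : 0 < z := by positivity
  obtain ⟨Δ, hΔ⟩ : ∃ Δ : ℝ, Δ = m * z ^ (1 / q) := ⟨_, rfl⟩
  obtain ⟨b, w, v, hb0, hw1, hwq, hbq, hv, hvb, hκ, hvτ⟩ :=
    exists_scales hq hn hτ0 hnτ2 huτ hm hm1 hc0 hc hΔ
  have hw0 : 0 < w := by linarith
  have hv0 : 0 < v := by rw [hv]; positivity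
  have hκv : Δ / v * v = Δ := div_mul_cancel₀ _ hv0.ne'
  rw [← hκv] at hvτ
  -- The smoothing width of the noise equals the mean shift `m`. Coordinate `0` is then at most `σ *
  -- (w + 2 * m)`, within `σ * (1 + 4 * m) * w` because `w ≥ 1/2`.
  obtain ⟨η, hηp, hη⟩ := hC w m hm (by linarith)
  have : NeZero n := ⟨hn.ne'⟩
  obtain ⟨Q, hQp, hQ⟩ := exists_isIsotropic (n := n) hv0.le
  have hprob : ∀ x, IsProbabilityMeasure (hardLaw η Q σ m (Δ / v) x) := fun x =>
    isProbabilityMeasure_hardLaw hQ hκ x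
  have hmean : ∀ x, meanVec (hardLaw η Q σ m (Δ / v) x) = (σ * m) • hardMean q z x := fun x => by
    funext k
    refine Fin.cases ?_ (fun i => ?_) k
    · rw [meanVec_hardLaw_zero hη hQ hκ]; simp [hardMean]
    · rw [meanVec_hardLaw_succ hQ hκ, hκv, hΔ]; simp [hardMean]; ring
  have hσm0 : 0 < σ * m := by positivity
  obtain ⟨x, hx⟩ := alg.exists_le_expectedRegret (fun a ha => h.abs_le_one ha) μ (T := T) Fin.succ
    (fun x => hardLaw η Q σ m (Δ / v) x) (fun x => bestAction q z x)
    (info := hardInfo (C / m ^ 2) v (Δ / v)) (measurable_hardInfo _ _ _)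
    (hardInfo_nonneg (by positivity) hv0.le _)
    (fun i a ha => hardInfo_le (by positivity) hv0.le _ i (h.abs_le_one ha i.succ))
    (fun x i a ha G hG hG0 hG1 =>
      integral_hardLaw_le_log (by positivity) hv0.le hη hQ hκ x i a hG hG0 hG1)
    (L := 7 * τ / c / (σ * m)) (by positivity)
    (fun x a ha => by
      have := sum_wrongSign_add_hardInfo_le h hm hτ1 hnτ hc0 hc hcC
        (hκv.trans hΔ) hv0 hvτ x ha
      rw [hτT] at this
      refine this.trans (le_of_eq ?_)
      rw [hmean, dotProduct_smul, sub_dotProduct, bestAction_dot hz0, smul_eq_mul, ← mul_assoc,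
        div_mul_cancel₀ _ hσm0.ne'])
  refine ⟨_, hprob x, _, ?_, ?_, bestAction_mem h hz0 x, ?_, ?_⟩
  · filter_upwards [ae_hardLaw hη hQ x hm.le hσ.le] with y hy a ha
    -- By Hölder it suffices that the `ℓ_q` norm of the parameter is at most `1`. Both halves of the
    -- budget are exceeded by at most the factor `1 + 4 * m`, which `hσm` absorbs.
    refine (h.abs_dot_le ha y).trans (Real.rpow_le_one (by positivity) ?_ (by positivity))
    rw [Fin.sum_univ_succ]
    have hD : 0 ≤ σ * (1 + 4 * m) := by positivity
    have h1 : |y 0| ^ q ≤ (σ * (1 + 4 * m) * w) ^ q := by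
      refine Real.rpow_le_rpow (abs_nonneg _) (hy.1.trans ?_) (by linarith)
      rw [mul_assoc]
      refine mul_le_mul_of_nonneg_left ?_ hσ.le
      nlinarith
    have h2 : ∑ i : Fin n, |y i.succ| ^ q ≤ n * (σ * (1 + 4 * m) * b) ^ q := by
      have h3 := sum_abs_rpow_le hq hq2 hn (v := σ ^ 2 * v) (by positivity)
        (y := fun i => y i.succ) (by rw [hy.2]; ring)
      refine h3.trans ?_
      rw [Real.sqrt_mul (by positivity), Real.sqrt_sq hσ.le]
      refine mul_le_mul_of_nonneg_left (Real.rpow_le_rpow (by positivity) ?_ (by linarith)) hn0.le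
      rw [mul_assoc]
      refine mul_le_mul_of_nonneg_left (hvb.trans ?_) hσ.le
      nlinarith
    rw [Real.mul_rpow hD hw0.le, hwq] at h1
    rw [Real.mul_rpow hD hb0.le, mul_left_comm, hbq] at h2
    have h4 : (σ * (1 + 4 * m)) ^ q ≤ 1 := Real.rpow_le_one hD hσm (by linarith)
    linarith
  · unfold sigmaSq
    have e1 : ∀ t : ℝ, 0 < t → (σ ^ 2 * t ^ 2) ^ (q / 2) = σ ^ q * t ^ q := fun t ht => by
      rw [← mul_pow, ← Real.rpow_natCast_mul (by positivity), ← Real.mul_rpow hσ.le ht.le]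
      congr 1
      push_cast; ring
    have e2 : v - (Δ / v * v) ^ 2 = b ^ 2 := by rw [hκv, hv]; ring
    rw [Fin.sum_univ_succ, covMatrix_hardLaw_zero hη hQ hκ x hm.le hσ.le, e1 w hw0]
    simp only [covMatrix_hardLaw_succ hη hQ hκ x hm.le hσ.le, e2, e1 b hb0, Finset.sum_const,
      Finset.card_univ, Fintype.card_fin, nsmul_eq_mul]
    rw [mul_left_comm, hbq, hwq, ← mul_add, add_halves, mul_one, ← Real.rpow_mul hσ.le,
      mul_div_cancel₀ _ hq0, Real.rpow_two]
  · intro a ha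
    simp only [Set.mem_ofPred_eq, hmean, dotProduct_smul, smul_eq_mul, bestAction_dot hz0]
    exact mul_le_mul_of_nonneg_left (dot_hardMean_le h hz0 x ha) hσm0.le
  · refine le_trans (le_of_eq ?_) hx
    rw [← hτT]
    field_simp
    norm_num

end LowerBound

end ParameterNoiseBandit

/-! ### Choice of constants and conclusion. -/

open ParameterNoiseBandit in
theorem mainTheorem6 :
    ∃ k : ℕ, ∀ s : ℝ, s < 1 → ∃ c : ℝ, 0 < c ∧
      ∀ (p : ℝ≥0∞) (q : ℝ), 2 < p → ENNReal.HolderConjugate p (ENNReal.ofReal q) →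
      ∀ (d T : ℕ), 1 ≤ d → (d : ℝ) ^ (4 / (2 - q)) ≤ (T : ℝ) →
      ∀ σ2 : ℝ, 0 < σ2 → σ2 ≤ s →
      ∀ (S : Type*) [MeasurableSpace S] (μ : Measure S) [IsProbabilityMeasure μ]
        (alg : ParameterNoiseBandit.Algorithm (ParameterNoiseBandit.lpBall d p) S),
      ∃ (ν : Measure (Fin d → ℝ)) (_ : IsProbabilityMeasure ν) (aStar : Fin d → ℝ),
        (∀ᵐ θ ∂ν, ∀ a ∈ ParameterNoiseBandit.lpBall d p, |a ⬝ᵥ θ| ≤ 1) ∧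
        ParameterNoiseBandit.sigmaSq q ν = σ2 ∧
        aStar ∈ ParameterNoiseBandit.lpBall d p ∧
        IsMaxOn (fun a => a ⬝ᵥ ParameterNoiseBandit.meanVec ν)
          (ParameterNoiseBandit.lpBall d p) aStar ∧
        c * ((d : ℝ) * Real.sqrt ((T : ℝ) * σ2)) / (1 + Real.log (T : ℝ)) ^ k
          ≤ alg.expectedRegret μ ν aStar T := by
  obtain ⟨C, hC0, hC⟩ := exists_isNoise
  -- The bound holds without logarithmic factors.
  refine ⟨0, fun s hs => ?_⟩
  obtain ⟨m, hm, hm1, hms⟩ : ∃ m : ℝ, 0 < m ∧ m ≤ 1 / 4 ∧ ∀ σ : ℝ, 0 < σ → σ ^ 2 ≤ s →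
      σ * (1 + 4 * m) ≤ 1 := by
    by_cases hs0 : 0 < s
    · have h1 : √s < 1 := (Real.sqrt_lt' one_pos).2 (by simpa using hs)
      -- With this `m`, `σ * (1 + 4 * m) ≤ √s * (2 - √s) = 1 - (1 - √s) ^ 2`. If `s ≤ 0`, no
      -- admissible `σ` exists.
      refine ⟨(1 - √s) / 4, by linarith, by linarith [Real.sqrt_nonneg s], fun σ hσ hσs => ?_⟩
      have h2 : σ ≤ √s := Real.le_sqrt_of_sq_le hσs
      nlinarith [Real.sqrt_nonneg s, sq_nonneg (1 - √s)]
    · exact ⟨1 / 4, by norm_num, le_rfl, fun σ hσ hσs => by nlinarith [pow_pos hσ 2]⟩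
  obtain ⟨c, hc0, hc, hcC⟩ : ∃ c : ℝ, 0 < c ∧ c ≤ 1 / 64 ∧ 768 * C * c ≤ 1 := by
    refine ⟨min (1 / 64) (1 / (768 * C)), by positivity, min_le_left _ _, ?_⟩
    have := min_le_right (1 / 64) (1 / (768 * C))
    rwa [le_div_iff₀ (by positivity), mul_comm] at this
  refine ⟨c * m / 28, by positivity, ?_⟩
  intro p q hp hpq d T hd hT σ2 hσ2 hσs S _ μ _ alg
  have h : DualExponents p q := ⟨hp, hpq⟩
  have hσ : 0 < √σ2 := Real.sqrt_pos.2 hσ2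
  have hsq : √σ2 ^ 2 = σ2 := Real.sq_sqrt hσ2.le
  have hσm := hms √σ2 hσ (by rwa [hsq])
  have hreg : 0 ≤ √(T : ℝ) * √σ2 := by positivity
  rw [Real.sqrt_mul (Nat.cast_nonneg T), pow_zero, div_one]
  obtain ⟨n, rfl⟩ : ∃ n, d = n + 1 := ⟨d - 1, by omega⟩
  rcases Nat.eq_zero_or_pos n with rfl | hn
  · have hT1 : 1 ≤ T := by simpa using hT
    obtain ⟨ν, hν, aStar, h1, h2, h3, h4, h5⟩ :=
      exists_le_expectedRegret_one hm hm1 hσ hσm h hT1 μ alg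
    refine ⟨ν, hν, aStar, h1, h2.trans hsq, h3, h4, le_trans ?_ h5⟩
    push_cast
    rw [one_mul]
    refine mul_le_mul_of_nonneg_right ?_ hreg
    nlinarith
  · obtain ⟨ν, hν, aStar, h1, h2, h3, h4, h5⟩ :=
      exists_le_expectedRegret_succ hC hC0 hm hm1 hc0 hc hcC hσ hσm h hn hT μ alg
    refine ⟨ν, hν, aStar, h1, h2.trans hsq, h3, h4, le_trans ?_ h5⟩
    have hn1 : (1 : ℝ) ≤ n := by exact_mod_cast hn
    -- Only `n = d - 1` coordinates carry signs; `d ≤ 2 * n` turns the constant `c * m / 14` into `c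
    -- * m / 28`.
    have h6 : ((n + 1 : ℕ) : ℝ) * (√(T : ℝ) * √σ2) ≤ 2 * (n * (√(T : ℝ) * √σ2)) := by
      push_cast; nlinarith
    have h7 : 0 ≤ c * m / 28 := by positivity
    nlinarith [mul_le_mul_of_nonneg_left h6 h7]
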